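/- Let $n,N\ge 1$ be integers. Notation. Put $Q=[-1/2,1/2)^n$, $\langle\eta\rangle=(1+|\eta_1|^2+\dots+|\eta_N|^2)^{1/2}$ for $\eta\in(\mathbb R^n)^N$, $\widehat f(\xi)=\int_{\mathbb R^n} e^{-ix\cdot\xi}f(x)\,dx$, and let $m(D)f=\mathcal F^{-1}[m\,\widehat f\,]$. For $0<q\le\infty$ the amalgam space $(L^2,\ell^q)=(L^2,\ell^q)(\mathbb R^n)$ consists of the measurable $f$ with $$\|f\|_{(L^2,\ell^q)}=\Big\{\sum_{\nu\in\mathbb Z^n}\Big(\int_Q|f(x+\nu)|^2dx\Big)^{q/2}\Big\}^{1/q}<\infty$$ (supremum over $\nu$ if $q=\infty$), and $\|F\|_{L^2_{ul}((\mathbb R^n)^{N+1})}=\sup_{\nu\in(\mathbb Z^n)^{N+1}}\big(\int_{Q^{N+1}}|F(X+\nu)|^2dX\big)^{1/2}$. For $\sigma\in L^\infty((\mathbb R^n)^{N+1})$ and $f_1,\dots,f_N\in\mathcal S(\mathbb R^n)$ let $$T_\sigma(f_1,\dots,f_N)(x)=\frac1{(2\pi)^{Nn}}\int_{(\mathbb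 R^n)^N}e^{ix\cdot(\xi_1+\dots+\xi_N)}\sigma(x,\xi_1,\dots,\xi_N)\prod_{j=1}^N\widehat{f_j}(\xi_j)\,d\xi_1\cdots d\xi_N .$$ Weights. A continuous $W:(\mathbb R^n)^N\to(0,\infty)$ is moderate if there are $C,M>0$ with $W(\xi+\eta)\le C\,W(\xi)\langle\eta\rangle^M$ for all $\xi,\eta$. A nonnegative function $V$ on $(\mathbb Z^n)^N$ belongs to $\mathcal B_N((\mathbb Z^n)^N)$ if there is $c\in(0,\infty)$ such that $$\sum_{\nu_1,\dots,\nu_N\in\mathbb Z^n}V(\nu_1,\dots,\nu_N)A_0(\nu_1+\dots+\nu_N)\prod_{j=1}^NA_j(\nu_j)\le c\prod_{j=0}^N\|A_j\|_{\ell^2(\mathbb Z^n)}$$ for all nonnegative functions $A_0,\dots,A_N$ on $\mathbb Z^n$. Symbol class. Let $\phi\in\mathcal S(\mathbb R^n)$ satisfy $\phi(y)=1$ for $|y|\le1$ and $\operatorname{supp}\phi\subset\{|y|\le2\}$; put $\psi(y)=\phi(y)-\phi(2y)$, $\psi_0=\phi$ and $\psi_k=\psi(\cdot/2^k)$ for $k\ge1$.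 For $\boldsymbol k=(k_0,\dots,k_N)\in\mathbb N_0^{N+1}$ put $\Delta_{\boldsymbol k}\sigma=\psi_{k_0}(D_x)\psi_{k_1}(D_{\xi_1})\cdots\psi_{k_N}(D_{\xi_N})\sigma$. For $\boldsymbol s\in[0,\infty)^{N+1}$ and $0<t<\infty$, $S^W_{0,0}(\boldsymbol s,t;\mathbb R^n,N)$ is the set of all $\sigma\in L^\infty((\mathbb R^n)^{N+1})$ with $$\Big\{\sum_{\boldsymbol k\in\mathbb N_0^{N+1}}\big(2^{\boldsymbol s\cdot\boldsymbol k}\big)^t\,\big\|W(\xi_1,\dots,\xi_N)^{-1}\Delta_{\boldsymbol k}\sigma(x,\xi_1,\dots,\xi_N)\big\|_{L^2_{ul}((\mathbb R^n)^{N+1})}^t\Big\}^{1/t}<\infty .$$ Theorem. Let $W$ be moderate and suppose that the restriction of $W$ to $(\mathbb Z^n)^N$ belongs to $\mathcal B_N((\mathbb Z^n)^N)$. Let $q_1,\dots,q_N,r\in(0,\infty]$ satisfy $\sum_{j=1}^N1/q_j=1/r$, and let $s_0=n/2$ and $s_j=n/\min(2,q_j)$ for $j=1,\dots,N$. Then for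 every $\sigma\in S^W_{0,0}(\boldsymbol s,\min(1,r);\mathbb R^n,N)$ the operator $T_\sigma$ is bounded from $(L^2,\ell^{q_1})\times\dots\times(L^2,\ell^{q_N})$ to $(L^2,\ell^r)$, that is, there is a constant $A<\infty$ such that, for all $f_j\in\mathcal S(\mathbb R^n)\cap(L^2,\ell^{q_j})$, $j=1,\dots,N$, the function $T_\sigma(f_1,\dots,f_N)$ is measurable and $$\|T_\sigma(f_1,\dots,f_N)\|_{(L^2,\ell^r)}\le A\prod_{j=1}^N\|f_j\|_{(L^2,\ell^{q_j})}.$$ -/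

import Mathlib

open MeasureTheory
open scoped ENNReal NNReal SchwartzMap

noncomputable section

namespace MultiPsiDO

/-- The Euclidean space `ℝⁿ`. -/
abbrev E (n : ℕ) : Type := EuclideanSpace ℝ (Fin n)

/-- A lattice point of `ℤⁿ`, seen as a point of `ℝⁿ`. -/
def lat {n : ℕ} (ν : Fin n → ℤ) : E n := WithLp.toLp 2 (fun i => (ν i : ℝ))

/-- The unit cube `Q = [-1/2, 1/2)ⁿ`. -/
def cube (n : ℕ) : Set (E n) := {x | ∀ i, x i ∈ Set.Ico (-(1 / 2) : ℝ) (1 / 2)}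

/-- The (quasi-)norm of `ℓ^q` for a countable family of elements of `[0, ∞]`:
`(∑ a_k ^ q) ^ (1 / q)` for `0 < q < ∞` and `sup a_k` for `q = ∞`. -/
def seqNorm {K : Type*} [MeasurableSpace K] (q : ℝ≥0∞) (a : K → ℝ≥0∞) : ℝ≥0∞ :=
  eLpNorm a q Measure.count

/-! ### Amalgam spaces -/

/-- The amalgam (quasi-)norm `‖ ‖f (x + ν)‖_{L^p_x(Q)} ‖_{ℓ^q_ν(ℤⁿ)}`. -/
def amalgamNorm {n : ℕ} (p q : ℝ≥0∞) (f : E n → ℂ) : ℝ≥0∞ :=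
  seqNorm q (fun ν : Fin n → ℤ =>
    eLpNorm (fun x => f (x + lat ν)) p (volume.restrict (cube n)))

/-- Membership in the amalgam space `(L^p, ℓ^q)(ℝⁿ)`. -/
def MemAmalgam {n : ℕ} (p q : ℝ≥0∞) (f : E n → ℂ) : Prop :=
  AEStronglyMeasurable f volume ∧ amalgamNorm p q f < ∞

/-- The norm of the uniformly local space `L²_ul((ℝⁿ)^d)`. -/
def ulNorm {n d : ℕ} (F : (Fin d → E n) → ℂ) : ℝ≥0∞ :=
  ⨆ ν : Fin d → Fin n → ℤ,
    eLpNorm (fun X => F (X + fun j => lat (ν j))) 2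
      (volume.restrict {X : Fin d → E n | ∀ j, X j ∈ cube n})

/-! ### Multilinear pseudo-differential operators

Symbols are functions on `(ℝⁿ)^(N+1)`; the slot `0` is the variable `x`, the slots
`1, …, N` are the frequency variables. -/

/-- The Fourier transform `∫ e^{-i x·ξ} f(x) dx`. -/
def fourierHat {n : ℕ} (f : E n → ℂ) (ξ : E n) : ℂ :=
  ∫ x, Complex.exp (-(Complex.I * ((inner ℝ x ξ : ℝ) : ℂ))) * f x

/-- The inverse Fourier transform `(2π)⁻ⁿ ∫ e^{i x·ξ} g(ξ) dξ`. -/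
def fourierCheck {n : ℕ} (g : E n → ℂ) (x : E n) : ℂ :=
  ((2 * Real.pi : ℝ) : ℂ)⁻¹ ^ n *
    ∫ ξ, Complex.exp (Complex.I * ((inner ℝ x ξ : ℝ) : ℂ)) * g ξ

/-- The multilinear pseudo-differential operator `T_σ` with symbol `σ`. -/
def opT {n N : ℕ} (σ : (Fin (N + 1) → E n) → ℂ) (f : Fin N → E n → ℂ) (x : E n) : ℂ :=
  ((2 * Real.pi : ℝ) : ℂ)⁻¹ ^ (N * n) *
    ∫ ξ : Fin N → E n,
      Complex.exp (Complex.I * ((inner ℝ x (∑ j, ξ j) : ℝ) : ℂ)) *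
        σ (Fin.cons x ξ) * ∏ j, fourierHat (f j) (ξ j)

/-- `T` is bounded from `(L²,ℓ^{q₁}) × ⋯ × (L²,ℓ^{q_N})` to `(L²,ℓ^r)`: the norm inequality
holds, with one constant, for all Schwartz functions belonging to the domain spaces. -/
def BoundedOnAmalgams {n N : ℕ} (q : Fin N → ℝ≥0∞) (r : ℝ≥0∞)
    (T : (Fin N → E n → ℂ) → E n → ℂ) : Prop :=
  ∃ A : ℝ≥0, ∀ f : Fin N → 𝓢(E n, ℂ), (∀ j, MemAmalgam 2 (q j) (f j)) →
    AEStronglyMeasurable (T fun j => f j) volume ∧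
    amalgamNorm 2 r (T fun j => f j) ≤ A * ∏ j, amalgamNorm 2 (q j) (f j)

/-! ### Weights -/

/-- The class `𝓑_N((ℤⁿ)^N)`. -/
def ClassB (n N : ℕ) (V : (Fin N → Fin n → ℤ) → ℝ) : Prop :=
  (∀ ν, 0 ≤ V ν) ∧
  ∃ c : ℝ≥0, 0 < c ∧ ∀ (A₀ : (Fin n → ℤ) → ℝ≥0) (A : Fin N → (Fin n → ℤ) → ℝ≥0),
    ∑' ν : Fin N → Fin n → ℤ,
        ENNReal.ofReal (V ν) * (A₀ (∑ j, ν j) : ℝ≥0∞) * ∏ j, (A j (ν j) : ℝ≥0∞) ≤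
      c * (seqNorm 2 (fun μ => (A₀ μ : ℝ≥0∞)) *
        ∏ j, seqNorm 2 (fun μ => (A j μ : ℝ≥0∞)))

/-- The moderate class `𝓜(ℝ^{Nn})`, with `⟨η⟩ = (1 + |η₁|² + ⋯ + |η_N|²)^{1/2}`. -/
def Moderate {n N : ℕ} (F : (Fin N → E n) → ℝ) : Prop :=
  Continuous F ∧ (∀ ξ, 0 < F ξ) ∧
  ∃ C M : ℝ, 0 < C ∧ 0 < M ∧
    ∀ ξ η, F (ξ + η) ≤ C * F ξ * Real.sqrt (1 + ∑ j, ‖η j‖ ^ 2) ^ M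

/-! ### Besov type symbol classes -/

/-- `φ` generates a Littlewood–Paley partition of unity on `ℝⁿ`. -/
def IsLPGenerator {n : ℕ} (φ : 𝓢(E n, ℂ)) : Prop :=
  (∀ y, ‖y‖ ≤ 1 → φ y = 1) ∧ tsupport φ ⊆ Metric.closedBall 0 2

/-- The partition of unity generated by `φ`: `ψ₀ = φ` and `ψ_k = ψ(·/2^k)` for `k ≥ 1`,
where `ψ(y) = φ(y) - φ(2y)`. -/
def lpPiece {n : ℕ} (φ : 𝓢(E n, ℂ)) (k : ℕ) (y : E n) : ℂ :=
  if k = 0 then φ y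
  else φ (((2 : ℝ) ^ k)⁻¹ • y) - φ ((2 : ℝ) • (((2 : ℝ) ^ k)⁻¹ • y))

/-- `Δ_k σ = ψ_{k₀}(D_x) ψ_{k₁}(D_{ξ₁}) ⋯ ψ_{k_N}(D_{ξ_N}) σ`. A Fourier multiplier operator
`m(D)` with `m` a Schwartz function is the convolution with the Schwartz function `𝓕⁻¹ m`;
here `m(ζ₀, …, ζ_N) = ∏ ψ_{k_j}(ζ_j)`. For `σ ∈ L^∞` the integral converges absolutely at
every point. -/
def lpBlock {n d : ℕ} (φ : 𝓢(E n, ℂ)) (k : Fin d → ℕ) (σ : (Fin d → E n) → ℂ)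
    (X : Fin d → E n) : ℂ :=
  ∫ Y : Fin d → E n, (∏ j, fourierCheck (lpPiece φ (k j)) (Y j)) * σ (X - Y)

/-- The quasi-norm of `S^W_{0,0}(s, t; ℝⁿ, N)`. -/
def symbolNorm {n N : ℕ} (φ : 𝓢(E n, ℂ)) (W : (Fin N → E n) → ℝ)
    (s : Fin (N + 1) → ℝ) (t : ℝ≥0∞) (σ : (Fin (N + 1) → E n) → ℂ) : ℝ≥0∞ :=
  seqNorm t (fun k : Fin (N + 1) → ℕ =>
    (2 : ℝ≥0∞) ^ (∑ j, s j * (k j : ℝ)) *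
      ulNorm (fun X => ((W (Fin.tail X) : ℝ) : ℂ)⁻¹ * lpBlock φ k σ X))

/-- Membership in `S^W_{0,0}(s, t; ℝⁿ, N)`. -/
def MemSymbol {n N : ℕ} (φ : 𝓢(E n, ℂ)) (W : (Fin N → E n) → ℝ)
    (s : Fin (N + 1) → ℝ) (t : ℝ≥0∞) (σ : (Fin (N + 1) → E n) → ℂ) : Prop :=
  MemLp σ ∞ volume ∧ symbolNorm φ W s t σ < ∞

end MultiPsiDO

end

open scoped FourierTransform Topology

noncomputable section

namespace MultiPsiDO

/-! ### Sequence quasi-norms: monotonicity, powers, and the triangle inequality -/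

section SeqNorm

variable {K : Type*} [MeasurableSpace K]

/-! The symbol is decomposed as `σ = ∑ Δ_k σ`. Each block is estimated in `L²` on a single unit cell
`m`, and the bounds are then summed over `m` in `ℓ^r` and over `k`.

One block is localized in two ways. Its spectrum in the slot `ξ_j` lies in a ball of radius
`2·2^{k_j}`, so its value at `x` sees `f_j` only at distance at most `2·2^{k_j}` from `x`
(`opT_lpBlock_congr`). On the cell `m`, each `f_j` may therefore be cut off to `O(2^{k_j n})`
neighbouring cells. Its spectrum in `x` lies in a ball of radius `2·2^{k_0}`. After multiplication
by a function `θ(x - m)` of spectrum in the unit ball with `|θ| ≥ 1` near the origin, the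
contribution of `ξ` in the frequency cell `ν` has spectrum within `O(2^{k_0})` of `ν_1 + ⋯ + ν_N`.
Two contributions are then orthogonal unless these sums differ by one of `O(2^{k_0 n})` lattice
points (`locOp_orthogonal`). Cauchy–Schwarz bounds the contribution of `ν` by `W(ν)` times the local
norm of the block times `∏ ‖f̂_j‖_{L²(ν_j)}`. The class `𝓑_N`, read by duality in `A_0`, is exactly
the bound for the `ℓ²` norm of these quantities summed along `ν_1 + ⋯ + ν_N = l`. Plancherel then
yields the factor `2^{k_0 n/2}` and the norms `‖f_j‖_2` of the cut-off inputs
(`exists_eLpNorm_opT_lpBlock_le`).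

Hölder in `m` splits the product. A local `ℓ²` sum over `O(2^{k_j n})` shifts costs `2^{k_j n /
min(2, q_j)}` in `ℓ^{q_j}` (`seqNorm_shift_sum_le`). These factors are exactly `2^{s·k}`, and the
quasi-triangle inequality with exponent `min(1, r)` produces the symbol norm
(`exists_seqNorm_tsum_opT_lpBlock_le`). Finally, the partial sums of the blocks are convolutions of
`σ` with an approximate identity, so the operators converge in `L¹` on each cell, and Fatou bounds
the `L²` norm of `T_σ` there by the sum over the blocks (`eLpNorm_opT_le_tsum`). -/

theorem seqNorm_mono {q : ℝ≥0∞} {a b : K → ℝ≥0∞} (h : ∀ k, a k ≤ b k) :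
    seqNorm q a ≤ seqNorm q b :=
  eLpNorm_mono_enorm (by simpa using h)

/-- Trading a power for a change of exponent moves quasi-norm estimates into the range `q ≥ 1`,
where the triangle inequality is available. -/
theorem seqNorm_rpow (q : ℝ≥0∞) {p : ℝ} (hp : 0 < p) (a : K → ℝ≥0∞) :
    seqNorm q (fun k => a k ^ p) = seqNorm (q * ENNReal.ofReal p) a ^ p := by
  simpa [seqNorm] using eLpNorm_enorm_rpow (μ := Measure.count) (p := q) a hp

theorem seqNorm_top (a : K → ℝ≥0∞) : seqNorm ∞ a = ⨆ k, a k := by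
  rw [seqNorm, eLpNorm_exponent_top, eLpNormEssSup_eq_essSup_enorm]
  simp only [enorm_eq_self]
  apply le_antisymm
  · exact essSup_le_of_ae_le _ (Filter.Eventually.of_forall fun k => le_iSup a k)
  · refine iSup_le fun k => ?_
    have := ENNReal.ae_le_essSup (μ := Measure.count) a
    rw [Measure.ae_count_iff] at this
    exact this k

theorem seqNorm_ofReal (q : ℝ≥0∞) {g : K → ℝ} (hg : ∀ k, 0 ≤ g k) :
    seqNorm q (fun k => ENNReal.ofReal (g k)) = eLpNorm g q Measure.count :=
  eLpNorm_congr_enorm_ae (Filter.Eventually.of_forall fun k => by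
    simp [Real.enorm_eq_ofReal (hg k)])

variable [MeasurableSingletonClass K]

theorem seqNorm_eq_tsum {q : ℝ≥0∞} (h0 : q ≠ 0) (ht : q ≠ ∞) (a : K → ℝ≥0∞) :
    seqNorm q a = (∑' k, a k ^ q.toReal) ^ (1 / q.toReal) := by
  simp [seqNorm, eLpNorm_eq_lintegral_rpow_enorm_toReal h0 ht, lintegral_count]

theorem le_seqNorm {q : ℝ≥0∞} (h0 : q ≠ 0) (a : K → ℝ≥0∞) (k : K) : a k ≤ seqNorm q a := by
  simpa [seqNorm] using enorm_le_eLpNorm_count a k h0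

theorem seqNorm_comp_equiv (q : ℝ≥0∞) (e : K ≃ K) (a : K → ℝ≥0∞) :
    seqNorm q (fun k => a (e k)) = seqNorm q a := by
  rcases eq_or_ne q 0 with rfl | h0
  · simp [seqNorm]
  rcases eq_or_ne q ∞ with rfl | ht
  · simp only [seqNorm_top]
    exact e.iSup_comp
  · rw [seqNorm_eq_tsum h0 ht, seqNorm_eq_tsum h0 ht, e.tsum_eq (fun k => a k ^ q.toReal)]

variable [Countable K]

theorem seqNorm_sum_le {ι : Type*} {q : ℝ≥0∞} (hq : 1 ≤ q) (s : Finset ι) (a : ι → K → ℝ≥0∞) :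
    seqNorm q (fun k => ∑ i ∈ s, a i k) ≤ ∑ i ∈ s, seqNorm q (a i) := by
  have := eLpNorm_sum_le (μ := Measure.count) (f := a) (s := s) (p := q)
    (fun i _ => (Measurable.of_discrete (f := a i)).aestronglyMeasurable) hq
  have e : (fun k => ∑ i ∈ s, a i k) = ∑ i ∈ s, a i := by ext k; simp
  rw [seqNorm, e]
  exact this

theorem seqNorm_tsum_le {ι : Type*} {q : ℝ≥0∞} (hq : 1 ≤ q) (a : ι → K → ℝ≥0∞) :
    seqNorm q (fun k => ∑' i, a i k) ≤ ∑' i, seqNorm q (a i) := by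
  have h0 : q ≠ 0 := (zero_lt_one.trans_le hq).ne'
  have key (s : Finset ι) : seqNorm q (fun k => ∑ i ∈ s, a i k) ≤ ∑' i, seqNorm q (a i) :=
    (seqNorm_sum_le hq s a).trans (ENNReal.sum_le_tsum s)
  rcases eq_or_ne q ∞ with rfl | ht
  · rw [seqNorm_top]
    refine iSup_le fun k => ?_
    rw [ENNReal.tsum_eq_iSup_sum]
    exact iSup_le fun s => (le_seqNorm h0 (fun k => ∑ i ∈ s, a i k) k).trans (key s)
  · have hp : 0 < q.toReal := ENNReal.toReal_pos h0 ht
    rw [seqNorm_eq_tsum h0 ht, one_div, ENNReal.rpow_inv_le_iff hp, ENNReal.tsum_eq_iSup_sum]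
    refine iSup_le fun F => ?_
    -- For finitely many `k` the left side is continuous along partial sums over `i`, so the finite
    -- Minkowski inequality passes to the limit.
    have lim : Filter.Tendsto (fun s : Finset ι => ∑ k ∈ F, (∑ i ∈ s, a i k) ^ q.toReal)
        Filter.atTop (nhds (∑ k ∈ F, (∑' i, a i k) ^ q.toReal)) :=
      tendsto_finsetSum _ fun k _ =>
        (ENNReal.continuous_rpow_const.tendsto _).comp ENNReal.summable.hasSum
    refine le_of_tendsto' lim fun s => ?_
    have := key s
    rw [seqNorm_eq_tsum h0 ht, one_div, ENNReal.rpow_inv_le_iff hp] at this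
    exact (ENNReal.sum_le_tsum F).trans this

end SeqNorm

theorem rpow_tsum_le_tsum_rpow {ι : Type*} {p : ℝ} (h0 : 0 < p) (h1 : p ≤ 1) (a : ι → ℝ≥0∞) :
    (∑' i, a i) ^ p ≤ ∑' i, a i ^ p := by
  refine le_of_tendsto' ((ENNReal.continuous_rpow_const.tendsto _).comp
    (ENNReal.summable (f := a)).hasSum) fun s => ?_
  refine le_trans ?_ (ENNReal.sum_le_tsum s)
  exact Finset.le_sum_of_subadditive (fun x : ℝ≥0∞ => x ^ p) (by simp [h0])
    (fun x y => ENNReal.rpow_add_le_add_rpow x y h0.le h1) s a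

/-! ### Quasi-triangle inequality, local square sums and Hölder in `ℓ^q` -/

section

variable {K : Type*} [MeasurableSpace K] [Countable K] [MeasurableSingletonClass K]

/-- The quasi-triangle inequality in `ℓ^r`. -/
theorem seqNorm_tsum_le_seqNorm {ι : Type*} [MeasurableSpace ι] [Countable ι]
    [MeasurableSingletonClass ι] {r : ℝ≥0∞} (hr : 0 < r) (a : ι → K → ℝ≥0∞) :
    seqNorm r (fun k => ∑' i, a i k) ≤ seqNorm (min 1 r) (fun i => seqNorm r (a i)) := by
  -- Since `t ≤ 1`, the power `t` is subadditive; since `r / t ≥ 1`, the triangle inequality holds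
  -- in `ℓ^{r/t}`.
  set t := min 1 r with ht
  have t0 : t ≠ 0 := (lt_min one_pos hr).ne'
  have tt : t ≠ ∞ := (min_le_left _ _ |>.trans_lt ENNReal.one_lt_top).ne
  have tp : 0 < t.toReal := ENNReal.toReal_pos t0 tt
  have t1 : t.toReal ≤ 1 := by
    simpa using ENNReal.toReal_mono ENNReal.one_ne_top (min_le_left 1 r)
  have e : r / t * ENNReal.ofReal t.toReal = r := by
    rw [ENNReal.ofReal_toReal tt, ENNReal.div_mul_cancel t0 tt]
  have q1 : 1 ≤ r / t := by
    rw [ENNReal.le_div_iff_mul_le (Or.inl t0) (Or.inl tt), one_mul]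
    exact min_le_right _ _
  rw [seqNorm_eq_tsum t0 tt, one_div, ENNReal.le_rpow_inv_iff tp]
  calc seqNorm r (fun k => ∑' i, a i k) ^ t.toReal
      = seqNorm (r / t) (fun k => (∑' i, a i k) ^ t.toReal) := by
        rw [seqNorm_rpow _ tp, e]
    _ ≤ seqNorm (r / t) (fun k => ∑' i, a i k ^ t.toReal) :=
        seqNorm_mono fun k => rpow_tsum_le_tsum_rpow tp t1 _
    _ ≤ ∑' i, seqNorm (r / t) (fun k => a i k ^ t.toReal) := seqNorm_tsum_le q1 _
    _ = _ := by
        congr 1; ext i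
        rw [seqNorm_rpow _ tp, e]

/-- With `p = min 2 q`, the inclusion `ℓ^p ⊂ ℓ²` replaces the square sum by a sum of `p`-th powers,
and the triangle inequality in `ℓ^{q/p}` adds up `D.card` translates of equal norm. This is the
source of the exponents `s_j = n / min(2, q_j)`. -/
theorem seqNorm_shift_sum_le [AddCommGroup K] {q : ℝ≥0∞} (hq : 0 < q) (D : Finset K)
    (a : K → ℝ≥0∞) :
    seqNorm q (fun k => (∑ d ∈ D, a (k + d) ^ (2 : ℝ)) ^ (1 / 2 : ℝ)) ≤
      (D.card : ℝ≥0∞) ^ (1 / (min 2 q).toReal) * seqNorm q a := by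
  set p := min 2 q with hp
  have p0 : p ≠ 0 := (lt_min two_pos hq).ne'
  have pt : p ≠ ∞ := ((min_le_left _ _).trans_lt (by simp)).ne
  have pp : 0 < p.toReal := ENNReal.toReal_pos p0 pt
  have p2 : p.toReal ≤ 2 := by
    simpa using ENNReal.toReal_mono (by simp) (min_le_left 2 q)
  have e : q / p * ENNReal.ofReal p.toReal = q := by
    rw [ENNReal.ofReal_toReal pt, ENNReal.div_mul_cancel p0 pt]
  have q1 : 1 ≤ q / p := by
    rw [ENNReal.le_div_iff_mul_le (Or.inl p0) (Or.inl pt), one_mul]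
    exact min_le_right _ _
  have key (k : K) : ((∑ d ∈ D, a (k + d) ^ (2 : ℝ)) ^ (1 / 2 : ℝ)) ^ p.toReal ≤
      ∑ d ∈ D, a (k + d) ^ p.toReal := by
    rw [← ENNReal.rpow_mul]
    have := Finset.le_sum_of_subadditive (fun x : ℝ≥0∞ => x ^ (1 / 2 * p.toReal : ℝ))
      (by simp [pp]) (fun x y => ENNReal.rpow_add_le_add_rpow x y (by positivity) (by linarith)) D
      (fun d => a (k + d) ^ (2 : ℝ))
    refine this.trans_eq (Finset.sum_congr rfl fun d _ => ?_)
    rw [← ENNReal.rpow_mul]; congr 1; ring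
  rw [← ENNReal.rpow_le_rpow_iff pp, ENNReal.mul_rpow_of_nonneg _ _ pp.le, ← ENNReal.rpow_mul,
    one_div_mul_cancel pp.ne', ENNReal.rpow_one]
  calc _ = seqNorm (q / p) (fun k => ((∑ d ∈ D, a (k + d) ^ (2 : ℝ)) ^ (1 / 2 : ℝ)) ^ p.toReal) := by
        rw [seqNorm_rpow _ pp, e]
    _ ≤ seqNorm (q / p) (fun k => ∑ d ∈ D, a (k + d) ^ p.toReal) := seqNorm_mono key
    _ ≤ ∑ d ∈ D, seqNorm (q / p) (fun k => a (k + d) ^ p.toReal) := seqNorm_sum_le q1 _ _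
    _ = _ := by
        have h (d : K) : seqNorm (q / p) (fun k => a (k + d) ^ p.toReal) =
            seqNorm q a ^ p.toReal := by
          rw [← e, ← seqNorm_rpow _ pp, e]
          exact seqNorm_comp_equiv (q / p) (Equiv.addRight d) (fun k => a k ^ p.toReal)
        simp [h]

/-- Hölder's inequality for products of finitely many sequences. -/
theorem seqNorm_prod_le {ι : Type*} (s : Finset ι) (q : ι → ℝ≥0∞) (a : ι → K → ℝ≥0∞)
    (ha : ∀ i k, a i k ≠ ∞) {r : ℝ≥0∞} (hr : ∑ i ∈ s, (q i)⁻¹ = r⁻¹) :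
    seqNorm r (fun k => ∏ i ∈ s, a i k) ≤ ∏ i ∈ s, seqNorm (q i) (a i) := by
  classical
  induction s using Finset.induction_on generalizing r with
  | empty =>
    have : r = ∞ := by simpa using hr.symm
    subst this
    simp [seqNorm_top]
  | insert i s hi ih =>
    rw [Finset.sum_insert hi] at hr
    have h := ih (r := (∑ i ∈ s, (q i)⁻¹)⁻¹) (by simp)
    simp only [Finset.prod_insert hi]
    refine le_trans ?_ (mul_le_mul_right h _)
    have : ENNReal.HolderTriple (q i) (∑ i ∈ s, (q i)⁻¹)⁻¹ r := ⟨by simpa using hr⟩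
    -- All entries are finite, so Hölder is applied to the associated real sequences and transferred
    -- back.
    have := eLpNorm_smul_le_mul_eLpNorm (μ := (Measure.count : Measure K))
      (p := q i) (q := (∑ i ∈ s, (q i)⁻¹)⁻¹) (r := r)
      (f := fun k => (∏ i ∈ s, a i k).toReal) (φ := fun k => (a i k).toReal)
      Measurable.of_discrete.aestronglyMeasurable
      Measurable.of_discrete.aestronglyMeasurable
    have hp (k : K) : ∏ i ∈ s, a i k ≠ ∞ := ENNReal.prod_ne_top fun i _ => ha i k
    have e1 : eLpNorm (fun k => (a i k).toReal) (q i) Measure.count = seqNorm (q i) (a i) := by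
      rw [← seqNorm_ofReal _ fun k => ENNReal.toReal_nonneg]
      simp_rw [ENNReal.ofReal_toReal (ha i _)]
    have e2 : eLpNorm (fun k => (∏ i ∈ s, a i k).toReal) (∑ i ∈ s, (q i)⁻¹)⁻¹ Measure.count =
        seqNorm (∑ i ∈ s, (q i)⁻¹)⁻¹ (fun k => ∏ i ∈ s, a i k) := by
      rw [← seqNorm_ofReal _ fun k => ENNReal.toReal_nonneg]
      simp_rw [ENNReal.ofReal_toReal (hp _)]
    have e3 : eLpNorm ((fun k => (a i k).toReal) • fun k => (∏ i ∈ s, a i k).toReal) r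
        Measure.count = seqNorm r (fun k => a i k * ∏ i ∈ s, a i k) := by
      have : ((fun k => (a i k).toReal) • fun k => (∏ i ∈ s, a i k).toReal) =
          fun k => (a i k * ∏ i ∈ s, a i k).toReal := by
        ext k; simp [ENNReal.toReal_mul]
      rw [this, ← seqNorm_ofReal _ fun k => ENNReal.toReal_nonneg]
      simp_rw [ENNReal.ofReal_toReal (ENNReal.mul_ne_top (ha i _) (hp _))]
    rwa [e1, e2, e3] at this

end

/-! ### Decomposition of space into unit cells -/

section Cells

variable {n d : ℕ}

/-- The lattice point nearest to `x`. -/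
def rnd (x : E n) : Fin n → ℤ := fun i => ⌊x i + 1 / 2⌋

/-- The unit cube centred at the lattice point `ν`. -/
def cell (ν : Fin n → ℤ) : Set (E n) := {x | rnd x = ν}

/-- A product of unit cubes. -/
def pcell (ν : Fin d → Fin n → ℤ) : Set (Fin d → E n) := {X | (fun j => rnd (X j)) = ν}

theorem measurable_rnd : Measurable (rnd : E n → Fin n → ℤ) := by
  unfold rnd
  fun_prop

theorem measurableSet_cell (ν : Fin n → ℤ) : MeasurableSet (cell ν) :=
  measurable_rnd (measurableSet_singleton ν)

theorem measurable_prnd : Measurable (fun (X : Fin d → E n) j => rnd (X j)) :=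
  measurable_pi_lambda _ fun j => measurable_rnd.comp (measurable_pi_apply j)

theorem measurableSet_pcell (ν : Fin d → Fin n → ℤ) : MeasurableSet (pcell ν) :=
  measurable_prnd (measurableSet_singleton ν)

theorem iUnion_cell : ⋃ ν : Fin n → ℤ, cell ν = Set.univ := by
  ext x; simp [cell]

theorem iUnion_pcell : ⋃ ν : Fin d → Fin n → ℤ, pcell ν = Set.univ := by
  ext x; simp [pcell]

theorem pairwise_disjoint_cell :
    Pairwise (Function.onFun Disjoint (cell : (Fin n → ℤ) → Set (E n))) := by
  intro a b hab
  rw [Function.onFun, Set.disjoint_left]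
  exact fun x hx hy => hab (hx.symm.trans hy)

theorem pairwise_disjoint_pcell :
    Pairwise (Function.onFun Disjoint (pcell : (Fin d → Fin n → ℤ) → Set (Fin d → E n))) := by
  intro a b hab
  rw [Function.onFun, Set.disjoint_left]
  exact fun x hx hy => hab (hx.symm.trans hy)

theorem lintegral_eq_tsum_cell (f : E n → ℝ≥0∞) :
    ∫⁻ x, f x = ∑' ν : Fin n → ℤ, ∫⁻ x in cell ν, f x := by
  rw [← lintegral_iUnion measurableSet_cell pairwise_disjoint_cell, iUnion_cell,
    Measure.restrict_univ]

theorem add_lat_mem_cell {x : E n} {ν : Fin n → ℤ} : x + lat ν ∈ cell ν ↔ x ∈ cube n := by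
  simp only [cell, rnd, lat, cube, Set.mem_ofPred_eq, funext_iff, PiLp.add_apply, Int.floor_eq_iff,
    Set.mem_Ico]
  refine forall_congr' fun i => ⟨fun h => ⟨by linarith, by linarith⟩, fun h => ⟨by linarith, by linarith⟩⟩

theorem abs_sub_le_of_mem_cell {x : E n} {ν : Fin n → ℤ} (h : x ∈ cell ν) (i : Fin n) :
    |x i - ν i| ≤ 1 / 2 := by
  have h : ⌊x i + 1 / 2⌋ = ν i := congrFun h i
  rw [Int.floor_eq_iff] at h
  rw [abs_le]; constructor <;> linarith

theorem norm_le_of_abs_le {x : E n} {C : ℝ} (hC : 0 ≤ C) (h : ∀ i, |x i| ≤ C) :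
    ‖x‖ ≤ n * C := by
  rw [EuclideanSpace.norm_eq, Real.sqrt_le_iff]
  refine ⟨by positivity, ?_⟩
  have h1 := Finset.sum_le_card_nsmul Finset.univ (fun i => ‖x i‖ ^ 2) (C ^ 2)
    (fun i _ => pow_le_pow_left₀ (norm_nonneg _) (h i) 2)
  have h2 : (n : ℝ) ≤ (n : ℝ) ^ 2 := by exact_mod_cast Nat.le_self_pow two_ne_zero n
  simp only [Finset.card_univ, Fintype.card_fin, nsmul_eq_mul] at h1
  nlinarith [sq_nonneg C]

/-- The crude bound `n` in place of `√n / 2` is the one used for all cells below. -/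
theorem norm_sub_lat_le {x : E n} {ν : Fin n → ℤ} (h : x ∈ cell ν) : ‖x - lat ν‖ ≤ n := by
  have := norm_le_of_abs_le (x := x - lat ν) (C := 1 / 2) (by norm_num)
    (fun i => by simpa [lat] using abs_sub_le_of_mem_cell h i)
  have hn : (0 : ℝ) ≤ n := n.cast_nonneg
  linarith

theorem eLpNorm_add_lat {F : Type*} [NormedAddCommGroup F] (p : ℝ≥0∞) (f : E n → F)
    (ν : Fin n → ℤ) :
    eLpNorm (fun x => f (x + lat ν)) p (volume.restrict (cube n)) =
      eLpNorm f p (volume.restrict (cell ν)) := by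
  have hp : (fun x : E n => x + lat ν) ⁻¹' cell ν = cube n := by
    ext x; exact add_lat_mem_cell
  have he : MeasurableEmbedding (fun x : E n => x + lat ν) :=
    (MeasurableEquiv.addRight (lat ν)).measurableEmbedding
  have h := (measurePreserving_add_right (volume : Measure (E n)) (lat ν)).restrict_preimage_emb he
    (cell ν)
  rw [hp] at h
  rw [← h.map_eq, he.eLpNorm_map_measure]
  rfl

theorem eLpNorm_add_plat {F : Type*} [NormedAddCommGroup F] (p : ℝ≥0∞) (f : (Fin d → E n) → F)
    (ν : Fin d → Fin n → ℤ) :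
    eLpNorm (fun X => f (X + fun j => lat (ν j))) p
      (volume.restrict {X : Fin d → E n | ∀ j, X j ∈ cube n}) =
      eLpNorm f p (volume.restrict (pcell ν)) := by
  have hp : (fun X : Fin d → E n => X + fun j => lat (ν j)) ⁻¹' pcell ν =
      {X : Fin d → E n | ∀ j, X j ∈ cube n} := by
    ext X
    simp only [pcell, Set.preimage_ofPred_eq, Set.mem_ofPred_eq, funext_iff (f := fun j => rnd _)]
    exact forall_congr' fun j => add_lat_mem_cell
  have he : MeasurableEmbedding (fun X : Fin d → E n => X + fun j => lat (ν j)) :=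
    (MeasurableEquiv.addRight (fun j => lat (ν j))).measurableEmbedding
  have h := (measurePreserving_add_right (volume : Measure (Fin d → E n))
    (fun j => lat (ν j))).restrict_preimage_emb he (pcell ν)
  rw [hp] at h
  rw [← h.map_eq, he.eLpNorm_map_measure]
  rfl

theorem amalgamNorm_eq (p q : ℝ≥0∞) (f : E n → ℂ) :
    amalgamNorm p q f =
      seqNorm q (fun ν : Fin n → ℤ => eLpNorm f p (volume.restrict (cell ν))) := by
  simp only [amalgamNorm, eLpNorm_add_lat]

theorem ulNorm_eq (F : (Fin d → E n) → ℂ) :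
    ulNorm F = ⨆ ν : Fin d → Fin n → ℤ, eLpNorm F 2 (volume.restrict (pcell ν)) := by
  simp only [ulNorm, eLpNorm_add_plat]

theorem volume_cell_lt_top (ν : Fin n → ℤ) : volume (cell ν) < ∞ := by
  refine (measure_mono fun x hx => ?_).trans_lt
    (measure_closedBall_lt_top (x := (lat ν : E n)) (r := (n : ℝ)))
  rw [Metric.mem_closedBall, dist_eq_norm]
  exact norm_sub_lat_le hx

theorem sq_eLpNorm_two {α F : Type*} [MeasurableSpace α] [NormedAddCommGroup F] (f : α → F)
    (μ : Measure α) : eLpNorm f 2 μ ^ 2 = ∫⁻ x, ‖f x‖ₑ ^ 2 ∂μ := by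
  have := eLpNorm_nnreal_pow_eq_lintegral (μ := μ) (f := f) (p := 2) (by simp)
  simpa using this

theorem rpow_two_eLpNorm_two {α F : Type*} [MeasurableSpace α] [NormedAddCommGroup F] (f : α → F)
    (μ : Measure α) : eLpNorm f 2 μ ^ (2 : ℝ) = ∫⁻ x, ‖f x‖ₑ ^ 2 ∂μ := by
  rw [← sq_eLpNorm_two]; norm_cast

/-- The `L²` norm over a set covered by cells. -/
theorem seqNorm_two_eLpNorm_cell {F : Type*} [NormedAddCommGroup F] (f : E n → F) :
    seqNorm 2 (fun ν : Fin n → ℤ => eLpNorm f 2 (volume.restrict (cell ν))) =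
      eLpNorm f 2 volume := by
  rw [seqNorm_eq_tsum (by simp) (by simp)]
  simp only [ENNReal.toReal_ofNat, rpow_two_eLpNorm_two]
  rw [← lintegral_eq_tsum_cell, ← rpow_two_eLpNorm_two, ← ENNReal.rpow_mul]
  norm_num

end Cells

/-! ### Fourier transforms of Schwartz functions and spectral supports -/

section Fourier

variable {n : ℕ}

theorem norm_exp_I_mul_ofReal (t : ℝ) : ‖Complex.exp (Complex.I * (t : ℂ))‖ = 1 := by
  rw [mul_comm, Complex.norm_exp_ofReal_mul_I]

theorem norm_exp_neg_I_mul_ofReal (t : ℝ) : ‖Complex.exp (-(Complex.I * (t : ℂ)))‖ = 1 := by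
  rw [← mul_neg, ← Complex.ofReal_neg, norm_exp_I_mul_ofReal]

theorem conj_exp_I_mul_ofReal (t : ℝ) : (starRingEnd ℂ) (Complex.exp (Complex.I * (t : ℂ))) =
    Complex.exp (-(Complex.I * (t : ℂ))) := by
  rw [← Complex.exp_conj]; simp

/-- Dilation of a Schwartz function. -/
def scaleS (a : ℝ) (ha : a ≠ 0) (f : 𝓢(E n, ℂ)) : 𝓢(E n, ℂ) :=
  SchwartzMap.compCLMOfContinuousLinearEquiv ℂ
    (ContinuousLinearEquiv.smulLeft (R₁ := ℝ) (M₁ := E n) (Units.mk0 a ha)) f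

@[simp] theorem scaleS_apply (a : ℝ) (ha : a ≠ 0) (f : 𝓢(E n, ℂ)) (x : E n) :
    scaleS a ha f x = f (a • x) := rfl

theorem two_pi_ne_zero : (2 * Real.pi : ℝ) ≠ 0 := by positivity

theorem fourierHat_eq (f : E n → ℂ) (ξ : E n) :
    fourierHat f ξ = 𝓕 f ((2 * Real.pi)⁻¹ • ξ) := by
  rw [Real.fourier_eq', fourierHat]
  refine integral_congr_ae (Filter.Eventually.of_forall fun x => ?_)
  simp only [smul_eq_mul, inner_smul_right]
  congr 2
  rw [show -2 * Real.pi * ((2 * Real.pi)⁻¹ * inner ℝ x ξ) = -inner ℝ x ξ by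
    field_simp]
  push_cast; ring

theorem fourierCheck_eq (g : E n → ℂ) (x : E n) :
    fourierCheck g x = ((2 * Real.pi : ℝ) : ℂ)⁻¹ ^ n * 𝓕⁻ g ((2 * Real.pi)⁻¹ • x) := by
  rw [Real.fourierInv_eq', fourierCheck]
  congr 1
  refine integral_congr_ae (Filter.Eventually.of_forall fun ξ => ?_)
  simp only [smul_eq_mul, inner_smul_right]
  congr 2
  rw [show 2 * Real.pi * ((2 * Real.pi)⁻¹ * inner ℝ ξ x) = inner ℝ x ξ by
    rw [real_inner_comm]; field_simp]
  ring

/-- The Fourier transform of a Schwartz function, as a Schwartz function. -/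
def hatS (f : 𝓢(E n, ℂ)) : 𝓢(E n, ℂ) := scaleS (2 * Real.pi)⁻¹ (inv_ne_zero two_pi_ne_zero) (𝓕 f)

/-- The inverse Fourier transform of a Schwartz function, as a Schwartz function. -/
def checkS (f : 𝓢(E n, ℂ)) : 𝓢(E n, ℂ) :=
  (((2 * Real.pi : ℝ) : ℂ)⁻¹ ^ n) • scaleS (2 * Real.pi)⁻¹ (inv_ne_zero two_pi_ne_zero) (𝓕⁻ f)

theorem coe_hatS (f : 𝓢(E n, ℂ)) : ⇑(hatS f) = fourierHat f := by
  ext ξ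
  rw [fourierHat_eq, hatS, scaleS_apply, SchwartzMap.fourier_coe]

theorem coe_checkS (f : 𝓢(E n, ℂ)) : ⇑(checkS f) = fourierCheck f := by
  ext ξ
  rw [fourierCheck_eq, checkS, smul_apply, scaleS_apply, SchwartzMap.fourierInv_coe,
    smul_eq_mul]

theorem fourierHat_checkS (f : 𝓢(E n, ℂ)) (ξ : E n) : fourierHat (checkS f) ξ = f ξ := by
  have h1 : fourierHat (checkS f) ξ = (((2 * Real.pi : ℝ) : ℂ)⁻¹ ^ n) *
      ∫ x : E n, (fun u : E n => Complex.exp ((-2 * Real.pi * inner ℝ u ξ : ℝ) * Complex.I) *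
        𝓕⁻ f u) ((2 * Real.pi)⁻¹ • x) := by
    rw [fourierHat, ← integral_const_mul]
    refine integral_congr_ae (Filter.Eventually.of_forall fun x => ?_)
    simp only [checkS, smul_apply, scaleS_apply, smul_eq_mul, inner_smul_left]
    rw [show (-2 * Real.pi * ((starRingEnd ℝ) (2 * Real.pi)⁻¹ * inner ℝ x ξ)) = -inner ℝ x ξ by
      simp only [conj_trivial]; field_simp]
    push_cast
    ring_nf
  rw [h1, Measure.integral_comp_smul volume (fun u : E n =>
    Complex.exp ((-2 * Real.pi * inner ℝ u ξ : ℝ) * Complex.I) * 𝓕⁻ f u)]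
  have h2 : 𝓕 (𝓕⁻ f : 𝓢(E n, ℂ)) ξ = f ξ := by rw [FourierTransform.fourier_fourierInv_eq f]
  simp only [SchwartzMap.fourier_coe, Real.fourier_eq', smul_eq_mul] at h2
  rw [h2]
  have hp : (0 : ℝ) < 2 * Real.pi := by positivity
  simp only [finrank_euclideanSpace, Fintype.card_fin, inv_pow, inv_inv]
  rw [abs_of_pos (by positivity), Complex.real_smul]
  push_cast
  have : (2 * (Real.pi : ℂ)) ≠ 0 := by exact_mod_cast hp.ne'
  field_simp

theorem integral_checkS (f : 𝓢(E n, ℂ)) : ∫ x, checkS f x = f 0 := by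
  rw [← fourierHat_checkS f 0, fourierHat]
  simp

/-- Plancherel; the factor `(2π)^n` is the Jacobian of the dilation relating the two normalizations
of the transform. -/
theorem lintegral_enorm_sq_fourierHat (f : 𝓢(E n, ℂ)) :
    ∫⁻ ξ, ‖fourierHat f ξ‖ₑ ^ 2 = ENNReal.ofReal ((2 * Real.pi) ^ n) * ∫⁻ x, ‖f x‖ₑ ^ 2 := by
  have key (g : 𝓢(E n, ℂ)) : ∫⁻ x, ‖g x‖ₑ ^ 2 = ENNReal.ofReal (∫ x, ‖g x‖ ^ 2) := by
    have hi : Integrable (fun x => ‖g x‖ ^ 2) := by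
      simpa using (g.memLp 2).integrable_norm_pow (by simp)
    rw [ofReal_integral_eq_lintegral_ofReal hi
      (Filter.Eventually.of_forall fun x => by positivity)]
    refine lintegral_congr fun x => ?_
    rw [← ofReal_norm, ENNReal.ofReal_pow (norm_nonneg _)]
  rw [← coe_hatS, key, key, ← ENNReal.ofReal_mul (by positivity), ← SchwartzMap.integral_norm_sq_fourier f]
  congr 1
  have := Measure.integral_comp_smul (volume : Measure (E n)) (fun x => ‖𝓕 f x‖ ^ 2) (2 * Real.pi)⁻¹
  simp only [hatS, scaleS_apply]
  rw [this]
  simp only [finrank_euclideanSpace, Fintype.card_fin, inv_pow, inv_inv]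
  rw [abs_of_pos (by positivity), smul_eq_mul]

theorem eLpNorm_two_hatS (f : 𝓢(E n, ℂ)) :
    eLpNorm (hatS f) 2 volume =
      ENNReal.ofReal ((2 * Real.pi) ^ n) ^ (1 / 2 : ℝ) * eLpNorm f 2 volume := by
  have h := lintegral_enorm_sq_fourierHat f
  rw [← coe_hatS, ← rpow_two_eLpNorm_two, ← rpow_two_eLpNorm_two] at h
  have := congrArg (fun t : ℝ≥0∞ => t ^ (1 / 2 : ℝ)) h
  rwa [ENNReal.mul_rpow_of_nonneg _ _ (by norm_num), ← ENNReal.rpow_mul, ← ENNReal.rpow_mul,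
    mul_one_div_cancel two_ne_zero, ENNReal.rpow_one, ENNReal.rpow_one] at this

/-- Functions whose Fourier transform vanishes outside a ball. -/
def BandLimited (R : ℝ) (u : E n → ℂ) : Prop := ∀ z, R < ‖z‖ → fourierHat u z = 0

/-- Superpositions of plane waves with frequencies in a ball. -/
def IsSynthesis (ρ : ℝ) (v : E n → ℂ) : Prop :=
  ∃ b : E n → ℂ, Integrable b ∧ (∀ ζ, ρ < ‖ζ‖ → b ζ = 0) ∧
    ∀ x, v x = ∫ ζ, Complex.exp (Complex.I * ((inner ℝ x ζ : ℝ) : ℂ)) * b ζ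

theorem IsSynthesis.bound {ρ : ℝ} {v : E n → ℂ} (h : IsSynthesis ρ v) :
    Continuous v ∧ ∃ C : ℝ, ∀ x, ‖v x‖ ≤ C := by
  obtain ⟨b, hb, -, hv⟩ := h
  refine ⟨?_, ∫ ζ, ‖b ζ‖, fun x => ?_⟩
  · rw [funext hv]
    refine continuous_of_dominated (bound := fun ζ => ‖b ζ‖) (fun x => ?_) (fun x => ?_) hb.norm ?_
    · exact (Continuous.aestronglyMeasurable (by fun_prop)).mul hb.1
    · exact Filter.Eventually.of_forall fun ζ => by rw [norm_mul, norm_exp_I_mul_ofReal, one_mul]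
    · exact Filter.Eventually.of_forall fun ζ => by fun_prop
  · rw [hv]
    refine (norm_integral_le_integral_norm _).trans_eq ?_
    simp

theorem IsSynthesis.conj {ρ : ℝ} {v : E n → ℂ} (h : IsSynthesis ρ v) :
    IsSynthesis ρ (fun x => (starRingEnd ℂ) (v x)) := by
  obtain ⟨b, hb, hs, hv⟩ := h
  refine ⟨fun ζ => (starRingEnd ℂ) (b (-ζ)), ?_, fun ζ hζ => ?_, fun x => ?_⟩
  · have h := hb.comp_neg
    exact ⟨Complex.continuous_conj.comp_aestronglyMeasurable h.1,
      by simpa [HasFiniteIntegral] using h.2⟩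
  · simp [hs (-ζ) (by simpa using hζ)]
  · simp only [hv]
    rw [← integral_conj, ← integral_neg_eq_self]
    refine integral_congr_ae (Filter.Eventually.of_forall fun ζ => ?_)
    simp only [map_mul, conj_exp_I_mul_ofReal, inner_neg_right]
    push_cast; ring_nf

theorem IsSynthesis.translate {ρ : ℝ} {v : E n → ℂ} (h : IsSynthesis ρ v) (y : E n) :
    IsSynthesis ρ (fun x => v (x - y)) := by
  obtain ⟨b, hb, hs, hv⟩ := h
  refine ⟨fun ζ => Complex.exp (-(Complex.I * ((inner ℝ y ζ : ℝ) : ℂ))) * b ζ, ?_,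
    fun ζ hζ => ?_, fun x => ?_⟩
  · refine (hb.bdd_mul (c := 1) (Continuous.aestronglyMeasurable (by fun_prop)) ?_)
    exact Filter.Eventually.of_forall fun ζ => (norm_exp_neg_I_mul_ofReal _).le
  · simp [hs ζ hζ]
  · simp only [hv]
    refine integral_congr_ae (Filter.Eventually.of_forall fun ζ => ?_)
    simp only [← mul_assoc, ← Complex.exp_add, inner_sub_left]
    push_cast; ring_nf

theorem IsSynthesis.mono {ρ ρ' : ℝ} {v : E n → ℂ} (h : IsSynthesis ρ v) (hρ : ρ ≤ ρ') :
    IsSynthesis ρ' v := by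
  obtain ⟨b, hb, hs, hv⟩ := h
  exact ⟨b, hb, fun ζ hζ => hs ζ (hρ.trans_lt hζ), hv⟩

theorem isSynthesis_checkS {ρ : ℝ} {f : 𝓢(E n, ℂ)} (hf : ∀ ζ, ρ < ‖ζ‖ → f ζ = 0) :
    IsSynthesis ρ (checkS f) := by
  refine ⟨fun ζ => ((2 * Real.pi : ℝ) : ℂ)⁻¹ ^ n * f ζ, (f.integrable).const_mul _,
    fun ζ hζ => by simp [hf ζ hζ], fun x => ?_⟩
  rw [coe_checkS, fourierCheck, ← integral_const_mul]
  refine integral_congr_ae (Filter.Eventually.of_forall fun ζ => ?_)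
  ring_nf

theorem bandLimited_checkS {ρ : ℝ} {f : 𝓢(E n, ℂ)} (hf : ∀ ζ, ρ < ‖ζ‖ → f ζ = 0) :
    BandLimited ρ (checkS f) := fun z hz => by rw [fourierHat_checkS, hf z hz]

theorem BandLimited.translate {R : ℝ} {u : E n → ℂ} (h : BandLimited R u) (y : E n) :
    BandLimited R (fun x => u (x - y)) := by
  intro z hz
  have h0 := h z hz
  rw [fourierHat] at h0 ⊢
  rw [← integral_add_right_eq_self _ y]
  calc _ = ∫ x, Complex.exp (-(Complex.I * ((inner ℝ y z : ℝ) : ℂ))) *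
        (Complex.exp (-(Complex.I * ((inner ℝ x z : ℝ) : ℂ))) * u x) := by
        refine integral_congr_ae (Filter.Eventually.of_forall fun x => ?_)
        simp only [← mul_assoc, ← Complex.exp_add, inner_add_left, add_sub_cancel_right]
        push_cast; ring_nf
    _ = 0 := by rw [integral_const_mul, h0, mul_zero]

/-- The transform of `u v` at `z` is `∫ b(ζ) û(z - ζ) dζ`, where `b` is the spectral density of `v`,
and one of the two factors vanishes once `‖z‖ > R + ρ`. Keeping `v` as an explicit superposition of
plane waves makes this a single use of Fubini, without Fourier inversion. -/
theorem BandLimited.mul {R ρ : ℝ} {u v : E n → ℂ} (hu : BandLimited R u) (hui : Integrable u)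
    (hv : IsSynthesis ρ v) :
    BandLimited (R + ρ) (fun x => u x * v x) ∧ Integrable (fun x => u x * v x) := by
  obtain ⟨hc, C, hC⟩ := hv.bound
  refine ⟨?_, by
    simpa [mul_comm] using hui.bdd_mul hc.aestronglyMeasurable (Filter.Eventually.of_forall hC)⟩
  obtain ⟨b, hb, hs, hv⟩ := hv
  intro z hz
  have hint : Integrable (Function.uncurry fun (x ζ : E n) =>
      Complex.exp (-(Complex.I * ((inner ℝ x z : ℝ) : ℂ))) * (u x *
        (Complex.exp (Complex.I * ((inner ℝ x ζ : ℝ) : ℂ)) * b ζ))) (volume.prod volume) := by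
    have h := hui.mul_prod hb
    refine (h.bdd_mul (c := 1) (f := fun p : E n × E n =>
      Complex.exp (-(Complex.I * ((inner ℝ p.1 z : ℝ) : ℂ))) *
        Complex.exp (Complex.I * ((inner ℝ p.1 p.2 : ℝ) : ℂ)))
      (Continuous.aestronglyMeasurable (by fun_prop)) ?_).congr ?_
    · exact Filter.Eventually.of_forall fun p => by
        rw [norm_mul, norm_exp_neg_I_mul_ofReal, norm_exp_I_mul_ofReal, one_mul]
    · exact Filter.Eventually.of_forall fun p => by simp only [Function.uncurry]; ring
  rw [fourierHat]
  calc ∫ x, Complex.exp (-(Complex.I * ((inner ℝ x z : ℝ) : ℂ))) * (u x * v x)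
      = ∫ x, ∫ ζ, Complex.exp (-(Complex.I * ((inner ℝ x z : ℝ) : ℂ))) * (u x *
        (Complex.exp (Complex.I * ((inner ℝ x ζ : ℝ) : ℂ)) * b ζ)) := by
        refine integral_congr_ae (Filter.Eventually.of_forall fun x => ?_)
        simp only [hv, integral_const_mul]
    _ = ∫ ζ, ∫ x, Complex.exp (-(Complex.I * ((inner ℝ x z : ℝ) : ℂ))) * (u x *
        (Complex.exp (Complex.I * ((inner ℝ x ζ : ℝ) : ℂ)) * b ζ)) :=
        integral_integral_swap hint
    _ = ∫ ζ, b ζ * fourierHat u (z - ζ) := by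
        refine integral_congr_ae (Filter.Eventually.of_forall fun ζ => ?_)
        simp only [fourierHat, ← integral_const_mul]
        refine integral_congr_ae (Filter.Eventually.of_forall fun x => ?_)
        simp only [inner_sub_right]
        rw [show -(Complex.I * ((inner ℝ x z - inner ℝ x ζ : ℝ) : ℂ)) =
          -(Complex.I * ((inner ℝ x z : ℝ) : ℂ)) + Complex.I * ((inner ℝ x ζ : ℝ) : ℂ) by
            push_cast; ring, Complex.exp_add]
        ring
    _ = 0 := by
        refine integral_eq_zero_of_ae (Filter.Eventually.of_forall fun ζ => ?_)
        by_cases hζ : ρ < ‖ζ‖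
        · simp [hs ζ hζ]
        · have : R < ‖z - ζ‖ := by
            have := norm_sub_norm_le z ζ
            linarith
          simp [hu _ this]

/-- A Schwartz function with compactly supported Fourier transform which is bounded below near the
origin. -/
theorem exists_isSynthesis_one_le (n : ℕ) :
    ∃ θ : 𝓢(E n, ℂ), IsSynthesis 1 θ ∧ ∀ x : E n, ‖x‖ ≤ n → 1 ≤ ‖θ x‖ := by
  have hr : (0 : ℝ) < 1 / (n + 1) := by positivity
  -- Radius `1 / (n + 1)` forces `|x·ζ| ≤ 1` for `‖x‖ ≤ n`, so the real part of `e^{ix·ζ}` is at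
  -- least `cos 1 > 0` on the support.
  let β : ContDiffBump (0 : E n) := ⟨1 / (2 * (n + 1)), 1 / (n + 1), by positivity, by
    apply one_div_lt_one_div_of_lt <;> linarith [n.cast_nonneg (α := ℝ)]⟩
  have hβs : HasCompactSupport (fun x => ((β.normed volume x : ℝ) : ℂ)) :=
    β.hasCompactSupport_normed.comp_left (g := fun t : ℝ => (t : ℂ)) (by simp)
  have hβc : ContDiff ℝ (⊤ : ℕ∞) (fun x => ((β.normed volume x : ℝ) : ℂ)) :=
    Complex.ofRealCLM.contDiff.comp β.contDiff_normed
  let f : 𝓢(E n, ℂ) := hβs.toSchwartzMap hβc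
  have hf (x : E n) : f x = ((β.normed volume x : ℝ) : ℂ) := rfl
  have hf0 (ζ : E n) (h : 1 / (n + 1 : ℝ) < ‖ζ‖) : f ζ = 0 := by
    rw [hf]
    have : ζ ∉ Function.support (β.normed volume) := by
      rw [β.support_normed_eq]; simp only [Metric.mem_ball, dist_zero_right, not_lt]; exact h.le
    simpa using this
  have hc1 : 0 < Real.cos 1 := Real.cos_one_pos
  -- This constant cancels the factor `(2π)^{-n}` of the inverse transform and normalizes the lower
  -- bound `cos 1` to `1`.
  let c : ℂ := ((2 * Real.pi : ℝ) : ℂ) ^ n * ((Real.cos 1)⁻¹ : ℝ)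
  refine ⟨checkS (c • f), (isSynthesis_checkS (ρ := 1 / (n + 1)) fun ζ hζ => ?_).mono ?_, ?_⟩
  · simp [hf0 ζ hζ]
  · rw [div_le_one (by positivity)]; linarith [n.cast_nonneg (α := ℝ)]
  · intro x hx
    have e : checkS (c • f) x = ((Real.cos 1)⁻¹ : ℝ) *
        ∫ ζ, Complex.exp (Complex.I * ((inner ℝ x ζ : ℝ) : ℂ)) * f ζ := by
      rw [coe_checkS, fourierCheck, ← integral_const_mul, ← integral_const_mul]
      refine integral_congr_ae (Filter.Eventually.of_forall fun ζ => ?_)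
      have : ((2 * Real.pi : ℝ) : ℂ) ≠ 0 := by exact_mod_cast two_pi_ne_zero
      simp only [smul_apply, smul_eq_mul, c]
      rw [inv_pow]
      field_simp
    have hint : Integrable (fun ζ => Complex.exp (Complex.I * ((inner ℝ x ζ : ℝ) : ℂ)) * f ζ) :=
      f.integrable.bdd_mul (c := 1) (Continuous.aestronglyMeasurable (by fun_prop))
        (Filter.Eventually.of_forall fun ζ => (norm_exp_I_mul_ofReal _).le)
    have hre : Real.cos 1 ≤
        (∫ ζ, Complex.exp (Complex.I * ((inner ℝ x ζ : ℝ) : ℂ)) * f ζ).re := by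
      have : (∫ ζ, Complex.exp (Complex.I * ((inner ℝ x ζ : ℝ) : ℂ)) * f ζ).re =
          ∫ ζ, (Complex.exp (Complex.I * ((inner ℝ x ζ : ℝ) : ℂ)) * f ζ).re :=
        (integral_re (𝕜 := ℂ) hint).symm
      rw [this]
      calc Real.cos 1 = ∫ ζ, Real.cos 1 * β.normed volume ζ := by
            rw [integral_const_mul, β.integral_normed, mul_one]
        _ ≤ _ := by
            refine integral_mono (β.integrable_normed.const_mul _) hint.re fun ζ => ?_
            have e2 : (Complex.exp (Complex.I * ((inner ℝ x ζ : ℝ) : ℂ)) * f ζ).re =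
                Real.cos (inner ℝ x ζ) * β.normed volume ζ := by
              rw [hf, Complex.re_mul_ofReal, mul_comm Complex.I, Complex.exp_ofReal_mul_I_re]
            show Real.cos 1 * β.normed volume ζ ≤
              (Complex.exp (Complex.I * ((inner ℝ x ζ : ℝ) : ℂ)) * f ζ).re
            rw [e2]
            by_cases hζ : 1 / (n + 1 : ℝ) < ‖ζ‖
            · have := hf0 ζ hζ
              rw [hf] at this
              have : β.normed volume ζ = 0 := by exact_mod_cast this
              simp [this]
            · refine mul_le_mul_of_nonneg_right ?_ (β.nonneg_normed _)
              have h1 : |inner ℝ x ζ| ≤ 1 := by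
                refine (abs_real_inner_le_norm x ζ).trans ?_
                calc ‖x‖ * ‖ζ‖ ≤ n * (1 / (n + 1)) :=
                      mul_le_mul hx (not_lt.mp hζ) (norm_nonneg _) n.cast_nonneg
                  _ ≤ 1 := by rw [mul_one_div, div_le_one (by positivity)]; linarith
              rw [← Real.cos_abs (inner ℝ x ζ)]
              exact Real.cos_le_cos_of_nonneg_of_le_pi (abs_nonneg _)
                (by linarith [Real.pi_gt_three]) h1
    rw [e, norm_mul, Complex.norm_real, Real.norm_of_nonneg (by positivity)]
    rw [inv_mul_eq_div, le_div_iff₀ hc1, one_mul]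
    exact hre.trans (Complex.re_le_norm _)

end Fourier

/-! ### Almost orthogonality in a Hilbert space -/

section AlmostOrthogonality

variable {n : ℕ}

theorem seqNorm_two_sq {K : Type*} [MeasurableSpace K] [MeasurableSingletonClass K]
    (a : K → ℝ≥0∞) : seqNorm 2 a ^ 2 = ∑' k, a k ^ 2 := by
  rw [seqNorm_eq_tsum (by simp) (by simp), ← ENNReal.rpow_natCast, ← ENNReal.rpow_mul]
  norm_num

/-- Almost orthogonality for families whose inner products vanish unless the indices `S ν` differ
by an element of the finite set `D`. -/
theorem enorm_sum_sq_le_of_orthogonal {ι V : Type*} [NormedAddCommGroup V] [InnerProductSpace ℂ V]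
    (H : ι → V) (a : ι → ℝ≥0) (hH : ∀ ν, ‖H ν‖ₑ ≤ a ν) (S : ι → Fin n → ℤ)
    (D : Finset (Fin n → ℤ)) (horth : ∀ ν ν', S ν' - S ν ∉ D → inner ℂ (H ν) (H ν') = 0)
    (B : ℝ≥0∞) (hB : ∀ A₀ : (Fin n → ℤ) → ℝ≥0,
      ∑' ν, (a ν : ℝ≥0∞) * A₀ (S ν) ≤ B * seqNorm 2 (fun l => (A₀ l : ℝ≥0∞)))
    (s : Finset ι) : ‖∑ ν ∈ s, H ν‖ₑ ^ 2 ≤ D.card * B ^ 2 := by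
  classical
  -- The total mass of `a` on each fibre of `S`, restricted to `s`.
  let h : (Fin n → ℤ) → ℝ≥0 := fun l => ∑ ν ∈ s with S ν = l, a ν
  have hh (l) : (h l : ℝ≥0∞) = ∑ ν ∈ s, if S ν = l then (a ν : ℝ≥0∞) else 0 := by
    simp only [h, Finset.sum_filter, ENNReal.ofNNReal_finsetSum]
    exact Finset.sum_congr rfl fun ν _ => by split_ifs <;> simp
  have hsupp (l) (hl : l ∉ s.image S) : (h l : ℝ≥0∞) = 0 := by
    rw [hh]
    exact Finset.sum_eq_zero fun ν hν => if_neg fun (e : S ν = l) =>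
      hl (e ▸ Finset.mem_image_of_mem S hν)
  have hsq : seqNorm 2 (fun l => (h l : ℝ≥0∞)) ^ 2 = ∑ ν ∈ s, (a ν : ℝ≥0∞) * h (S ν) := by
    rw [seqNorm_two_sq, tsum_eq_sum (s := s.image S) (fun l hl => by simp [hsupp l hl])]
    simp_rw [sq]
    calc _ = ∑ l ∈ s.image S, ∑ ν ∈ s, (if S ν = l then (a ν : ℝ≥0∞) else 0) * h l := by
          refine Finset.sum_congr rfl fun l _ => ?_
          rw [← Finset.sum_mul, ← hh]
      _ = _ := by
          rw [Finset.sum_comm]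
          refine Finset.sum_congr rfl fun ν hν => ?_
          rw [Finset.sum_eq_single (S ν)]
          · simp
          · intro l _ hl; rw [if_neg hl.symm, zero_mul]
          · intro hn; exact absurd (Finset.mem_image_of_mem S hν) hn
  have hfin : seqNorm 2 (fun l => (h l : ℝ≥0∞)) ≠ ∞ := by
    intro e
    rw [e] at hsq
    have : (∑ ν ∈ s, (a ν : ℝ≥0∞) * h (S ν)) ≠ ∞ := by
      exact ENNReal.sum_ne_top.mpr fun ν _ => ENNReal.mul_ne_top (by simp) (by simp)
    exact this (by rw [← hsq]; simp)
  -- Duality: `hB` is tested on `h` itself, and one factor of its norm is cancelled, which is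
  -- legitimate because finiteness of `s` makes that norm finite.
  have hle : seqNorm 2 (fun l => (h l : ℝ≥0∞)) ≤ B := by
    by_cases h0 : seqNorm 2 (fun l => (h l : ℝ≥0∞)) = 0
    · simp [h0]
    have h1 : seqNorm 2 (fun l => (h l : ℝ≥0∞)) * seqNorm 2 (fun l => (h l : ℝ≥0∞)) ≤
        B * seqNorm 2 (fun l => (h l : ℝ≥0∞)) := by
      rw [← sq, hsq]
      exact (ENNReal.sum_le_tsum s).trans (hB h)
    exact (ENNReal.mul_le_mul_iff_left h0 hfin).mp h1
  calc ‖∑ ν ∈ s, H ν‖ₑ ^ 2 = ‖inner ℂ (∑ ν ∈ s, H ν) (∑ ν ∈ s, H ν)‖ₑ := by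
        rw [inner_self_eq_norm_sq_to_K, enorm_pow]
        simp [enorm_eq_nnnorm]
    _ ≤ ∑ ν ∈ s, ∑ ν' ∈ s, ‖inner ℂ (H ν) (H ν')‖ₑ := by
        rw [sum_inner]
        refine (enorm_sum_le _ _).trans (Finset.sum_le_sum fun ν _ => ?_)
        rw [inner_sum]
        exact enorm_sum_le _ _
    _ ≤ ∑ ν ∈ s, ∑ ν' ∈ s, ∑ d ∈ D, (a ν : ℝ≥0∞) * if S ν' = S ν + d then (a ν' : ℝ≥0∞) else 0 := by
        refine Finset.sum_le_sum fun ν _ => Finset.sum_le_sum fun ν' _ => ?_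
        by_cases hd : S ν' - S ν ∈ D
        · refine le_trans ?_ (Finset.single_le_sum (fun _ _ => zero_le) hd)
          rw [if_pos (by abel)]
          refine le_trans ?_ (mul_le_mul' (hH ν) (hH ν'))
          simp only [enorm_eq_nnnorm]
          exact_mod_cast nnnorm_inner_le_nnnorm (𝕜 := ℂ) (H ν) (H ν')
        · simp [horth ν ν' hd]
    _ = ∑ d ∈ D, ∑ ν ∈ s, (a ν : ℝ≥0∞) * h (S ν + d) := by
        simp_rw [hh, Finset.mul_sum]
        rw [Finset.sum_comm (s := D)]
        exact Finset.sum_congr rfl fun ν _ => Finset.sum_comm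
    _ ≤ ∑ d ∈ D, B * B := by
        -- For each admissible difference `d`, `hB` is tested on the translate of `h` by `d`, whose
        -- norm equals that of `h` and so is at most `B`.
        refine Finset.sum_le_sum fun d _ => ?_
        refine (ENNReal.sum_le_tsum s).trans ((hB (fun l => h (l + d))).trans ?_)
        have := seqNorm_comp_equiv 2 (Equiv.addRight d) (fun l => (h l : ℝ≥0∞))
        simp only [Equiv.coe_addRight] at this
        rw [this]
        gcongr
    _ = D.card * B ^ 2 := by simp [sq]

end AlmostOrthogonality

/-! ### Rapidly decaying weights and uniformly local bounds -/

section Weight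

variable {n : ℕ}

theorem volume_cell (ν : Fin n → ℤ) : volume (cell ν) = volume (cube n) := by
  have hp : (fun x : E n => x + lat ν) ⁻¹' cell ν = cube n := by
    ext x; exact add_lat_mem_cell
  rw [← hp, measure_preimage_add_right]

/-- Countably many translates of the cube cover the space, so a null cube would make Lebesgue
measure vanish. -/
theorem volume_cube_ne_zero : volume (cube n) ≠ 0 := by
  intro h
  have h1 := lintegral_eq_tsum_cell (n := n) (fun _ => 1)
  simp [volume_cell, h] at h1
  exact NeZero.ne (volume : Measure (E n)) h1

theorem volume_cube_ne_top : volume (cube n) ≠ ∞ := by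
  rw [← volume_cell 0]; exact (volume_cell_lt_top 0).ne

theorem sub_lat_mem_cell {x : E n} {l m : Fin n → ℤ} (h : x ∈ cell l) : x - lat m ∈ cell (l - m) := by
  have h : rnd x = l := h
  ext i
  rw [← h]
  simp only [rnd, lat, PiLp.sub_apply, Pi.sub_apply]
  rw [show x i - (m i : ℝ) + 1 / 2 = (x i + 1 / 2) - (m i : ℝ) by ring, Int.floor_sub_intCast]

/-- The localizer `θ` has compact spectrum and hence no compact support. Its decay makes the suprema
of `|θ|²` over the cells summable, so a uniform bound on the integrals of `B` over the cells
suffices. -/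
theorem exists_lintegral_weight_le (θ : 𝓢(E n, ℂ)) :
    ∃ C : ℝ≥0, ∀ (m : Fin n → ℤ) (B : E n → ℝ≥0∞) (D : ℝ≥0∞),
      (∀ l, ∫⁻ x in cell l, B x ≤ D) → ∫⁻ x, ‖θ (x - lat m)‖ₑ ^ 2 * B x ≤ C * D := by
  obtain ⟨c, hc0, hc⟩ : ∃ c : ℝ, 0 < c ∧ ∀ x, ‖θ x‖ ^ 2 ≤ c * (1 + ‖x‖) ^ (-((n : ℝ) + 1)) := by
    let A := 2 ^ (n + 1) * ((Finset.Iic (n + 1, 0)).sup fun m => SchwartzMap.seminorm ℝ m.1 m.2) θ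
    have hA (x : E n) : (1 + ‖x‖) ^ (n + 1) * ‖θ x‖ ≤ A := by
      simpa using SchwartzMap.one_add_le_sup_seminorm_apply (𝕜 := ℝ) (m := (n + 1, 0))
        (k := n + 1) (n := 0) le_rfl le_rfl θ x
    refine ⟨A ^ 2 + 1, by positivity, fun x => ?_⟩
    have h1 : (1 : ℝ) ≤ (1 + ‖x‖) ^ (n + 1) := one_le_pow₀ (by simp)
    have h2 : ‖θ x‖ ≤ A := (le_mul_of_one_le_left (norm_nonneg _) h1).trans (hA x)
    have e : (1 + ‖x‖) ^ (-((n : ℝ) + 1)) = ((1 + ‖x‖) ^ (n + 1))⁻¹ := by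
      rw [Real.rpow_neg (by positivity)]; norm_cast
    rw [e, ← div_eq_mul_inv, le_div_iff₀ (by positivity)]
    have := mul_le_mul h2 (hA x) (by positivity) ((norm_nonneg _).trans h2)
    nlinarith
  let w : E n → ℝ≥0∞ := fun x => ENNReal.ofReal ((1 + ‖x‖) ^ (-((n : ℝ) + 1)))
  have hw : ∫⁻ x, w x < ∞ := by
    have := integrable_one_add_norm (μ := (volume : Measure (E n))) (r := (n : ℝ) + 1) (by simp)
    rw [← ofReal_integral_eq_lintegral_ofReal this
      (Filter.Eventually.of_forall fun x => by positivity)]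
    exact ENNReal.ofReal_lt_top
  let c' : ℝ≥0∞ := ENNReal.ofReal (c * (1 + 2 * n) ^ ((n : ℝ) + 1))
  have hcell (l : Fin n → ℤ) (x y : E n) (hx : x ∈ cell l) (hy : y ∈ cell l) :
      ‖θ x‖ₑ ^ 2 ≤ c' * w y := by
    have h1 : ‖y‖ ≤ ‖x‖ + 2 * n := by
      have h2 := norm_sub_lat_le hx
      have h3 := norm_sub_lat_le hy
      have : y = (y - lat l) - (x - lat l) + x := by abel
      calc ‖y‖ = ‖(y - lat l) - (x - lat l) + x‖ := by rw [← this]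
        _ ≤ ‖y - lat l‖ + ‖x - lat l‖ + ‖x‖ :=
            (norm_add_le _ _).trans (by gcongr; exact norm_sub_le _ _)
        _ ≤ _ := by linarith
    have hn : (0 : ℝ) ≤ n := n.cast_nonneg
    have h4 : 1 + ‖y‖ ≤ (1 + 2 * n) * (1 + ‖x‖) := by nlinarith [norm_nonneg x]
    have h5 : (1 + ‖x‖) ^ (-((n : ℝ) + 1)) ≤
        (1 + 2 * n) ^ ((n : ℝ) + 1) * (1 + ‖y‖) ^ (-((n : ℝ) + 1)) := by
      rw [Real.rpow_neg (by positivity), Real.rpow_neg (by positivity), ← div_eq_mul_inv,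
        inv_eq_one_div, div_le_div_iff₀ (by positivity) (by positivity), one_mul,
        ← Real.mul_rpow (by positivity) (by positivity)]
      exact Real.rpow_le_rpow (by positivity) h4 (by positivity)
    simp only [c', w]
    rw [← ENNReal.ofReal_mul (by positivity), ← ofReal_norm, ← ENNReal.ofReal_pow (norm_nonneg _)]
    refine ENNReal.ofReal_le_ofReal ((hc x).trans ?_)
    rw [mul_assoc]
    gcongr
  -- By `hcell`, the supremum of `|θ|²` on a cell is bounded by the average of `c' * w` there, so
  -- the sum over cells becomes one convergent integral.
  let M : (Fin n → ℤ) → ℝ≥0∞ := fun l => c' / volume (cube n) * ∫⁻ y in cell l, w y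
  have hM (l : Fin n → ℤ) (x : E n) (hx : x ∈ cell l) : ‖θ x‖ₑ ^ 2 ≤ M l := by
    have h1 : ∫⁻ y in cell l, ‖θ x‖ₑ ^ 2 ≤ ∫⁻ y in cell l, c' * w y :=
      setLIntegral_mono' (measurableSet_cell l) fun y hy => hcell l x y hx hy
    rw [setLIntegral_const, volume_cell, lintegral_const_mul' _ _ ENNReal.ofReal_ne_top] at h1
    simp only [M]
    rw [ENNReal.div_eq_inv_mul, mul_assoc, ← ENNReal.div_eq_inv_mul,
      ENNReal.le_div_iff_mul_le (Or.inl volume_cube_ne_zero) (Or.inl volume_cube_ne_top)]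
    exact h1
  have hMs : ∑' l, M l ≠ ∞ := by
    simp only [M]
    rw [ENNReal.tsum_mul_left, ← lintegral_eq_tsum_cell]
    exact ENNReal.mul_ne_top (ENNReal.div_ne_top ENNReal.ofReal_ne_top volume_cube_ne_zero) hw.ne
  refine ⟨(∑' l, M l).toNNReal, fun m B D hB => ?_⟩
  rw [ENNReal.coe_toNNReal hMs, lintegral_eq_tsum_cell]
  calc _ ≤ ∑' l, M (l - m) * D := by
        refine ENNReal.tsum_le_tsum fun l => ?_
        calc _ ≤ ∫⁻ x in cell l, M (l - m) * B x :=
              setLIntegral_mono' (measurableSet_cell l) fun x hx => by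
                gcongr; exact hM _ _ (sub_lat_mem_cell hx)
          _ = M (l - m) * ∫⁻ x in cell l, B x :=
              lintegral_const_mul' _ _ (ENNReal.ne_top_of_tsum_ne_top hMs _)
          _ ≤ _ := by gcongr; exact hB l
    _ = _ := by
        rw [ENNReal.tsum_mul_right]
        congr 1
        exact (Equiv.subRight m).tsum_eq M

end Weight

/-! ### Convolution of symbols, in all slots or in some of them -/

section Blocks

variable {n N : ℕ}

/-- Splitting off the slot `0`. -/
def consE : E n × (Fin N → E n) ≃ᵐ (Fin (N + 1) → E n) :=
  (MeasurableEquiv.piFinSuccAbove (fun _ => E n) 0).symm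

theorem consE_apply (p : E n × (Fin N → E n)) : consE p = Fin.cons p.1 p.2 := by
  ext j
  simp [consE, MeasurableEquiv.piFinSuccAbove]

theorem measurePreserving_consE :
    MeasurePreserving (consE (n := n) (N := N)) (volume.prod volume) volume :=
  (volume_preserving_piFinSuccAbove (fun _ => E n) 0).symm

theorem measurable_cons : Measurable (fun p : E n × (Fin N → E n) =>
    (Fin.cons p.1 p.2 : Fin (N + 1) → E n)) := by
  have : (fun p : E n × (Fin N → E n) => (Fin.cons p.1 p.2 : Fin (N + 1) → E n)) = consE :=
    funext fun p => (consE_apply p).symm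
  rw [this]
  exact consE.measurable

theorem cons_sub_cons (x y : E n) (ξ η : Fin N → E n) :
    (Fin.cons x ξ - Fin.cons y η : Fin (N + 1) → E n) = Fin.cons (x - y) (ξ - η) := by
  ext j
  refine Fin.cases ?_ (fun i => ?_) j <;> simp

theorem integral_cons (F : (Fin (N + 1) → E n) → ℂ) :
    ∫ X, F X = ∫ p : E n × (Fin N → E n), F (Fin.cons p.1 p.2) := by
  rw [← measurePreserving_consE.integral_comp consE.measurableEmbedding]
  simp only [consE_apply]; rfl

theorem lintegral_cons (F : (Fin (N + 1) → E n) → ℝ≥0∞) :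
    ∫⁻ X, F X = ∫⁻ p : E n × (Fin N → E n), F (Fin.cons p.1 p.2) := by
  rw [← measurePreserving_consE.lintegral_comp_emb consE.measurableEmbedding]
  simp only [consE_apply]; rfl

instance {d : ℕ} : (volume : Measure (Fin d → E n)).IsNegInvariant :=
  Measure.pi.isNegInvariant (fun _ => volume)

/-- Convolution of a symbol with a product of Schwartz functions. -/
def blk {d : ℕ} (K : Fin d → 𝓢(E n, ℂ)) (σ : (Fin d → E n) → ℂ) (X : Fin d → E n) : ℂ :=
  ∫ Y : Fin d → E n, (∏ j, K j (Y j)) * σ (X - Y)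

theorem integrable_prod_schwartz {d : ℕ} (K : Fin d → 𝓢(E n, ℂ)) :
    Integrable (fun Y : Fin d → E n => ∏ j, K j (Y j)) :=
  Integrable.fintype_prod fun j => (K j).integrable

theorem measurable_prod_schwartz {d : ℕ} (K : Fin d → 𝓢(E n, ℂ)) :
    Measurable (fun Y : Fin d → E n => ∏ j, K j (Y j)) :=
  Finset.measurable_prod _ fun j _ => (K j).continuous.measurable.comp (measurable_pi_apply j)

theorem _root_.MeasureTheory.Integrable.mul_bdd_measurable {α : Type*} [MeasurableSpace α]
    {μ : Measure α} {f g : α → ℂ} {M : ℝ} (hf : Integrable f μ) (hg : Measurable g)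
    (hM : ∀ x, ‖g x‖ ≤ M) : Integrable (fun x => f x * g x) μ := by
  simpa [mul_comm] using hf.bdd_mul hg.aestronglyMeasurable (Filter.Eventually.of_forall hM)

theorem norm_integral_mul_le {α : Type*} [MeasurableSpace α]
    {μ : Measure α} {f g : α → ℂ} {M : ℝ} (hf : Integrable f μ)
    (hM : ∀ x, ‖g x‖ ≤ M) : ‖∫ x, f x * g x ∂μ‖ ≤ (∫ x, ‖f x‖ ∂μ) * M := by
  rw [← integral_mul_const]
  refine norm_integral_le_of_norm_le (hf.norm.mul_const M) (Filter.Eventually.of_forall fun x => ?_)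
  rw [norm_mul]
  exact mul_le_mul_of_nonneg_left (hM x) (norm_nonneg _)

variable {σ : (Fin (N + 1) → E n) → ℂ} {M : ℝ} (K : Fin (N + 1) → 𝓢(E n, ℂ))

theorem measurable_blk {d : ℕ} {σ : (Fin d → E n) → ℂ} (K : Fin d → 𝓢(E n, ℂ))
    (hσ : Measurable σ) : Measurable (blk K σ) := by
  have : Measurable (fun p : (Fin d → E n) × (Fin d → E n) => (∏ j, K j (p.2 j)) * σ (p.1 - p.2)) :=
    ((measurable_prod_schwartz K).comp measurable_snd).mul
      (hσ.comp (measurable_fst.sub measurable_snd))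
  exact (this.stronglyMeasurable.integral_prod_right').measurable

theorem norm_blk_le {d : ℕ} {σ : (Fin d → E n) → ℂ} (K : Fin d → 𝓢(E n, ℂ))
    (hM : ∀ X, ‖σ X‖ ≤ M) (X : Fin d → E n) :
    ‖blk K σ X‖ ≤ (∫ Y : Fin d → E n, ‖∏ j, K j (Y j)‖) * M :=
  norm_integral_mul_le (integrable_prod_schwartz K) fun _ => hM _

/-- Convolution in the frequency slots only. -/
def blkFreq (σ : (Fin (N + 1) → E n) → ℂ) (p : E n × (Fin N → E n)) : ℂ :=
  ∫ η : Fin N → E n, (∏ j, K j.succ (η j)) * σ (Fin.cons p.1 (p.2 - η))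

/-- Convolution in the space slot only. -/
def blkSpace (σ : (Fin (N + 1) → E n) → ℂ) (p : E n × (Fin N → E n)) : ℂ :=
  ∫ y : E n, K 0 y * σ (Fin.cons (p.1 - y) p.2)

theorem measurable_blkFreq (hσ : Measurable σ) : Measurable (blkFreq K σ) := by
  have : Measurable (fun p : (E n × (Fin N → E n)) × (Fin N → E n) =>
      (∏ j, K (Fin.succ j) (p.2 j)) * σ (Fin.cons p.1.1 (p.1.2 - p.2))) :=
    ((measurable_prod_schwartz fun j => K j.succ).comp measurable_snd).mul
      (hσ.comp (measurable_cons.comp (measurable_fst.fst.prodMk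
        (measurable_fst.snd.sub measurable_snd))))
  exact (this.stronglyMeasurable.integral_prod_right').measurable

theorem measurable_blkSpace (hσ : Measurable σ) : Measurable (blkSpace K σ) := by
  have : Measurable (fun p : (E n × (Fin N → E n)) × E n =>
      K 0 p.2 * σ (Fin.cons (p.1.1 - p.2) p.1.2)) :=
    ((K 0).continuous.measurable.comp measurable_snd).mul
      (hσ.comp (measurable_cons.comp ((measurable_fst.fst.sub measurable_snd).prodMk
        measurable_fst.snd)))
  exact (this.stronglyMeasurable.integral_prod_right').measurable

theorem norm_blkFreq_le (hM : ∀ X, ‖σ X‖ ≤ M) (p : E n × (Fin N → E n)) :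
    ‖blkFreq K σ p‖ ≤ (∫ η : Fin N → E n, ‖∏ j, K j.succ (η j)‖) * M :=
  norm_integral_mul_le (integrable_prod_schwartz fun j => K j.succ) fun _ => hM _

theorem norm_blkSpace_le (hM : ∀ X, ‖σ X‖ ≤ M) (p : E n × (Fin N → E n)) :
    ‖blkSpace K σ p‖ ≤ (∫ y, ‖K 0 y‖) * M :=
  norm_integral_mul_le (K 0).integrable fun _ => hM _

theorem integrable_blk_integrand (hσ : Measurable σ) (hM : ∀ X, ‖σ X‖ ≤ M) (x : E n)
    (ξ : Fin N → E n) :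
    Integrable (fun p : E n × (Fin N → E n) =>
      (K 0 p.1 * ∏ j, K (Fin.succ j) (p.2 j)) * σ (Fin.cons (x - p.1) (ξ - p.2)))
      (volume.prod volume) :=
  (((K 0).integrable).mul_prod (integrable_prod_schwartz fun j => K j.succ)).mul_bdd_measurable
    (hσ.comp (measurable_cons.comp ((measurable_const.sub measurable_fst).prodMk
      (measurable_const.sub measurable_snd)))) fun _ => hM _

theorem blk_cons (x : E n) (ξ : Fin N → E n) :
    blk K σ (Fin.cons x ξ) = ∫ p : E n × (Fin N → E n),
      (K 0 p.1 * ∏ j, K (Fin.succ j) (p.2 j)) * σ (Fin.cons (x - p.1) (ξ - p.2)) := by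
  rw [blk, integral_cons]
  refine integral_congr_ae (Filter.Eventually.of_forall fun p => ?_)
  simp only [Fin.prod_univ_succ, Fin.cons_zero, Fin.cons_succ, cons_sub_cons]

/-- Convolving first in frequency leaves a convolution in `x` against `K 0`; this form shows the
band-limitation in `x`. -/
theorem blk_cons_eq_blkFreq (hσ : Measurable σ) (hM : ∀ X, ‖σ X‖ ≤ M) (x : E n)
    (ξ : Fin N → E n) :
    blk K σ (Fin.cons x ξ) = ∫ y, K 0 (x - y) * blkFreq K σ (y, ξ) := by
  rw [blk_cons, Measure.volume_eq_prod, integral_prod _ (integrable_blk_integrand K hσ hM x ξ),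
    ← integral_sub_left_eq_self _ volume x]
  refine integral_congr_ae (Filter.Eventually.of_forall fun y => ?_)
  simp only [mul_assoc, integral_const_mul, blkFreq, sub_sub_cancel]

/-- The opposite order leaves the frequency convolutions visible, which is what localizes the block
in space. -/
theorem blk_cons_eq_blkSpace (hσ : Measurable σ) (hM : ∀ X, ‖σ X‖ ≤ M) (x : E n)
    (ξ : Fin N → E n) :
    blk K σ (Fin.cons x ξ) =
      ∫ ζ : Fin N → E n, (∏ j, K j.succ (ξ j - ζ j)) * blkSpace K σ (x, ζ) := by
  rw [blk_cons, Measure.volume_eq_prod, integral_prod_symm _ (integrable_blk_integrand K hσ hM x ξ),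
    ← integral_sub_left_eq_self _ volume ξ]
  refine integral_congr_ae (Filter.Eventually.of_forall fun y => ?_)
  simp only [blkSpace, sub_sub_cancel, ← integral_const_mul, Pi.sub_apply]
  refine integral_congr_ae (Filter.Eventually.of_forall fun z => ?_)
  simp only
  ring

end Blocks

/-! ### Orthogonality of superpositions -/

section Kernels

/-- The inner product of two superpositions of mutually orthogonal functions vanishes. -/
theorem integral_conj_mul_eq_zero_of_kernels {X P Q : Type*} [MeasurableSpace X]
    [MeasurableSpace P] [MeasurableSpace Q] {μ : Measure X} {ρ : Measure P} {ρ' : Measure Q}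
    [SFinite μ] [SFinite ρ] [SFinite ρ'] (k : X → P → ℂ) (k' : X → Q → ℂ)
    (hm : Measurable (Function.uncurry k))
    (hk : Integrable (Function.uncurry k) (μ.prod ρ))
    (hk' : Integrable (Function.uncurry k') (μ.prod ρ'))
    (hm' : Measurable (Function.uncurry k'))
    {C : ℝ} (hL : ∀ x, ‖∫ q, k' x q ∂ρ'‖ ≤ C) (hb : ∀ p, ∃ C, ∀ x, ‖k x p‖ ≤ C)
    (h0 : ∀ p q, ∫ x, (starRingEnd ℂ) (k x p) * k' x q ∂μ = 0) :
    ∫ x, (starRingEnd ℂ) (∫ p, k x p ∂ρ) * (∫ q, k' x q ∂ρ') ∂μ = 0 := by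
  have hLm : Measurable fun x => ∫ q, k' x q ∂ρ' :=
    (hm'.stronglyMeasurable.integral_prod_right').measurable
  have conj_int {Y : Type _} [MeasurableSpace Y] {m : Measure Y} {f : Y → ℂ} (hf : Integrable f m) :
      Integrable (fun y => (starRingEnd ℂ) (f y)) m :=
    ⟨Complex.continuous_conj.comp_aestronglyMeasurable hf.1,
      by simpa [HasFiniteIntegral] using hf.2⟩
  -- Fubini is applied twice: first with the second superposition kept as a bounded function of `x`,
  -- then with `p` frozen.
  have h1 : Integrable (Function.uncurry fun x p =>
      (starRingEnd ℂ) (k x p) * (∫ q, k' x q ∂ρ')) (μ.prod ρ) :=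
    (conj_int hk).mul_bdd_measurable (hLm.comp measurable_fst) fun p => hL _
  calc _ = ∫ x, ∫ p, (starRingEnd ℂ) (k x p) * (∫ q, k' x q ∂ρ') ∂ρ ∂μ := by
        refine integral_congr_ae (Filter.Eventually.of_forall fun x => ?_)
        simp only [← integral_conj, integral_mul_const]
    _ = ∫ p, ∫ x, (starRingEnd ℂ) (k x p) * (∫ q, k' x q ∂ρ') ∂μ ∂ρ := integral_integral_swap h1
    _ = 0 := by
        refine integral_eq_zero_of_ae (Filter.Eventually.of_forall fun p => ?_)
        obtain ⟨C', hC'⟩ := hb p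
        have h2 : Integrable (Function.uncurry fun x q =>
            (starRingEnd ℂ) (k x p) * k' x q) (μ.prod ρ') := by
          refine hk'.bdd_mul (f := fun z : X × Q => (starRingEnd ℂ) (k z.1 p)) (c := C')
            (Measurable.aestronglyMeasurable ?_) (Filter.Eventually.of_forall fun z => by
              simpa using hC' z.1)
          exact Complex.continuous_conj.measurable.comp
            (hm.comp (measurable_fst.prodMk measurable_const))
        calc _ = ∫ x, ∫ q, (starRingEnd ℂ) (k x p) * k' x q ∂ρ' ∂μ := by
              simp only [integral_const_mul]
          _ = ∫ q, ∫ x, (starRingEnd ℂ) (k x p) * k' x q ∂μ ∂ρ' := integral_integral_swap h2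
          _ = 0 := integral_eq_zero_of_ae (Filter.Eventually.of_forall fun q => h0 p q)

end Kernels

/-! ### Orthogonality of the contributions of separated frequencies -/

section Orthogonality

variable {n N : ℕ}

/-- The plane wave `e^{i x·a}`. -/
def wave (x a : E n) : ℂ := Complex.exp (Complex.I * ((inner ℝ x a : ℝ) : ℂ))

theorem norm_wave (x a : E n) : ‖wave x a‖ = 1 := norm_exp_I_mul_ofReal _

theorem measurable_wave {α : Type*} [MeasurableSpace α] {f g : α → E n} (hf : Measurable f)
    (hg : Measurable g) : Measurable fun a => wave (f a) (g a) :=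
  ((Complex.measurable_ofReal.comp (hf.inner hg)).const_mul _).cexp

theorem conj_wave_mul_wave (x a a' : E n) : (starRingEnd ℂ) (wave x a) * wave x a' =
    Complex.exp (-(Complex.I * ((inner ℝ x (a - a') : ℝ) : ℂ))) := by
  rw [wave, wave, conj_exp_I_mul_ofReal, ← Complex.exp_add, inner_sub_right]
  push_cast; ring_nf

/-- The two copies of `θ` and the two of `κ`, conjugated or not, have spectra in balls of radii `1,
1, R, R`, so the transform of their product vanishes at `a - a'`. -/
theorem integral_modulated_eq_zero {R : ℝ} {θ κ : E n → ℂ} (hθ : IsSynthesis 1 θ)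
    (hκ : IsSynthesis R κ) (hκb : BandLimited R κ) (hκi : Integrable κ) (v y y' a a' : E n)
    (h : 2 * R + 2 < ‖a - a'‖) :
    ∫ x, (starRingEnd ℂ) (θ (x - v) * κ (x - y) * wave x a) *
      (θ (x - v) * κ (x - y') * wave x a') = 0 := by
  have h1 := (hκb.translate y').mul (hκi.comp_sub_right y') (hκ.translate y).conj
  have h2 := h1.1.mul h1.2 (hθ.translate v)
  have h3 := (h2.1.mul h2.2 (hθ.translate v).conj).1 (a - a') (by linarith)
  rw [← h3, fourierHat]
  refine integral_congr_ae (Filter.Eventually.of_forall fun x => ?_)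
  simp only [← conj_wave_mul_wave, map_mul]
  ring

/-- The localized output `θ(x - v) ∫ e^{i x·(ξ₁+⋯+ξ_N)} b(x, ξ) g(ξ) dξ`. -/
def locOp (θ : E n → ℂ) (v : E n) (b : E n × (Fin N → E n) → ℂ) (g : (Fin N → E n) → ℂ)
    (x : E n) : ℂ :=
  θ (x - v) * ∫ ξ : Fin N → E n, wave x (∑ j, ξ j) * b (x, ξ) * g ξ

variable (θ κ : 𝓢(E n, ℂ)) (v : E n) (τ : E n × (Fin N → E n) → ℂ)

/-- The integral kernel of `locOp`. -/
def locKer (g : (Fin N → E n) → ℂ) (x : E n) (p : E n × (Fin N → E n)) : ℂ :=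
  (θ (x - v) * κ (x - p.1) * wave x (∑ j, p.2 j)) * (τ p * g p.2)

theorem measurable_sum_freq : Measurable fun ξ : Fin N → E n => ∑ j, ξ j :=
  Finset.measurable_sum _ fun j _ => measurable_pi_apply j

variable {τ} {M : ℝ} {g g' : (Fin N → E n) → ℂ}

theorem measurable_locKer (hτ : Measurable τ) (hg : Measurable g) :
    Measurable (Function.uncurry (locKer θ κ v τ g)) := by
  unfold locKer Function.uncurry
  refine ((Measurable.mul ?_ ?_).mul ?_).mul
    ((hτ.comp measurable_snd).mul (hg.comp measurable_snd.snd))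
  · exact θ.continuous.measurable.comp (measurable_fst.sub measurable_const)
  · exact κ.continuous.measurable.comp (measurable_fst.sub measurable_snd.fst)
  · exact measurable_wave measurable_fst (measurable_sum_freq.comp measurable_snd.snd)

theorem integrable_prod_kernel (hg : Integrable g) (x : E n) :
    Integrable (fun p : E n × (Fin N → E n) => κ (x - p.1) * g p.2) (volume.prod volume) :=
  (κ.integrable.comp_sub_left x).mul_prod hg

theorem norm_locKer_le (hM : ∀ p, ‖τ p‖ ≤ M) (x : E n) (p : E n × (Fin N → E n)) :
    ‖locKer θ κ v τ g x p‖ ≤ ‖θ (x - v)‖ * (M * ‖κ (x - p.1) * g p.2‖) := by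
  simp only [locKer, norm_mul, norm_wave, mul_one]
  have := mul_le_mul_of_nonneg_right (hM p)
    (mul_nonneg (norm_nonneg (κ (x - p.1))) (norm_nonneg (g p.2)))
  have := mul_le_mul_of_nonneg_left this (norm_nonneg (θ (x - v)))
  linarith

theorem integrable_locKer_right (hτ : Measurable τ) (hM : ∀ p, ‖τ p‖ ≤ M) (hg : Measurable g)
    (hgi : Integrable g) (x : E n) :
    Integrable (locKer θ κ v τ g x) (volume.prod volume) := by
  refine (((integrable_prod_kernel κ hgi x).norm.const_mul M).const_mul ‖θ (x - v)‖).mono'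
    ((measurable_locKer θ κ v hτ hg).comp measurable_prodMk_left).aestronglyMeasurable
    (Filter.Eventually.of_forall fun p => ?_)
  exact norm_locKer_le θ κ v hM x p

theorem integral_norm_locKer_le (hτ : Measurable τ) (hM : ∀ p, ‖τ p‖ ≤ M) (hg : Measurable g)
    (hgi : Integrable g) (x : E n) :
    ∫ p, ‖locKer θ κ v τ g x p‖ ∂(volume.prod volume) ≤
      ‖θ (x - v)‖ * (M * ((∫ y, ‖κ y‖) * ∫ ξ, ‖g ξ‖)) := by
  have h := integral_mono (integrable_locKer_right θ κ v hτ hM hg hgi x).norm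
    (((integrable_prod_kernel κ hgi x).norm.const_mul M).const_mul ‖θ (x - v)‖)
    (fun p => norm_locKer_le θ κ v hM x p)
  refine h.trans_eq ?_
  simp only [integral_const_mul, norm_mul]
  rw [integral_prod_mul (fun y => ‖κ (x - y)‖) (fun ξ => ‖g ξ‖),
    integral_sub_left_eq_self (fun y => ‖κ y‖)]

theorem integrable_locKer (hτ : Measurable τ) (hM : ∀ p, ‖τ p‖ ≤ M) (hg : Measurable g)
    (hgi : Integrable g) :
    Integrable (Function.uncurry (locKer θ κ v τ g)) (volume.prod (volume.prod volume)) := by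
  have hm := measurable_locKer θ κ v hτ hg
  rw [integrable_prod_iff hm.aestronglyMeasurable]
  refine ⟨Filter.Eventually.of_forall fun x => integrable_locKer_right θ κ v hτ hM hg hgi x, ?_⟩
  refine (((θ.integrable.comp_sub_right v).norm).mul_const
    (M * ((∫ y, ‖κ y‖) * ∫ ξ, ‖g ξ‖))).mono'
    (hm.norm.stronglyMeasurable.integral_prod_right').aestronglyMeasurable
    (Filter.Eventually.of_forall fun x => ?_)
  rw [Real.norm_of_nonneg (integral_nonneg fun p => norm_nonneg _)]
  exact integral_norm_locKer_le θ κ v hτ hM hg hgi x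

variable {b : E n × (Fin N → E n) → ℂ}

theorem locOp_eq_integral_locKer (hτ : Measurable τ) (hM : ∀ p, ‖τ p‖ ≤ M)
    (hb : ∀ x ξ, b (x, ξ) = ∫ y, κ (x - y) * τ (y, ξ)) (hg : Measurable g) (hgi : Integrable g)
    (x : E n) :
    locOp θ v b g x = ∫ p, locKer θ κ v τ g x p ∂(volume.prod volume) := by
  rw [integral_prod_symm _ (integrable_locKer_right θ κ v hτ hM hg hgi x), locOp,
    ← integral_const_mul]
  refine integral_congr_ae (Filter.Eventually.of_forall fun ξ => ?_)
  simp only [hb, locKer]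
  rw [show θ (x - v) * (wave x (∑ j, ξ j) * (∫ y, κ (x - y) * τ (y, ξ)) * g ξ) =
    (θ (x - v) * wave x (∑ j, ξ j) * g ξ) * ∫ y, κ (x - y) * τ (y, ξ) by ring,
    ← integral_const_mul]
  refine integral_congr_ae (Filter.Eventually.of_forall fun y => ?_)
  simp only
  ring

theorem norm_locOp_le (hτ : Measurable τ) (hM : ∀ p, ‖τ p‖ ≤ M)
    (hb : ∀ x ξ, b (x, ξ) = ∫ y, κ (x - y) * τ (y, ξ)) (hg : Measurable g) (hgi : Integrable g) :
    ∃ C, ∀ x, ‖locOp θ v b g x‖ ≤ C := by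
  have hM0 : 0 ≤ M := (norm_nonneg _).trans (hM 0)
  obtain ⟨A, hA⟩ : ∃ A, ∀ x, ‖θ x‖ ≤ A := ⟨_, SchwartzMap.norm_le_seminorm ℝ θ⟩
  refine ⟨A * (M * ((∫ y, ‖κ y‖) * ∫ ξ, ‖g ξ‖)), fun x => ?_⟩
  rw [locOp_eq_integral_locKer θ κ v hτ hM hb hg hgi]
  refine (norm_integral_le_integral_norm _).trans
    ((integral_norm_locKer_le θ κ v hτ hM hg hgi x).trans ?_)
  exact mul_le_mul_of_nonneg_right (hA _) (mul_nonneg hM0 (mul_nonneg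
    (integral_nonneg fun _ => norm_nonneg _) (integral_nonneg fun _ => norm_nonneg _)))

/-- Writing `b` as a convolution with `κ` makes each output a superposition, over `(y, ξ)`, of the
functions `θ(x - v) κ(x - y) e^{ix·∑ξ_j}`; those from the supports of `g` and `g'` are mutually
orthogonal. -/
theorem locOp_orthogonal {R : ℝ} (hθ : IsSynthesis 1 θ) (hκ : IsSynthesis R κ)
    (hκb : BandLimited R κ) (hτ : Measurable τ) (hM : ∀ p, ‖τ p‖ ≤ M)
    (hb : ∀ x ξ, b (x, ξ) = ∫ y, κ (x - y) * τ (y, ξ)) (hg : Measurable g) (hgi : Integrable g)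
    (hg' : Measurable g') (hgi' : Integrable g')
    (hsep : ∀ ξ ξ', g ξ ≠ 0 → g' ξ' ≠ 0 → 2 * R + 2 < ‖∑ j, ξ j - ∑ j, ξ' j‖) :
    ∫ x, (starRingEnd ℂ) (locOp θ v b g x) * locOp θ v b g' x = 0 := by
  obtain ⟨C, hC⟩ := norm_locOp_le θ κ v hτ hM hb hg' hgi'
  simp only [locOp_eq_integral_locKer θ κ v hτ hM hb hg hgi,
    locOp_eq_integral_locKer θ κ v hτ hM hb hg' hgi'] at hC ⊢
  refine integral_conj_mul_eq_zero_of_kernels (C := C) _ _ (measurable_locKer θ κ v hτ hg)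
    (integrable_locKer θ κ v hτ hM hg hgi) (integrable_locKer θ κ v hτ hM hg' hgi')
    (measurable_locKer θ κ v hτ hg') hC (fun p => ?_) (fun p q => ?_)
  · obtain ⟨A, hA⟩ : ∃ A, ∀ x, ‖θ x‖ ≤ A := ⟨_, SchwartzMap.norm_le_seminorm ℝ θ⟩
    obtain ⟨A', hA'⟩ : ∃ A, ∀ x, ‖κ x‖ ≤ A := ⟨_, SchwartzMap.norm_le_seminorm ℝ κ⟩
    refine ⟨A * A' * ‖τ p * g p.2‖, fun x => ?_⟩
    rw [locKer, norm_mul, norm_mul, norm_mul, norm_wave, mul_one]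
    gcongr
    · exact (norm_nonneg _).trans (hA 0)
    · exact hA _
    · exact hA' _
  · by_cases h1 : g p.2 = 0
    · simp [locKer, h1]
    by_cases h2 : g' q.2 = 0
    · simp [locKer, h2]
    have h := integral_modulated_eq_zero hθ hκ hκb κ.integrable v p.1 q.1 _ _ (hsep _ _ h1 h2)
    calc _ = ((starRingEnd ℂ) (τ p * g p.2) * (τ q * g' q.2)) *
          ∫ x, (starRingEnd ℂ) (θ (x - v) * κ (x - p.1) * wave x (∑ j, p.2 j)) *
            (θ (x - v) * κ (x - q.1) * wave x (∑ j, q.2 j)) := by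
          rw [← integral_const_mul]
          refine integral_congr_ae (Filter.Eventually.of_forall fun x => ?_)
          simp only [locKer, map_mul]
          ring
      _ = 0 := by rw [h, mul_zero]

end Orthogonality

/-! ### The `L²` estimate on one cell -/

section LocalEstimate

variable {n N : ℕ}

theorem pcell_eq_pi {d : ℕ} (ν : Fin d → Fin n → ℤ) :
    pcell ν = Set.univ.pi fun j => cell (ν j) := by
  ext X; simp [pcell, cell, funext_iff]

theorem eLpNorm_two_restrict_ne_top (f : 𝓢(E n, ℂ)) (s : Set (E n)) :
    eLpNorm f 2 (volume.restrict s) ≠ ∞ := by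
  have h : MemLp f 2 volume := f.memLp 2 volume
  exact ((eLpNorm_mono_measure f Measure.restrict_le_self).trans_lt h.2).ne

theorem setLIntegral_pcell_prod (G : Fin N → 𝓢(E n, ℂ)) (ν : Fin N → Fin n → ℤ) :
    ∫⁻ ξ in pcell ν, ‖∏ j, G j (ξ j)‖ₑ ^ 2 =
      (∏ j, eLpNorm (G j) 2 (volume.restrict (cell (ν j)))) ^ 2 := by
  have hi (j : Fin N) : Integrable (fun x => ‖G j x‖ ^ 2) := by
    simpa using ((G j).memLp 2).integrable_norm_pow (by simp)
  have h1 (j : Fin N) : eLpNorm (G j) 2 (volume.restrict (cell (ν j))) ^ 2 =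
      ENNReal.ofReal (∫ x in cell (ν j), ‖G j x‖ ^ 2) := by
    rw [sq_eLpNorm_two, ofReal_integral_eq_lintegral_ofReal (hi j).restrict
      (Filter.Eventually.of_forall fun x => by positivity)]
    refine lintegral_congr fun x => ?_
    rw [← ofReal_norm, ENNReal.ofReal_pow (norm_nonneg _)]
  have hr : (volume : Measure (Fin N → E n)).restrict (pcell ν) =
      Measure.pi fun j => volume.restrict (cell (ν j)) := by
    rw [pcell_eq_pi, volume_pi, Measure.restrict_pi_pi]
  rw [← Finset.prod_pow]
  simp_rw [h1]
  rw [← ENNReal.ofReal_prod_of_nonneg fun j _ => by positivity,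
    ← integral_fintype_prod_eq_prod (fun j x => ‖G j x‖ ^ 2), hr,
    ofReal_integral_eq_lintegral_ofReal (Integrable.fintype_prod fun j => (hi j).restrict)
      (Filter.Eventually.of_forall fun x => by positivity)]
  refine lintegral_congr fun x => ?_
  rw [Finset.prod_pow, ← norm_prod, ← ofReal_norm, ENNReal.ofReal_pow (norm_nonneg _)]

theorem enorm_integral_mul_sq_le {α : Type*} [MeasurableSpace α] {μ : Measure α} {f g : α → ℂ}
    (hf : Measurable f) (hg : Measurable g) :
    ‖∫ x, f x * g x ∂μ‖ₑ ^ 2 ≤ (∫⁻ x, ‖f x‖ₑ ^ 2 ∂μ) * ∫⁻ x, ‖g x‖ₑ ^ 2 ∂μ := by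
  have h1 : ‖∫ x, f x * g x ∂μ‖ₑ ≤ ∫⁻ x, ‖f x‖ₑ * ‖g x‖ₑ ∂μ :=
    (enorm_integral_le_lintegral_enorm _).trans_eq (by simp [enorm_mul])
  have h2 := ENNReal.lintegral_mul_le_Lp_mul_Lq μ Real.HolderConjugate.two_two
    hf.enorm.aemeasurable hg.enorm.aemeasurable
  have h3 := pow_le_pow_left₀ zero_le (h1.trans h2) 2
  have e (t : ℝ≥0∞) : (t ^ (1 / 2 : ℝ)) ^ 2 = t := by
    rw [← ENNReal.rpow_natCast, ← ENNReal.rpow_mul]; norm_num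
  simpa only [mul_pow, e, ENNReal.rpow_two] using h3

variable {θ κ : 𝓢(E n, ℂ)} {τ b : E n × (Fin N → E n) → ℂ} {M R : ℝ}

theorem measurable_locOp (hb : Measurable b) {g : (Fin N → E n) → ℂ} (hg : Measurable g)
    (v : E n) : Measurable (locOp θ v b g) := by
  have : Measurable (fun p : E n × (Fin N → E n) =>
      wave p.1 (∑ j, p.2 j) * b (p.1, p.2) * g p.2) :=
    ((measurable_wave measurable_fst (measurable_sum_freq.comp measurable_snd)).mul hb).mul
      (hg.comp measurable_snd)
  exact (θ.continuous.measurable.comp (measurable_id.sub_const v)).mul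
    (this.stronglyMeasurable.integral_prod_right').measurable

theorem integral_mul_indicator_pcell (f g : (Fin N → E n) → ℂ) (ν : Fin N → Fin n → ℤ) :
    ∫ ξ, f ξ * (pcell ν).indicator g ξ = ∫ ξ in pcell ν, f ξ * g ξ := by
  rw [← integral_indicator (measurableSet_pcell ν)]
  refine integral_congr_ae (Filter.Eventually.of_forall fun ξ => ?_)
  simp only [Set.indicator]
  split_ifs <;> simp

/-- Cauchy–Schwarz in `ξ` on one frequency cell separates the symbol from the inputs; the decay of
`θ` then reduces the integral over all `x` to the uniform bound on cells. -/
theorem eLpNorm_locOp_indicator_sq_le {Cθ : ℝ≥0}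
    (hCθ : ∀ (m : Fin n → ℤ) (B : E n → ℝ≥0∞) (D : ℝ≥0∞),
      (∀ l, ∫⁻ x in cell l, B x ≤ D) → ∫⁻ x, ‖θ (x - lat m)‖ₑ ^ 2 * B x ≤ Cθ * D)
    (hbm : Measurable b) (G : Fin N → 𝓢(E n, ℂ)) (ν : Fin N → Fin n → ℤ) {u : ℝ≥0∞}
    (hU : ∀ l, ∫⁻ x in cell l, ∫⁻ ξ in pcell ν, ‖b (x, ξ)‖ₑ ^ 2 ≤ u ^ 2) (m : Fin n → ℤ) :
    eLpNorm (locOp θ (lat m) b ((pcell ν).indicator fun ξ => ∏ j, G j (ξ j))) 2 volume ^ 2 ≤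
      Cθ * (u * ∏ j, eLpNorm (G j) 2 (volume.restrict (cell (ν j)))) ^ 2 := by
  rw [sq_eLpNorm_two]
  simp only [locOp, enorm_mul, mul_pow]
  refine hCθ m _ _ fun l => ?_
  have key (x : E n) : ‖∫ ξ : Fin N → E n, wave x (∑ j, ξ j) * b (x, ξ) *
      (pcell ν).indicator (fun ξ => ∏ j, G j (ξ j)) ξ‖ₑ ^ 2 ≤
      (∫⁻ ξ in pcell ν, ‖b (x, ξ)‖ₑ ^ 2) *
        (∏ j, eLpNorm (G j) 2 (volume.restrict (cell (ν j)))) ^ 2 := by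
    rw [integral_mul_indicator_pcell, ← setLIntegral_pcell_prod]
    refine (enorm_integral_mul_sq_le ?_ (measurable_prod_schwartz G)).trans_eq ?_
    · exact (measurable_wave measurable_const measurable_sum_freq).mul
        (hbm.comp measurable_prodMk_left)
    · congr 1
      refine lintegral_congr fun ξ => ?_
      rw [enorm_mul, ← ofReal_norm (wave _ _), norm_wave, ENNReal.ofReal_one, one_mul]
  refine (lintegral_mono key).trans ?_
  rw [lintegral_mul_const _ (hbm.enorm.pow_const 2).lintegral_prod_right']
  gcongr
  exact hU l

/-- Each frequency is within `n` of its lattice point, so passing from the two lattice sums to the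
frequency sums costs at most `2 * N * n`. -/
theorem two_mul_lt_norm_sum_sub {ν ν' : Fin N → Fin n → ℤ} {ξ ξ' : Fin N → E n}
    (hξ : ξ ∈ pcell ν) (hξ' : ξ' ∈ pcell ν') {ρ : ℝ}
    (h : ρ + 2 * N * n < ‖lat (∑ j, ν' j - ∑ j, ν j)‖) :
    ρ < ‖∑ j, ξ j - ∑ j, ξ' j‖ := by
  have hl : lat (∑ j, ν' j - ∑ j, ν j) =
      (∑ j, ξ' j - ∑ j, ξ j) + (∑ j, (ξ j - lat (ν j)) - ∑ j, (ξ' j - lat (ν' j))) := by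
    have e (ν : Fin N → Fin n → ℤ) : (lat (∑ j, ν j) : E n) = ∑ j, lat (ν j) := by
      ext i; simp [lat]
    have e2 (a b : Fin n → ℤ) : (lat (a - b) : E n) = lat a - lat b := by
      ext i; simp [lat]
    rw [e2, e, e]
    simp only [Finset.sum_sub_distrib]
    abel
  have hs (ν : Fin N → Fin n → ℤ) (ξ : Fin N → E n) (h : ξ ∈ pcell ν) :
      ‖∑ j, (ξ j - lat (ν j))‖ ≤ N * n := by
    refine (norm_sum_le _ _).trans ?_
    have := Finset.sum_le_card_nsmul Finset.univ (fun j => ‖ξ j - lat (ν j)‖) n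
      (fun j _ => norm_sub_lat_le (congrFun h j))
    simpa using this
  have h1 := norm_add_le (∑ j, ξ' j - ∑ j, ξ j)
    (∑ j, (ξ j - lat (ν j)) - ∑ j, (ξ' j - lat (ν' j)))
  have h2 := norm_sub_le (∑ j, (ξ j - lat (ν j))) (∑ j, (ξ' j - lat (ν' j)))
  have h3 := hs ν ξ hξ
  have h4 := hs ν' ξ' hξ'
  rw [← hl] at h1
  rw [norm_sub_rev]
  linarith

/-- Almost orthogonality for a pointwise convergent series of functions in `L²`. -/
theorem eLpNorm_sq_le_of_hasSum_of_orthogonal {ι X : Type*} [Countable ι] [MeasurableSpace X]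
    {μ : Measure X} (F : ι → X → ℂ) (hFm : ∀ ν, Measurable (F ν)) (a : ι → ℝ≥0)
    (ha : ∀ ν, eLpNorm (F ν) 2 μ ≤ a ν) (S : ι → Fin n → ℤ) (D : Finset (Fin n → ℤ))
    (horth : ∀ ν ν', S ν' - S ν ∉ D → ∫ x, (starRingEnd ℂ) (F ν x) * F ν' x ∂μ = 0)
    (B : ℝ≥0∞) (hB : ∀ A₀ : (Fin n → ℤ) → ℝ≥0,
      ∑' ν, (a ν : ℝ≥0∞) * A₀ (S ν) ≤ B * seqNorm 2 (fun l => (A₀ l : ℝ≥0∞)))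
    (f : X → ℂ) (hf : ∀ x, HasSum (fun ν => F ν x) (f x)) :
    eLpNorm f 2 μ ^ 2 ≤ D.card * B ^ 2 := by
  have hmem ν : MemLp (F ν) 2 μ :=
    ⟨(hFm ν).aestronglyMeasurable, (ha ν).trans_lt ENNReal.coe_lt_top⟩
  have hH ν : ‖(hmem ν).toLp (F ν)‖ₑ ≤ a ν := by
    rw [Lp.enorm_toLp]; exact ha ν
  have horth' (ν ν') (hd : S ν' - S ν ∉ D) :
      inner ℂ ((hmem ν).toLp (F ν)) ((hmem ν').toLp (F ν')) = 0 := by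
    rw [L2.inner_def, ← horth ν ν' hd]
    refine integral_congr_ae ?_
    filter_upwards [(hmem ν).coeFn_toLp, (hmem ν').coeFn_toLp] with x h1 h2
    rw [h1, h2, RCLike.inner_apply, mul_comm]
  have hsum (s : Finset ι) : eLpNorm (fun x => ∑ ν ∈ s, F ν x) 2 μ ^ 2 ≤ D.card * B ^ 2 := by
    have h := enorm_sum_sq_le_of_orthogonal _ a hH S D horth' B hB s
    have e : ‖∑ ν ∈ s, (hmem ν).toLp (F ν)‖ₑ = eLpNorm (fun x => ∑ ν ∈ s, F ν x) 2 μ := by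
      rw [Lp.enorm_def]
      refine eLpNorm_congr_ae ?_
      have h1 : ∀ᵐ x ∂μ, ∀ ν ∈ s, (hmem ν).toLp (F ν) x = F ν x :=
        (ae_ball_iff s.countable_toSet).mpr fun ν _ => (hmem ν).coeFn_toLp
      filter_upwards [Lp.coeFn_finsetSum s fun ν => (hmem ν).toLp (F ν), h1] with x h2 h3
      rw [h2, Finset.sum_apply]
      exact Finset.sum_congr rfl h3
    rwa [e] at h
  -- Fatou transfers the bound, uniform over finite partial sums, to the pointwise limit.
  have hfinal : eLpNorm f 2 μ ≤ (D.card * B ^ 2) ^ (1 / 2 : ℝ) := by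
    refine Lp.eLpNorm_le_of_ae_tendsto (u := Filter.atTop)
      (f := fun s x => ∑ ν ∈ s, F ν x)
      (Filter.Eventually.of_forall fun s => ?_) (fun s => ?_)
      (Filter.Eventually.of_forall fun x => hf x)
    · rw [one_div, ENNReal.le_rpow_inv_iff two_pos]
      exact_mod_cast hsum s
    · exact (Finset.measurable_sum _ fun ν _ => hFm ν).aestronglyMeasurable
  calc _ ≤ ((D.card * B ^ 2) ^ (1 / 2 : ℝ)) ^ 2 := by gcongr
    _ = D.card * B ^ 2 := by
        rw [← ENNReal.rpow_natCast, ← ENNReal.rpow_mul]; norm_num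

theorem hasSum_locOp (hbm : Measurable b) {Mb : ℝ} (hMb : ∀ p, ‖b p‖ ≤ Mb)
    {g : (Fin N → E n) → ℂ} (hgi : Integrable g) (v x : E n) :
    HasSum (fun ν => locOp θ v b ((pcell ν).indicator g) x) (locOp θ v b g x) := by
  have hint : Integrable (fun ξ : Fin N → E n => wave x (∑ j, ξ j) * b (x, ξ) * g ξ) := by
    have := hgi.mul_bdd_measurable (g := fun ξ : Fin N → E n => wave x (∑ j, ξ j) * b (x, ξ))
      (M := Mb) ((measurable_wave measurable_const measurable_sum_freq).mul
        (hbm.comp measurable_prodMk_left)) (fun ξ => by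
          rw [norm_mul, norm_wave, one_mul]; exact hMb _)
    simpa only [mul_comm] using this
  have h1 := hasSum_integral_iUnion (f := fun ξ : Fin N → E n =>
    wave x (∑ j, ξ j) * b (x, ξ) * g ξ) measurableSet_pcell pairwise_disjoint_pcell
    hint.integrableOn
  rw [iUnion_pcell, setIntegral_univ] at h1
  have h2 := h1.mul_left (θ (x - v))
  simp only [← integral_mul_indicator_pcell] at h2
  exact h2

/-- The local `L²` estimate for symbols that are band-limited in the space variable. -/
theorem eLpNorm_cell_sq_le {Cθ : ℝ≥0} (hθ : IsSynthesis 1 θ) (hθ1 : ∀ x : E n, ‖x‖ ≤ n → 1 ≤ ‖θ x‖)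
    (hCθ : ∀ (m : Fin n → ℤ) (B : E n → ℝ≥0∞) (D : ℝ≥0∞),
      (∀ l, ∫⁻ x in cell l, B x ≤ D) → ∫⁻ x, ‖θ (x - lat m)‖ₑ ^ 2 * B x ≤ Cθ * D)
    (hκ : IsSynthesis R κ) (hκb : BandLimited R κ) (hτ : Measurable τ) (hM : ∀ p, ‖τ p‖ ≤ M)
    (hb : ∀ x ξ, b (x, ξ) = ∫ y, κ (x - y) * τ (y, ξ)) (hbm : Measurable b)
    {Mb : ℝ} (hMb : ∀ p, ‖b p‖ ≤ Mb)
    (G : Fin N → 𝓢(E n, ℂ)) {w : (Fin N → Fin n → ℤ) → ℝ≥0} {U c : ℝ≥0}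
    (hU : ∀ l ν, ∫⁻ x in cell l, ∫⁻ ξ in pcell ν, ‖b (x, ξ)‖ₑ ^ 2 ≤ (w ν * U : ℝ≥0∞) ^ 2)
    (hw : ∀ (A₀ : (Fin n → ℤ) → ℝ≥0) (A : Fin N → (Fin n → ℤ) → ℝ≥0),
      ∑' ν, (w ν : ℝ≥0∞) * (A₀ (∑ j, ν j) : ℝ≥0∞) * ∏ j, (A j (ν j) : ℝ≥0∞) ≤
        c * (seqNorm 2 (fun μ => (A₀ μ : ℝ≥0∞)) * ∏ j, seqNorm 2 (fun μ => (A j μ : ℝ≥0∞))))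
    {D : Finset (Fin n → ℤ)} (hD : ∀ d, d ∉ D → 2 * R + 2 + 2 * N * n < ‖(lat d : E n)‖)
    (m : Fin n → ℤ) :
    eLpNorm (fun x => ∫ ξ : Fin N → E n, wave x (∑ j, ξ j) * b (x, ξ) * ∏ j, G j (ξ j)) 2
      (volume.restrict (cell m)) ^ 2 ≤
      D.card * (Cθ * (c * U * ∏ j, eLpNorm (G j) 2 volume) ^ 2) := by
  have hgm : Measurable fun ξ : Fin N → E n => ∏ j, G j (ξ j) := measurable_prod_schwartz G
  have hgi : Integrable fun ξ : Fin N → E n => ∏ j, G j (ξ j) := integrable_prod_schwartz G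
  have hgνm ν := hgm.indicator (measurableSet_pcell ν)
  have hgνi ν := hgi.indicator (measurableSet_pcell ν)
  have hGfin (j : Fin N) (l : Fin n → ℤ) : eLpNorm (G j) 2 (volume.restrict (cell l)) ≠ ∞ :=
    eLpNorm_two_restrict_ne_top (G j) (cell l)
  obtain ⟨a, ha⟩ : ∃ a : (Fin N → Fin n → ℤ) → ℝ≥0, ∀ ν, (a ν : ℝ≥0∞) =
      NNReal.sqrt Cθ * (w ν * U * ∏ j, eLpNorm (G j) 2 (volume.restrict (cell (ν j)))) := by
    refine ⟨fun ν => NNReal.sqrt Cθ * (w ν * U *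
      ∏ j, (eLpNorm (G j) 2 (volume.restrict (cell (ν j)))).toNNReal), fun ν => ?_⟩
    push_cast
    simp only [ENNReal.coe_toNNReal (hGfin _ _)]
  have hCsq : (NNReal.sqrt Cθ : ℝ≥0∞) ^ 2 = Cθ := by
    norm_cast; exact NNReal.sq_sqrt Cθ
  have hle ν : eLpNorm (locOp θ (lat m) b ((pcell ν).indicator fun ξ => ∏ j, G j (ξ j))) 2
      volume ≤ a ν := by
    have h := eLpNorm_locOp_indicator_sq_le hCθ hbm G ν (u := w ν * U) (fun l => hU l ν) m
    rw [← hCsq, ← mul_pow, ← ha] at h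
    exact (ENNReal.pow_le_pow_left_iff two_ne_zero).mp h
  have hB (A₀ : (Fin n → ℤ) → ℝ≥0) :
      ∑' ν, (a ν : ℝ≥0∞) * A₀ (∑ j, ν j) ≤
        (NNReal.sqrt Cθ * (c * U * ∏ j, eLpNorm (G j) 2 volume)) *
          seqNorm 2 (fun l => (A₀ l : ℝ≥0∞)) := by
    -- The test sequences are the norms of `G j` on the cells; their `ℓ²` norm is the full `L²` norm
    -- of `G j`.
    have h := hw A₀ fun j l => (eLpNorm (G j) 2 (volume.restrict (cell l))).toNNReal
    simp only [ENNReal.coe_toNNReal (hGfin _ _), seqNorm_two_eLpNorm_cell] at h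
    have h2 := mul_le_mul_right h ((NNReal.sqrt Cθ : ℝ≥0∞) * U)
    rw [← ENNReal.tsum_mul_left] at h2
    refine (ENNReal.tsum_le_tsum fun ν => ?_).trans (h2.trans_eq ?_)
    · rw [ha]
      apply le_of_eq
      ring
    · ring
  have h := eLpNorm_sq_le_of_hasSum_of_orthogonal _
    (fun ν => measurable_locOp (θ := θ) hbm (hgνm ν) (lat m)) a hle (fun ν => ∑ j, ν j) D
    (fun ν ν' hd => locOp_orthogonal θ κ (lat m) hθ hκ hκb hτ hM hb (hgνm ν) (hgνi ν) (hgνm ν')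
      (hgνi ν') (fun ξ ξ' h1 h2 => two_mul_lt_norm_sum_sub
        (Set.mem_of_indicator_ne_zero h1) (Set.mem_of_indicator_ne_zero h2) (hD _ hd)))
    _ hB _ (fun x => hasSum_locOp (θ := θ) hbm hMb hgi (lat m) x)
  rw [mul_pow, hCsq] at h
  refine le_trans ?_ h
  gcongr
  -- On the cell `m` the localizer has modulus at least `1`, so it can be removed.
  refine le_trans ?_ (eLpNorm_mono_measure _ (Measure.restrict_le_self (s := cell m)))
  refine eLpNorm_mono_ae ((ae_restrict_iff' (measurableSet_cell m)).mpr
    (Filter.Eventually.of_forall fun x hx => ?_))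
  rw [locOp, norm_mul]
  exact le_mul_of_one_le_left (norm_nonneg _) (hθ1 _ (norm_sub_lat_le hx))

end LocalEstimate

/-! ### The `L²` estimate for one Littlewood–Paley block -/

section Pieces

variable {n N : ℕ}

/-- The Littlewood–Paley pieces as Schwartz functions. -/
def lpS (φ : 𝓢(E n, ℂ)) (k : ℕ) : 𝓢(E n, ℂ) :=
  if k = 0 then φ
  else scaleS ((2 : ℝ) ^ k)⁻¹ (by positivity) φ - scaleS (2 * ((2 : ℝ) ^ k)⁻¹) (by positivity) φ

theorem coe_lpS (φ : 𝓢(E n, ℂ)) (k : ℕ) : ⇑(lpS φ k) = lpPiece φ k := by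
  ext y
  by_cases hk : k = 0
  · simp [lpS, lpPiece, hk]
  · simp [lpS, lpPiece, hk, smul_smul]

theorem IsLPGenerator.eq_zero {φ : 𝓢(E n, ℂ)} (hφ : IsLPGenerator φ) {y : E n} (hy : 2 < ‖y‖) :
    φ y = 0 := by
  refine image_eq_zero_of_notMem_tsupport fun h => ?_
  have := hφ.2 h
  rw [Metric.mem_closedBall, dist_zero_right] at this
  linarith

theorem lpS_eq_zero {φ : 𝓢(E n, ℂ)} (hφ : IsLPGenerator φ) (k : ℕ) {y : E n}
    (hy : 2 * 2 ^ k < ‖y‖) : lpS φ k y = 0 := by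
  by_cases hk : k = 0
  · subst hk
    simpa [lpS] using hφ.eq_zero (by simpa using hy)
  · have hp : (0 : ℝ) < 2 ^ k := by positivity
    have h1 : 2 < ‖((2 : ℝ) ^ k)⁻¹ • y‖ := by
      rw [norm_smul, norm_inv, Real.norm_of_nonneg hp.le, inv_mul_eq_div, lt_div_iff₀ hp]
      exact hy
    have h2 : 2 < ‖(2 * ((2 : ℝ) ^ k)⁻¹) • y‖ := by
      rw [mul_smul, norm_smul, Real.norm_of_nonneg zero_le_two]
      linarith
    simp [lpS, hk, hφ.eq_zero h1, hφ.eq_zero h2]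

/-- The convolution kernels of the Littlewood–Paley operators. -/
def lpKer (φ : 𝓢(E n, ℂ)) (k : ℕ) : 𝓢(E n, ℂ) := checkS (lpS φ k)

theorem lpBlock_eq_blk {d : ℕ} (φ : 𝓢(E n, ℂ)) (k : Fin d → ℕ) (σ : (Fin d → E n) → ℂ) :
    lpBlock φ k σ = blk (fun j => lpKer φ (k j)) σ := by
  ext X
  simp only [lpBlock, blk, lpKer, coe_checkS, coe_lpS]

theorem opT_eq (σ : (Fin (N + 1) → E n) → ℂ) (f : Fin N → 𝓢(E n, ℂ)) (x : E n) :
    opT σ (fun j => f j) x = ((2 * Real.pi : ℝ) : ℂ)⁻¹ ^ (N * n) *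
      ∫ ξ : Fin N → E n, wave x (∑ j, ξ j) * σ (Fin.cons x ξ) * ∏ j, hatS (f j) (ξ j) := by
  simp only [opT, wave, coe_hatS]

/-- The lattice points in a cube. -/
def box (n L : ℕ) : Finset (Fin n → ℤ) := Fintype.piFinset fun _ => Finset.Icc (-(L : ℤ)) L

theorem card_box (n L : ℕ) : (box n L).card = (2 * L + 1) ^ n := by
  simp only [box, Fintype.card_piFinset, Int.card_Icc, Finset.prod_const, Finset.card_univ,
    Fintype.card_fin]
  congr 1
  omega

theorem mem_box {L : ℕ} {d : Fin n → ℤ} : d ∈ box n L ↔ ∀ i, |d i| ≤ L := by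
  simp [box, Fintype.mem_piFinset, abs_le]

theorem lt_norm_lat_of_notMem_box {L : ℕ} {d : Fin n → ℤ} (h : d ∉ box n L) :
    (L : ℝ) < ‖(lat d : E n)‖ := by
  rw [mem_box] at h
  push Not at h
  obtain ⟨i, hi⟩ := h
  have h1 : (L : ℝ) < |(d i : ℝ)| := by exact_mod_cast hi
  exact h1.trans_le (PiLp.norm_apply_le (lat d : E n) i)

theorem setLIntegral_pcell_cons {F : (Fin (N + 1) → E n) → ℝ≥0∞} (hF : Measurable F)
    (l : Fin n → ℤ) (ν : Fin N → Fin n → ℤ) :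
    ∫⁻ X in pcell (Fin.cons l ν), F X = ∫⁻ x in cell l, ∫⁻ ξ in pcell ν, F (Fin.cons x ξ) := by
  rw [← measurePreserving_consE.setLIntegral_comp_preimage_emb consE.measurableEmbedding]
  have hp : consE ⁻¹' pcell (Fin.cons l ν : Fin (N + 1) → Fin n → ℤ) =
      (cell l ×ˢ pcell ν : Set (E n × (Fin N → E n))) := by
    ext p
    simp only [Set.mem_preimage, consE_apply, pcell, cell, Set.mem_ofPred_eq, Set.mem_prod]
    constructor
    · intro h
      exact ⟨congrFun h 0, funext fun j => congrFun h j.succ⟩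
    · rintro ⟨h1, h2⟩
      ext j : 1
      refine Fin.cases ?_ (fun i => ?_) j
      · exact h1
      · exact congrFun h2 i
  rw [hp, ← Measure.prod_restrict, lintegral_prod (fun p => F (consE p))
    (hF.comp consE.measurable).aemeasurable]
  simp only [consE_apply]

/-- Inside a cell every component of `ξ - ν` has norm at most `n`, so moderateness costs only a
constant independent of `ν`. -/
theorem Moderate.exists_le {W : (Fin N → E n) → ℝ} (hW : Moderate W) :
    ∃ C : ℝ≥0, ∀ ν, ∀ ξ ∈ pcell ν, W ξ ≤ C * W (fun j => lat (ν j)) := by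
  obtain ⟨-, hpos, C, M, hC, hM, h⟩ := hW
  refine ⟨⟨C * Real.sqrt (1 + N * n ^ 2) ^ M, by positivity⟩, fun ν ξ hξ => ?_⟩
  have h1 := h (fun j => lat (ν j)) (ξ - fun j => lat (ν j))
  rw [add_sub_cancel] at h1
  refine h1.trans ?_
  rw [mul_right_comm]
  change _ ≤ C * Real.sqrt (1 + N * n ^ 2) ^ M * W (fun j => lat (ν j))
  refine mul_le_mul_of_nonneg_right (mul_le_mul_of_nonneg_left ?_ hC.le) (hpos _).le
  refine Real.rpow_le_rpow (Real.sqrt_nonneg _) (Real.sqrt_le_sqrt ?_) hM.le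
  have h2 := Finset.sum_le_card_nsmul Finset.univ
    (fun j => ‖(ξ - fun j => lat (ν j)) j‖ ^ 2) ((n : ℝ) ^ 2)
    (fun j _ => pow_le_pow_left₀ (norm_nonneg _) (norm_sub_lat_le (congrFun hξ j)) 2)
  simp only [Finset.card_univ, Fintype.card_fin, nsmul_eq_mul] at h2
  linarith

theorem lintegral_cell_le_ulNorm {W : (Fin N → E n) → ℝ} (hW : Moderate W) {C : ℝ≥0}
    (hC : ∀ ν, ∀ ξ ∈ pcell ν, W ξ ≤ C * W (fun j => lat (ν j)))
    {b : (Fin (N + 1) → E n) → ℂ} (hb : Measurable b) (l : Fin n → ℤ) (ν : Fin N → Fin n → ℤ) :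
    ∫⁻ x in cell l, ∫⁻ ξ in pcell ν, ‖b (Fin.cons x ξ)‖ₑ ^ 2 ≤
      (C * ENNReal.ofReal (W fun j => lat (ν j)) *
        ulNorm (fun X => ((W (Fin.tail X) : ℝ) : ℂ)⁻¹ * b X)) ^ 2 := by
  rw [← setLIntegral_pcell_cons (F := fun X => ‖b X‖ₑ ^ 2) (hb.enorm.pow_const 2) l ν]
  have h1 : eLpNorm (fun X => ((W (Fin.tail X) : ℝ) : ℂ)⁻¹ * b X) 2
      (volume.restrict (pcell (Fin.cons l ν))) ≤
      ulNorm (fun X => ((W (Fin.tail X) : ℝ) : ℂ)⁻¹ * b X) := by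
    rw [ulNorm_eq]
    exact le_iSup (fun μ => eLpNorm (fun X => ((W (Fin.tail X) : ℝ) : ℂ)⁻¹ * b X) 2
      (volume.restrict (pcell μ))) _
  rw [mul_pow]
  refine le_trans ?_ (mul_le_mul_right (pow_le_pow_left₀ zero_le h1 2) _)
  rw [sq_eLpNorm_two, ← lintegral_const_mul' _ _ (by finiteness)]
  refine setLIntegral_mono' (measurableSet_pcell _) fun X hX => ?_
  rw [← mul_pow]
  refine pow_le_pow_left₀ zero_le ?_ 2
  have hw := hC ν (Fin.tail X) (funext fun j => congrFun hX j.succ)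
  have hpos := hW.2.1 (Fin.tail X)
  rw [enorm_mul, ← mul_assoc, ← ofReal_norm (_⁻¹ : ℂ), norm_inv, Complex.norm_real,
    Real.norm_of_nonneg hpos.le, ← ENNReal.ofReal_coe_nnreal (p := C),
    ← ENNReal.ofReal_mul C.coe_nonneg, ← ENNReal.ofReal_mul (by
      exact mul_nonneg C.coe_nonneg (hW.2.1 _).le)]
  refine le_mul_of_one_le_left zero_le ?_
  rw [ENNReal.one_le_ofReal, ← div_eq_mul_inv, one_le_div hpos]
  exact hw

/-- The factor `2^{k_0 n}` counts, up to a constant, the differences of frequency sums for which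
orthogonality may fail; the constant is independent of `σ` and `k`. -/
theorem exists_eLpNorm_opT_lpBlock_le {φ : 𝓢(E n, ℂ)} (hφ : IsLPGenerator φ)
    {W : (Fin N → E n) → ℝ} (hW : Moderate W)
    (hWB : ClassB n N (fun ν => W (fun j => lat (ν j)))) :
    ∃ C : ℝ≥0, ∀ (σ : (Fin (N + 1) → E n) → ℂ) (M : ℝ), Measurable σ → (∀ X, ‖σ X‖ ≤ M) →
      ∀ k : Fin (N + 1) → ℕ,
      ulNorm (fun X => ((W (Fin.tail X) : ℝ) : ℂ)⁻¹ * lpBlock φ k σ X) ≠ ∞ →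
      ∀ (h : Fin N → 𝓢(E n, ℂ)) (m : Fin n → ℤ),
      eLpNorm (opT (lpBlock φ k σ) fun j => h j) 2 (volume.restrict (cell m)) ^ 2 ≤
        (2 ^ k 0) ^ n * (C * ulNorm (fun X => ((W (Fin.tail X) : ℝ) : ℂ)⁻¹ * lpBlock φ k σ X) *
          ∏ j, eLpNorm (h j) 2 volume) ^ 2 := by
  obtain ⟨θ, hθ, hθ1⟩ := exists_isSynthesis_one_le n
  obtain ⟨Cθ, hCθ⟩ := exists_lintegral_weight_le θ
  obtain ⟨CW, hCW⟩ := hW.exists_le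
  obtain ⟨-, c, -, hc⟩ := hWB
  set A : ℝ≥0∞ := ENNReal.ofReal ((2 * Real.pi) ^ n) ^ (1 / 2 : ℝ) with hA
  have hAt : A ≠ ∞ := by finiteness
  let P : ℝ≥0∞ := ‖((2 * Real.pi : ℝ) : ℂ)⁻¹ ^ (N * n)‖ₑ
  -- For the `L` below, `2L + 1 = 8·2^{k_0} + 5 + 4Nn ≤ (13 + 4Nn)·2^{k_0}`.
  let L0 : ℝ≥0 := (13 + 4 * N * n : ℝ≥0)
  refine ⟨(P * (NNReal.sqrt (L0 ^ n * Cθ) * (CW * c) * A ^ N)).toNNReal,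
    fun σ M hσ hM k hU h m => ?_⟩
  have hPt : P * (NNReal.sqrt (L0 ^ n * Cθ) * (CW * c) * A ^ N) ≠ ∞ := by
    simp only [P]; finiteness
  rw [ENNReal.coe_toNNReal hPt]
  set K : Fin (N + 1) → 𝓢(E n, ℂ) := fun j => lpKer φ (k j) with hK
  have hblk : lpBlock φ k σ = blk K σ := lpBlock_eq_blk φ k σ
  rw [hblk] at hU ⊢
  set U := ulNorm (fun X => ((W (Fin.tail X) : ℝ) : ℂ)⁻¹ * blk K σ X) with hUdef
  -- This equals `2R + 2 + 2Nn` with spectral radius `R = 2·2^{k_0}`, the separation needed for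
  -- orthogonality.
  let L : ℕ := 4 * 2 ^ k 0 + 2 + 2 * N * n
  have hsupp (ζ : E n) (hζ : 2 * 2 ^ k 0 < ‖ζ‖) : lpS φ (k 0) ζ = 0 := lpS_eq_zero hφ _ hζ
  have main := eLpNorm_cell_sq_le (θ := θ) (κ := K 0) (R := 2 * 2 ^ k 0)
    (τ := blkFreq K σ) (b := fun p => blk K σ (Fin.cons p.1 p.2)) hθ hθ1 hCθ
    (isSynthesis_checkS hsupp) (bandLimited_checkS hsupp) (measurable_blkFreq K hσ)
    (norm_blkFreq_le K hM) (blk_cons_eq_blkFreq K hσ hM)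
    ((measurable_blk K hσ).comp measurable_cons) (fun p => norm_blk_le K hM _)
    (fun j => hatS (h j)) (w := fun ν => CW * (W fun j => lat (ν j)).toNNReal) (U := U.toNNReal)
    (c := CW * c) (fun l ν => by
      refine (lintegral_cell_le_ulNorm hW hCW (measurable_blk K hσ) l ν).trans_eq ?_
      rw [ENNReal.coe_toNNReal hU]
      push_cast
      rfl)
    (fun A₀ A => by
      have h1 := mul_le_mul_right (hc A₀ A) (CW : ℝ≥0∞)
      rw [← ENNReal.tsum_mul_left] at h1
      push_cast
      refine (ENNReal.tsum_le_tsum fun ν => le_of_eq ?_).trans (h1.trans_eq (by ring))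
      simp only [ENNReal.ofReal]
      ring)
    (D := box n L) (fun d hd => by
      have := lt_norm_lat_of_notMem_box hd
      simp only [L] at this
      push_cast at this
      linarith) m
  have e1 : eLpNorm (opT (blk K σ) fun j => h j) 2 (volume.restrict (cell m)) =
      P * eLpNorm (fun x => ∫ ξ : Fin N → E n, wave x (∑ j, ξ j) * blk K σ (Fin.cons x ξ) *
        ∏ j, hatS (h j) (ξ j)) 2 (volume.restrict (cell m)) := by
    rw [← eLpNorm_const_smul]
    congr 1
    ext x
    rw [opT_eq]; rfl
  have e2 : ∏ j, eLpNorm (hatS (h j)) 2 volume = A ^ N * ∏ j, eLpNorm (h j) 2 volume := by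
    simp only [eLpNorm_two_hatS, Finset.prod_mul_distrib, Finset.prod_const, Finset.card_univ,
      Fintype.card_fin]
    rfl
  have e3 : ((box n L).card : ℝ≥0∞) ≤ (L0 : ℝ≥0∞) ^ n * (2 ^ k 0) ^ n := by
    rw [card_box, ← mul_pow]
    push_cast
    gcongr
    simp only [L, L0]
    have h1 : 1 ≤ 2 ^ k 0 := Nat.one_le_two_pow
    have : 2 * (4 * 2 ^ k 0 + 2 + 2 * N * n) + 1 ≤ (13 + 4 * N * n) * 2 ^ k 0 := by
      have h2 := Nat.le_mul_of_pos_right (N * n) h1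
      have e1 : (13 + 4 * N * n) * 2 ^ k 0 = 13 * 2 ^ k 0 + 4 * (N * n * 2 ^ k 0) := by ring
      have e2 : 2 * N * n = 2 * (N * n) := by ring
      rw [e1, e2]
      omega
    exact_mod_cast this
  have hsq : (NNReal.sqrt (L0 ^ n * Cθ) : ℝ≥0∞) ^ 2 = L0 ^ n * Cθ := by
    norm_cast; exact NNReal.sq_sqrt _
  rw [e1, mul_pow]
  refine (mul_le_mul_right main _).trans ?_
  rw [e2, ENNReal.coe_toNNReal hU]
  calc _ ≤ P ^ 2 * (((L0 : ℝ≥0∞) ^ n * (2 ^ k 0) ^ n) * (Cθ * (((CW * c : ℝ≥0) : ℝ≥0∞) * U *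
        (A ^ N * ∏ j, eLpNorm (h j) 2 volume)) ^ 2)) := by gcongr
    _ = P ^ 2 * ((2 ^ k 0) ^ n * ((L0 : ℝ≥0∞) ^ n * Cθ) * ((CW * c) * U *
        (A ^ N * ∏ j, eLpNorm (h j) 2 volume)) ^ 2) := by push_cast; ring
    _ = _ := by rw [← hsq]; ring

end Pieces

/-! ### Spatial localization of the blocks -/

section Localization

variable {n N : ℕ}

theorem integral_checkS_mul_wave (Ψ : 𝓢(E n, ℂ)) (z ζ : E n) :
    ∫ ξ, checkS Ψ (ξ - ζ) * wave z ξ = wave z ζ * Ψ (-z) := by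
  rw [← integral_add_right_eq_self _ ζ, ← fourierHat_checkS, fourierHat, ← integral_const_mul]
  refine integral_congr_ae (Filter.Eventually.of_forall fun ξ => ?_)
  simp only [add_sub_cancel_right, wave, inner_add_right, inner_neg_right]
  rw [real_inner_comm z ξ, Complex.ofReal_add, mul_add, Complex.exp_add]
  push_cast
  ring_nf

/-- Smoothing in frequency with the kernel `checkS Ψ` becomes, by Fubini, multiplication of `u` by
the cutoff `Ψ(y - x)`. -/
theorem integral_checkS_mul_wave_mul_hatS (Ψ u : 𝓢(E n, ℂ)) (x ζ : E n) :
    ∫ ξ, checkS Ψ (ξ - ζ) * (wave x ξ * hatS u ξ) =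
      ∫ y, u y * (wave (x - y) ζ * Ψ (y - x)) := by
  have e (ξ y : E n) : wave x ξ * Complex.exp (-(Complex.I * ((inner ℝ y ξ : ℝ) : ℂ))) =
      wave (x - y) ξ := by
    rw [wave, wave, ← Complex.exp_add, inner_sub_left]
    push_cast; ring_nf
  have hint : Integrable (Function.uncurry fun ξ y : E n =>
      checkS Ψ (ξ - ζ) * u y * wave (x - y) ξ) (volume.prod volume) :=
    (((checkS Ψ).integrable.comp_sub_right ζ).mul_prod u.integrable).mul_bdd_measurable (M := 1)
      (measurable_wave (measurable_const.sub measurable_snd) measurable_fst)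
      (fun p => (norm_wave _ _).le)
  calc _ = ∫ ξ, ∫ y, checkS Ψ (ξ - ζ) * u y * wave (x - y) ξ := by
        refine integral_congr_ae (Filter.Eventually.of_forall fun ξ => ?_)
        simp only [coe_hatS, fourierHat, ← integral_const_mul]
        refine integral_congr_ae (Filter.Eventually.of_forall fun y => ?_)
        simp only [← e]
        ring
    _ = ∫ y, ∫ ξ, checkS Ψ (ξ - ζ) * u y * wave (x - y) ξ := integral_integral_swap hint
    _ = _ := by
        refine integral_congr_ae (Filter.Eventually.of_forall fun y => ?_)
        simp only [← neg_sub x y, ← integral_checkS_mul_wave, ← integral_const_mul]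
        refine integral_congr_ae (Filter.Eventually.of_forall fun ξ => ?_)
        simp only
        ring

theorem wave_sum (x : E n) (ξ : Fin N → E n) : wave x (∑ j, ξ j) = ∏ j, wave x (ξ j) := by
  simp only [wave, inner_sum, ← Complex.exp_sum, Complex.ofReal_sum, Finset.mul_sum]

/-- Once the `ξ` integral is done before the `ζ` integral, the symbol no longer involves `ξ`, and
the integral factors over the slots. -/
theorem opT_blk {σ : (Fin (N + 1) → E n) → ℂ} {M : ℝ} (K : Fin (N + 1) → 𝓢(E n, ℂ))
    (hσ : Measurable σ) (hM : ∀ X, ‖σ X‖ ≤ M) (f : Fin N → 𝓢(E n, ℂ)) (x : E n) :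
    opT (blk K σ) (fun j => f j) x = ((2 * Real.pi : ℝ) : ℂ)⁻¹ ^ (N * n) *
      ∫ ζ : Fin N → E n, (∏ j, ∫ ξ, K j.succ (ξ - ζ j) * (wave x ξ * hatS (f j) ξ)) *
        blkSpace K σ (x, ζ) := by
  rw [opT_eq]
  congr 1
  let F : (Fin N → E n) → (Fin N → E n) → ℂ := fun ξ ζ =>
    (∏ j, K j.succ (ξ j - ζ j) * (wave x (ξ j) * hatS (f j) (ξ j))) * blkSpace K σ (x, ζ)
  have hFm : Measurable (Function.uncurry F) := by
    refine Measurable.mul (Finset.measurable_prod _ fun j _ => Measurable.mul ?_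
      (Measurable.mul ?_ ?_)) ?_
    · exact (K j.succ).continuous.measurable.comp
        (((measurable_pi_apply j).comp measurable_fst).sub
          ((measurable_pi_apply j).comp measurable_snd))
    · exact measurable_wave measurable_const ((measurable_pi_apply j).comp measurable_fst)
    · exact (hatS (f j)).continuous.measurable.comp ((measurable_pi_apply j).comp measurable_fst)
    · exact (measurable_blkSpace K hσ).comp (measurable_const.prodMk measurable_snd)
  have hK : Integrable (fun ζ : Fin N → E n => ∏ j, K j.succ (ζ j)) :=
    integrable_prod_schwartz fun j => K j.succ
  have hb := norm_blkSpace_le K hM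
  set B := (∫ y, ‖K 0 y‖) * M
  have hFle (ξ ζ : Fin N → E n) : ‖F ξ ζ‖ ≤
      ‖∏ j, hatS (f j) (ξ j)‖ * (‖∏ j, K j.succ ((ξ - ζ) j)‖ * B) := by
    simp only [F, norm_mul, norm_prod, norm_wave, Finset.prod_const_one, one_mul, Finset.prod_mul_distrib, Pi.sub_apply]
    rw [mul_comm (∏ j, ‖K (Fin.succ j) (ξ j - ζ j)‖), mul_assoc]
    gcongr
    exact hb _
  have hFi (ξ : Fin N → E n) : Integrable (F ξ) :=
    (((hK.comp_sub_left ξ).norm.mul_const B).const_mul _).mono'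
      (hFm.comp measurable_prodMk_left).aestronglyMeasurable
      (Filter.Eventually.of_forall fun ζ => hFle ξ ζ)
  have hint : Integrable (Function.uncurry F) (volume.prod volume) := by
    rw [integrable_prod_iff hFm.aestronglyMeasurable]
    refine ⟨Filter.Eventually.of_forall hFi, ?_⟩
    refine ((integrable_prod_schwartz fun j => hatS (f j)).norm.mul_const
      ((∫ ζ : Fin N → E n, ‖∏ j, K j.succ (ζ j)‖) * B)).mono'
      (hFm.norm.stronglyMeasurable.integral_prod_right').aestronglyMeasurable
      (Filter.Eventually.of_forall fun ξ => ?_)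
    rw [Real.norm_of_nonneg (integral_nonneg fun p => norm_nonneg _)]
    refine (integral_mono (hFi ξ).norm
      (((hK.comp_sub_left ξ).norm.mul_const B).const_mul _) (fun ζ => hFle ξ ζ)).trans_eq ?_
    rw [integral_const_mul, integral_mul_const,
      integral_sub_left_eq_self (fun ζ : Fin N → E n => ‖∏ j, K j.succ (ζ j)‖)]
  calc _ = ∫ ξ, ∫ ζ, F ξ ζ := by
        refine integral_congr_ae (Filter.Eventually.of_forall fun ξ => ?_)
        simp only [blk_cons_eq_blkSpace K hσ hM, F, ← integral_const_mul, ← integral_mul_const]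
        refine integral_congr_ae (Filter.Eventually.of_forall fun ζ => ?_)
        simp only [Finset.prod_mul_distrib, wave_sum]
        ring
    _ = ∫ ζ, ∫ ξ, F ξ ζ := integral_integral_swap hint
    _ = _ := by
        refine integral_congr_ae (Filter.Eventually.of_forall fun ζ => ?_)
        simp only [F, integral_mul_const]
        congr 1
        exact integral_fintype_prod_volume_eq_prod fun j ξ =>
          K j.succ (ξ - ζ j) * (wave x ξ * hatS (f j) ξ)

/-- The output of a frequency-localized block at `x` depends only on the inputs near `x`. -/
theorem opT_lpBlock_congr {φ : 𝓢(E n, ℂ)} (hφ : IsLPGenerator φ)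
    {σ : (Fin (N + 1) → E n) → ℂ} {M : ℝ} (hσ : Measurable σ) (hM : ∀ X, ‖σ X‖ ≤ M)
    (k : Fin (N + 1) → ℕ) (f h : Fin N → 𝓢(E n, ℂ)) (x : E n)
    (hfh : ∀ j y, ‖y - x‖ ≤ 2 * 2 ^ k j.succ → f j y = h j y) :
    opT (lpBlock φ k σ) (fun j => f j) x = opT (lpBlock φ k σ) (fun j => h j) x := by
  rw [lpBlock_eq_blk, opT_blk _ hσ hM, opT_blk _ hσ hM]
  congr 1
  refine integral_congr_ae (Filter.Eventually.of_forall fun ζ => ?_)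
  simp only
  congr 1
  refine Finset.prod_congr rfl fun j _ => ?_
  simp only [lpKer, integral_checkS_mul_wave_mul_hatS]
  refine integral_congr_ae (Filter.Eventually.of_forall fun y => ?_)
  by_cases hy : ‖y - x‖ ≤ 2 * 2 ^ k j.succ
  · simp only [hfh j y hy]
  · simp only [lpS_eq_zero hφ _ (not_le.mp hy), mul_zero]

theorem exists_cutoff (f : 𝓢(E n, ℂ)) (c : E n) {ρ : ℝ} (hρ : 0 < ρ) :
    ∃ h : 𝓢(E n, ℂ), (∀ y, ‖y - c‖ ≤ ρ → h y = f y) ∧ (∀ y, ‖h y‖ ≤ ‖f y‖) ∧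
      ∀ y, ρ + 1 < ‖y - c‖ → h y = 0 := by
  let χ : ContDiffBump c := ⟨ρ, ρ + 1, hρ, by linarith⟩
  have hs : HasCompactSupport (fun y => ((χ y : ℝ) : ℂ) * f y) :=
    (χ.hasCompactSupport.comp_left (g := fun t : ℝ => (t : ℂ)) (by simp)).mul_right
  have hc : ContDiff ℝ (⊤ : ℕ∞) (fun y => ((χ y : ℝ) : ℂ) * f y) :=
    (Complex.ofRealCLM.contDiff.comp χ.contDiff).mul (f.smooth _)
  refine ⟨hs.toSchwartzMap hc, fun y hy => ?_, fun y => ?_, fun y hy => ?_⟩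
  · have : χ y = 1 := χ.one_of_mem_closedBall (by rwa [Metric.mem_closedBall, dist_eq_norm])
    change ((χ y : ℝ) : ℂ) * f y = f y
    rw [this]; simp
  · change ‖((χ y : ℝ) : ℂ) * f y‖ ≤ ‖f y‖
    rw [norm_mul, Complex.norm_real, Real.norm_of_nonneg χ.nonneg]
    exact mul_le_of_le_one_left (norm_nonneg _) χ.le_one
  · have : χ y = 0 := χ.zero_of_le_dist (by rw [dist_eq_norm]; exact hy.le)
    change ((χ y : ℝ) : ℂ) * f y = 0
    rw [this]; simp

/-- A point of the cell `m + d` with `d` outside the box is at distance more than `L - 1/2` from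
`m`, where `h` vanishes; only the cells in the box contribute. -/
theorem eLpNorm_two_le_of_support {f h : E n → ℂ} (m : Fin n → ℤ) (L : ℕ)
    (hle : ∀ y, ‖h y‖ ≤ ‖f y‖) (hs : ∀ y, (L : ℝ) - 1 < ‖y - lat m‖ → h y = 0) :
    eLpNorm h 2 volume ≤
      (∑ d ∈ box n L, eLpNorm f 2 (volume.restrict (cell (m + d))) ^ (2 : ℝ)) ^ (1 / 2 : ℝ) := by
  rw [one_div, ENNReal.le_rpow_inv_iff two_pos, rpow_two_eLpNorm_two, lintegral_eq_tsum_cell,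
    ← (Equiv.addLeft m).tsum_eq]
  simp only [Equiv.coe_addLeft]
  rw [tsum_eq_sum (s := box n L)]
  · refine Finset.sum_le_sum fun d _ => ?_
    rw [rpow_two_eLpNorm_two]
    refine lintegral_mono fun y => pow_le_pow_left₀ zero_le ?_ 2
    exact enorm_le_iff_norm_le.mpr (hle y)
  · intro d hd
    rw [setLIntegral_congr_fun (g := fun _ => 0) (measurableSet_cell _)]
    · simp
    intro y hy
    have : h y = 0 := hs y (by
      rw [mem_box] at hd
      push Not at hd
      obtain ⟨i, hi⟩ := hd
      have h1 := abs_sub_le_of_mem_cell hy i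
      have h2 : (L : ℝ) < |(d i : ℝ)| := by exact_mod_cast hi
      have h3 : |(y - lat m) i| ≤ ‖y - lat m‖ := PiLp.norm_apply_le (y - lat m : E n) i
      have h4 : (y - lat m) i = (y i - ((m + d) i : ℤ)) + d i := by
        simp only [PiLp.sub_apply, lat, Pi.add_apply, Int.cast_add]
        ring
      have h5 : |(d i : ℝ)| ≤ |(y - lat m) i| + |y i - ((m + d) i : ℤ)| := by
        have := abs_sub ((y - lat m) i) (y i - ((m + d) i : ℤ))
        rwa [h4, add_sub_cancel_left, ← h4] at this
      linarith)
    simp [this]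

/-- For `x` in the cell `m`, the block sees `f_j` only within `2·2^{k_j} + n` of `m`. Replacing
`f_j` by a cutoff equal to it there turns the global norms of the previous estimate into sums over
nearby cells. -/
theorem exists_eLpNorm_opT_lpBlock_le_shift {φ : 𝓢(E n, ℂ)} (hφ : IsLPGenerator φ)
    {W : (Fin N → E n) → ℝ} (hW : Moderate W)
    (hWB : ClassB n N (fun ν => W (fun j => lat (ν j)))) :
    ∃ C : ℝ≥0, ∀ (σ : (Fin (N + 1) → E n) → ℂ) (M : ℝ), Measurable σ → (∀ X, ‖σ X‖ ≤ M) →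
      ∀ k : Fin (N + 1) → ℕ,
      ulNorm (fun X => ((W (Fin.tail X) : ℝ) : ℂ)⁻¹ * lpBlock φ k σ X) ≠ ∞ →
      ∀ (f : Fin N → 𝓢(E n, ℂ)) (m : Fin n → ℤ),
      eLpNorm (opT (lpBlock φ k σ) fun j => f j) 2 (volume.restrict (cell m)) ≤
        C * ((2 : ℝ≥0∞) ^ ((n : ℝ) / 2 * k 0) *
          ulNorm (fun X => ((W (Fin.tail X) : ℝ) : ℂ)⁻¹ * lpBlock φ k σ X)) *
          ∏ j, (∑ d ∈ box n (2 * 2 ^ k j.succ + n + 3),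
            eLpNorm (f j) 2 (volume.restrict (cell (m + d))) ^ (2 : ℝ)) ^ (1 / 2 : ℝ) := by
  obtain ⟨C, hC⟩ := exists_eLpNorm_opT_lpBlock_le hφ hW hWB
  refine ⟨C, fun σ M hσ hM k hU f m => ?_⟩
  have hcut (j : Fin N) := exists_cutoff (f j) (lat m)
    (ρ := 2 * 2 ^ k j.succ + n) (by positivity)
  choose h h1 h2 h3 using hcut
  have e : eLpNorm (opT (lpBlock φ k σ) fun j => f j) 2 (volume.restrict (cell m)) =
      eLpNorm (opT (lpBlock φ k σ) fun j => h j) 2 (volume.restrict (cell m)) := by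
    refine eLpNorm_congr_ae ((ae_restrict_iff' (measurableSet_cell m)).mpr
      (Filter.Eventually.of_forall fun x hx => ?_))
    refine opT_lpBlock_congr hφ hσ hM k f h x fun j y hy => (h1 j y ?_).symm
    have h4 := norm_sub_lat_le hx
    have h5 := norm_add_le (y - x) (x - lat m)
    rw [sub_add_sub_cancel] at h5
    linarith
  have main := hC σ M hσ hM k hU h m
  rw [e]
  refine le_trans ?_ (mul_le_mul_right (Finset.prod_le_prod' fun j _ =>
    eLpNorm_two_le_of_support (f := f j) (h := h j) m (2 * 2 ^ k j.succ + n + 3) (h2 j)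
      fun y hy => h3 j y (by push_cast at hy; linarith)) _)
  rw [← ENNReal.pow_le_pow_left_iff two_ne_zero]
  refine main.trans_eq ?_
  have hp : ((2 : ℝ≥0∞) ^ ((n : ℝ) / 2 * k 0)) ^ 2 = (2 ^ k 0) ^ n := by
    rw [← ENNReal.rpow_natCast, ← ENNReal.rpow_mul, ← pow_mul, ← ENNReal.rpow_natCast]
    congr 1
    push_cast
    ring
  rw [← hp]
  ring

/-- The side of the box is `4·2^k + 2n + 7 ≤ (11 + 2n)·2^k`. With `p = min(2, q_j)` this gives the
factor `2^{s_j k_j}`. -/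
theorem card_box_rpow_le (k : ℕ) {p : ℝ} (hp : 0 < p) :
    ((box n (2 * 2 ^ k + n + 3)).card : ℝ≥0∞) ^ (1 / p) ≤
      (((11 + 2 * n : ℝ≥0) ^ (n / p) : ℝ≥0) : ℝ≥0∞) * (2 : ℝ≥0∞) ^ (n / p * k) := by
  have h1 : ((box n (2 * 2 ^ k + n + 3)).card : ℝ≥0∞) ≤
      (((11 + 2 * n : ℝ≥0) : ℝ≥0∞) * 2 ^ k) ^ n := by
    rw [card_box]
    push_cast
    gcongr
    have h1 : 1 ≤ 2 ^ k := Nat.one_le_two_pow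
    have h2 := Nat.le_mul_of_pos_right n h1
    have : 2 * (2 * 2 ^ k + n + 3) + 1 ≤ (11 + 2 * n) * 2 ^ k := by
      rw [show (11 + 2 * n) * 2 ^ k = 11 * 2 ^ k + 2 * (n * 2 ^ k) by ring]
      omega
    exact_mod_cast this
  refine (ENNReal.rpow_le_rpow h1 (by positivity)).trans_eq ?_
  rw [← ENNReal.rpow_natCast, ← ENNReal.rpow_mul, ENNReal.mul_rpow_of_nonneg _ _ (by positivity),
    ENNReal.coe_rpow_of_nonneg _ (by positivity), ← ENNReal.rpow_natCast, ← ENNReal.rpow_mul]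
  congr 2 <;> ring

end Localization

theorem seqNorm_const_mul {K : Type*} [MeasurableSpace K] [MeasurableSingletonClass K]
    {q : ℝ≥0∞} (hq : 0 < q) (c : ℝ≥0∞) (a : K → ℝ≥0∞) :
    seqNorm q (fun k => c * a k) = c * seqNorm q a := by
  rcases eq_or_ne q ∞ with rfl | ht
  · simp only [seqNorm_top, ENNReal.mul_iSup]
  · have hp := ENNReal.toReal_pos hq.ne' ht
    rw [seqNorm_eq_tsum hq.ne' ht, seqNorm_eq_tsum hq.ne' ht]
    simp only [ENNReal.mul_rpow_of_nonneg _ _ hp.le, ENNReal.tsum_mul_left]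
    rw [ENNReal.mul_rpow_of_nonneg _ _ (by positivity), ← ENNReal.rpow_mul,
      mul_one_div_cancel hp.ne', ENNReal.rpow_one]

/-! ### Summation over cells and over blocks -/

section Summation

variable {n N : ℕ}

theorem ulNorm_ne_top_of_symbolNorm {φ : 𝓢(E n, ℂ)} {W : (Fin N → E n) → ℝ}
    {s : Fin (N + 1) → ℝ} {t : ℝ≥0∞} (ht : t ≠ 0) {σ : (Fin (N + 1) → E n) → ℂ}
    (h : symbolNorm φ W s t σ < ∞) (k : Fin (N + 1) → ℕ) :
    ulNorm (fun X => ((W (Fin.tail X) : ℝ) : ℂ)⁻¹ * lpBlock φ k σ X) ≠ ∞ := by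
  intro e
  have h1 := (le_seqNorm ht (fun k : Fin (N + 1) → ℕ => (2 : ℝ≥0∞) ^ (∑ j, s j * (k j : ℝ)) *
    ulNorm (fun X => ((W (Fin.tail X) : ℝ) : ℂ)⁻¹ * lpBlock φ k σ X)) k).trans_lt h
  simp only [e] at h1
  rw [ENNReal.mul_top (ENNReal.rpow_pos (by simp) (by simp)).ne'] at h1
  exact lt_irrefl _ h1

theorem exists_seqNorm_tsum_opT_lpBlock_le {φ : 𝓢(E n, ℂ)} (hφ : IsLPGenerator φ)
    {W : (Fin N → E n) → ℝ} (hW : Moderate W)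
    (hWB : ClassB n N (fun ν => W (fun j => lat (ν j))))
    {q : Fin N → ℝ≥0∞} (hq : ∀ j, 0 < q j) {r : ℝ≥0∞} (hr : 0 < r)
    (hqr : ∑ j, (q j)⁻¹ = r⁻¹)
    {s : Fin (N + 1) → ℝ} (hs₀ : s 0 = (n : ℝ) / 2)
    (hs : ∀ j : Fin N, s j.succ = (n : ℝ) / (min 2 (q j)).toReal) :
    ∃ C : ℝ≥0, ∀ (σ : (Fin (N + 1) → E n) → ℂ) (M : ℝ), Measurable σ → (∀ X, ‖σ X‖ ≤ M) →
      symbolNorm φ W s (min 1 r) σ < ∞ → ∀ f : Fin N → 𝓢(E n, ℂ),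
      seqNorm r (fun m : Fin n → ℤ => ∑' k : Fin (N + 1) → ℕ,
        eLpNorm (opT (lpBlock φ k σ) fun j => f j) 2 (volume.restrict (cell m))) ≤
      C * symbolNorm φ W s (min 1 r) σ * ∏ j, amalgamNorm 2 (q j) (f j) := by
  obtain ⟨C, hC⟩ := exists_eLpNorm_opT_lpBlock_le_shift hφ hW hWB
  let p : Fin N → ℝ := fun j => (min 2 (q j)).toReal
  have hp (j : Fin N) : 0 < p j := ENNReal.toReal_pos (lt_min two_pos (hq j)).ne'
    ((min_le_left _ _).trans_lt (by simp)).ne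
  let c : Fin N → ℝ≥0 := fun j => (11 + 2 * n : ℝ≥0) ^ (n / p j)
  refine ⟨C * ∏ j, c j, fun σ M hσ hM hfin f => ?_⟩
  have ht : min 1 r ≠ 0 := (lt_min one_pos hr).ne'
  have hU := ulNorm_ne_top_of_symbolNorm ht hfin
  let U : (Fin (N + 1) → ℕ) → ℝ≥0∞ := fun k =>
    ulNorm (fun X => ((W (Fin.tail X) : ℝ) : ℂ)⁻¹ * lpBlock φ k σ X)
  let a : Fin N → (Fin n → ℤ) → ℝ≥0∞ := fun j m => eLpNorm (f j) 2 (volume.restrict (cell m))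
  have ha (j : Fin N) : seqNorm (q j) (a j) = amalgamNorm 2 (q j) (f j) :=
    (amalgamNorm_eq 2 (q j) (f j)).symm
  have key (k : Fin (N + 1) → ℕ) :
      seqNorm r (fun m : Fin n → ℤ =>
        eLpNorm (opT (lpBlock φ k σ) fun j => f j) 2 (volume.restrict (cell m))) ≤
      ((C * ∏ j, (c j : ℝ≥0∞)) * ∏ j, amalgamNorm 2 (q j) (f j)) *
        ((2 : ℝ≥0∞) ^ (∑ j, s j * (k j : ℝ)) * U k) := by
    calc _ ≤ seqNorm r (fun m : Fin n → ℤ => (C * ((2 : ℝ≥0∞) ^ ((n : ℝ) / 2 * k 0) * U k)) *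
          ∏ j, (∑ d ∈ box n (2 * 2 ^ k j.succ + n + 3), a j (m + d) ^ (2 : ℝ)) ^ (1 / 2 : ℝ)) :=
          seqNorm_mono fun m => hC σ M hσ hM k (hU k) f m
      _ = (C * ((2 : ℝ≥0∞) ^ ((n : ℝ) / 2 * k 0) * U k)) * seqNorm r (fun m : Fin n → ℤ =>
          ∏ j, (∑ d ∈ box n (2 * 2 ^ k j.succ + n + 3), a j (m + d) ^ (2 : ℝ)) ^ (1 / 2 : ℝ)) :=
          seqNorm_const_mul hr _ _
      _ ≤ (C * ((2 : ℝ≥0∞) ^ ((n : ℝ) / 2 * k 0) * U k)) *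
          ∏ j, ((c j : ℝ≥0∞) * (2 : ℝ≥0∞) ^ (n / p j * k j.succ) * seqNorm (q j) (a j)) := by
          gcongr
          -- Hölder in `m` first, then the loss from shifts in each factor separately.
          refine (seqNorm_prod_le Finset.univ q _ (fun j m => ?_) hqr).trans ?_
          · refine ENNReal.rpow_ne_top_of_nonneg (by norm_num) (ENNReal.sum_ne_top.mpr fun d _ =>
              ENNReal.rpow_ne_top_of_nonneg (by norm_num) (eLpNorm_two_restrict_ne_top _ _))
          · refine Finset.prod_le_prod' fun j _ => ?_
            refine (seqNorm_shift_sum_le (hq j) _ (a j)).trans ?_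
            gcongr
            exact card_box_rpow_le _ (hp j)
      _ = _ := by
          simp only [ha, Finset.prod_mul_distrib]
          have e : (2 : ℝ≥0∞) ^ (∑ j, s j * (k j : ℝ)) = (2 : ℝ≥0∞) ^ ((n : ℝ) / 2 * k 0) *
              ∏ j : Fin N, (2 : ℝ≥0∞) ^ (n / p j * k j.succ) := by
            rw [Fin.sum_univ_succ, ENNReal.rpow_add _ _ (by simp) (by simp), hs₀]
            congr 1
            simp only [hs]
            induction (Finset.univ : Finset (Fin N)) using Finset.induction_on with
            | empty => simp
            | insert j S hj ih =>
              rw [Finset.sum_insert hj, Finset.prod_insert hj,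
                ENNReal.rpow_add _ _ (by simp) (by simp), ih]
          rw [e]
          ring
  -- The per-block bounds carry exactly the weights `2^{s·k}`, so their `ℓ^{min(1,r)}` norm is the
  -- symbol norm.
  refine (seqNorm_tsum_le_seqNorm hr _).trans ((seqNorm_mono key).trans_eq ?_)
  rw [seqNorm_const_mul (lt_min one_pos hr)]
  push_cast
  change _ * symbolNorm φ W s (min 1 r) σ = _
  ring

end Summation

/-! ### Approximate identities acting on bounded functions -/

section Convergence

open Filter

section General

variable {V : Type*} [NormedAddCommGroup V] [NormedSpace ℝ V] [FiniteDimensional ℝ V]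
  [MeasureSpace V] [BorelSpace V] [(volume : Measure V).IsAddHaarMeasure]

/-- Continuity of translations in `L¹`. -/
theorem tendsto_lintegral_enorm_translate_sub {f : V → ℂ} (hf : Integrable f) :
    Tendsto (fun h : V => ∫⁻ x, ‖f (x - h) - f x‖ₑ) (𝓝 0) (𝓝 0) := by
  have hmp (h : V) : MeasurePreserving (fun x : V => x - h) volume volume :=
    measurePreserving_sub_right volume h
  let g : V → C(V, V) := fun h => ⟨fun x => x - h, by fun_prop⟩
  have hg : Continuous g :=
    ContinuousMap.continuous_of_continuous_uncurry g (by
      change Continuous fun p : V × V => p.2 - p.1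
      fun_prop)
  have hf1 : MemLp f 1 volume := memLp_one_iff_integrable.mpr hf
  let F : Lp ℂ 1 (volume : Measure V) := hf1.toLp f
  have hc := (continuous_const (y := F)).compMeasurePreservingLp hg hmp ENNReal.one_ne_top
  have ht := hc.tendsto 0
  rw [tendsto_iff_edist_tendsto_0] at ht
  refine ht.congr fun h => ?_
  have e (h : V) : Lp.compMeasurePreserving (g h) (hmp h) F =ᵐ[volume] fun x => f (x - h) :=
    (Lp.coeFn_compMeasurePreserving F (hmp h)).trans
      ((hmp h).quasiMeasurePreserving.ae_eq_comp hf1.coeFn_toLp)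
  rw [Lp.edist_def, eLpNorm_one_eq_lintegral_enorm]
  refine lintegral_congr_ae ?_
  filter_upwards [e h, e 0] with x h1 h2
  rw [Pi.sub_apply, h1, h2, sub_zero]

/-- A bounded `σ` need not be integrable, so `L¹` continuity of translation is applied to `g σ` and
to `g`, and the two are recombined. -/
theorem tendsto_lintegral_enorm_mul_translate_sub {g σ : V → ℂ} (hg : Integrable g)
    (hgm : Measurable g) (hσ : Measurable σ) {M : ℝ} (hM : ∀ x, ‖σ x‖ ≤ M) :
    Tendsto (fun h : V => ∫⁻ x, ‖g x‖ₑ * ‖σ (x - h) - σ x‖ₑ) (𝓝 0) (𝓝 0) := by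
  have h1 := tendsto_lintegral_enorm_translate_sub (hg.mul_bdd_measurable hσ hM)
  have h2 := tendsto_lintegral_enorm_translate_sub hg
  have h3 := h1.add (ENNReal.Tendsto.const_mul (a := ENNReal.ofReal M) h2
    (Or.inr ENNReal.ofReal_ne_top))
  rw [mul_zero, add_zero] at h3
  refine tendsto_of_tendsto_of_tendsto_of_le_of_le tendsto_const_nhds h3 (fun _ => zero_le)
    fun h => ?_
  dsimp only
  have hgσ := hgm.mul hσ
  rw [← lintegral_const_mul' _ _ ENNReal.ofReal_ne_top, ← lintegral_add_left
    (f := fun x => ‖g (x - h) * σ (x - h) - g x * σ x‖ₑ)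
    ((hgσ.comp (measurable_id.sub_const h)).sub hgσ).enorm]
  refine lintegral_mono fun x => ?_
  have e : g x * (σ (x - h) - σ x) =
      (g (x - h) * σ (x - h) - g x * σ x) - (g (x - h) - g x) * σ (x - h) := by ring
  rw [← enorm_mul, e]
  refine (enorm_sub_le).trans ?_
  gcongr
  rw [enorm_mul, mul_comm]
  gcongr
  rw [← ofReal_norm]
  exact ENNReal.ofReal_le_ofReal (hM _)

/-- Approximate identities converge in weighted `L¹`. -/
theorem tendsto_lintegral_approxIdentity {g σ P : V → ℂ} (hg : Integrable g)
    (hgm : Measurable g) (hσ : Measurable σ) {M : ℝ} (hM : ∀ x, ‖σ x‖ ≤ M) (hP : Integrable P)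
    (hPm : Measurable P) (hP1 : ∫ z, P z = 1) {ε : ℕ → ℝ} (hε : Tendsto ε atTop (𝓝 0)) :
    Tendsto (fun K => ∫⁻ x, ‖g x‖ₑ * ‖(∫ z, P z * σ (x - ε K • z)) - σ x‖ₑ) atTop (𝓝 0) := by
  let D : V → ℝ≥0∞ := fun h => ∫⁻ x, ‖g x‖ₑ * ‖σ (x - h) - σ x‖ₑ
  have hDb (h : V) : D h ≤ ENNReal.ofReal (2 * M) * ∫⁻ x, ‖g x‖ₑ := by
    rw [← lintegral_const_mul' _ _ ENNReal.ofReal_ne_top]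
    refine lintegral_mono fun x => ?_
    dsimp only
    rw [mul_comm]
    gcongr
    rw [← ofReal_norm]
    refine ENNReal.ofReal_le_ofReal ((norm_sub_le _ _).trans ?_)
    linarith [hM (x - h), hM x]
  have hmeas (t : ℝ) : Measurable (fun p : V × V => ‖g p.1‖ₑ * ‖σ (p.1 - t • p.2) - σ p.1‖ₑ) :=
    (hgm.comp measurable_fst).enorm.mul ((hσ.comp (measurable_fst.sub
      (measurable_snd.const_smul t))).sub (hσ.comp measurable_fst)).enorm
  have hDm (t : ℝ) : Measurable (fun z => D (t • z)) := (hmeas t).lintegral_prod_left'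
  -- Dominated convergence in `z`: the translation modulus `D` is bounded by `2M‖g‖_1` and tends to
  -- `0` at the origin.
  have hlim : Tendsto (fun K => ∫⁻ z, ‖P z‖ₑ * D (ε K • z)) atTop (𝓝 (∫⁻ z : V, 0)) := by
    refine tendsto_lintegral_of_dominated_convergence
      (fun z => ‖P z‖ₑ * (ENNReal.ofReal (2 * M) * ∫⁻ x, ‖g x‖ₑ))
      (fun K => hPm.enorm.mul (hDm _)) (fun K => Eventually.of_forall fun z => by
        dsimp only; gcongr; exact hDb _) ?_ (Eventually.of_forall fun z => ?_)
    · rw [lintegral_mul_const _ hPm.enorm]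
      exact ENNReal.mul_ne_top hP.2.ne (ENNReal.mul_ne_top ENNReal.ofReal_ne_top hg.2.ne)
    · have h1 : Tendsto (fun K => ε K • z) atTop (𝓝 0) := by
        simpa using hε.smul_const z
      have h2 := (tendsto_lintegral_enorm_mul_translate_sub hg hgm hσ hM).comp h1
      simpa using ENNReal.Tendsto.const_mul (a := ‖P z‖ₑ) h2 (Or.inr enorm_ne_top)
  rw [lintegral_zero] at hlim
  refine tendsto_of_tendsto_of_tendsto_of_le_of_le tendsto_const_nhds hlim (fun _ => zero_le)
    fun K => ?_
  dsimp only
  have key (x : V) : ‖g x‖ₑ * ‖(∫ z, P z * σ (x - ε K • z)) - σ x‖ₑ ≤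
      ∫⁻ z, ‖P z‖ₑ * (‖g x‖ₑ * ‖σ (x - ε K • z) - σ x‖ₑ) := by
    have e : (∫ z, P z * σ (x - ε K • z)) - σ x = ∫ z, P z * (σ (x - ε K • z) - σ x) := by
      simp only [mul_sub]
      have hi : Integrable (fun z => P z * σ (x - ε K • z)) :=
        hP.mul_bdd_measurable (g := fun z => σ (x - ε K • z)) (hσ.comp (measurable_const.sub
          (measurable_id.const_smul _))) fun _ => hM _
      rw [integral_sub hi (hP.mul_const _), integral_mul_const, hP1, one_mul]
    rw [e]
    refine (mul_le_mul_right (enorm_integral_le_lintegral_enorm _) _).trans_eq ?_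
    rw [← lintegral_const_mul' _ _ enorm_ne_top]
    refine lintegral_congr fun z => ?_
    rw [enorm_mul]; ring
  refine (lintegral_mono key).trans_eq ?_
  rw [lintegral_lintegral_swap]
  · refine lintegral_congr fun z => ?_
    rw [lintegral_const_mul' _ _ enorm_ne_top]
  · exact ((hPm.comp measurable_snd).enorm.mul (hmeas (ε K))).aemeasurable

end General

end Convergence

/-! ### Partial sums of the blocks and convergence of the operators -/

section PartialSums

open Filter

variable {n d N : ℕ}

/-- The sum telescopes, since the term subtracted at level `K + 1` is the dilate kept at level `K`.
-/
theorem sum_lpS (φ : 𝓢(E n, ℂ)) (K : ℕ) :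
    ∑ i ∈ Finset.range (K + 1), lpS φ i = scaleS ((2 : ℝ) ^ K)⁻¹ (by positivity) φ := by
  induction K with
  | zero => ext y; simp [lpS]
  | succ K ih =>
    have e : 2 * ((2 : ℝ) ^ (K + 1))⁻¹ = ((2 : ℝ) ^ K)⁻¹ := by
      rw [pow_succ]; field_simp
    rw [Finset.sum_range_succ, ih, lpS, if_neg K.succ_ne_zero]
    ext y
    simp [e]

theorem integrable_exp_mul (f : 𝓢(E n, ℂ)) (x : E n) :
    Integrable fun ξ => Complex.exp (Complex.I * ((inner ℝ x ξ : ℝ) : ℂ)) * f ξ :=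
  f.integrable.bdd_mul (c := 1) (Continuous.aestronglyMeasurable (by fun_prop))
    (Eventually.of_forall fun _ => (norm_exp_I_mul_ofReal _).le)

theorem checkS_sum {ι : Type*} (S : Finset ι) (f : ι → 𝓢(E n, ℂ)) (x : E n) :
    checkS (∑ i ∈ S, f i) x = ∑ i ∈ S, checkS (f i) x := by
  simp only [coe_checkS, fourierCheck, sum_apply, Finset.mul_sum]
  rw [integral_finsetSum _ fun i _ => integrable_exp_mul (f i) x, Finset.mul_sum]

theorem checkS_scaleS_inv {a : ℝ} (ha : 0 < a) (φ : 𝓢(E n, ℂ)) (x : E n) :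
    checkS (scaleS a⁻¹ (inv_ne_zero ha.ne') φ) x = (a : ℂ) ^ n * checkS φ (a • x) := by
  simp only [coe_checkS, fourierCheck, scaleS_apply]
  have h := Measure.integral_comp_inv_smul (volume : Measure (E n))
    (fun ζ => Complex.exp (Complex.I * ((inner ℝ (a • x) ζ : ℝ) : ℂ)) * φ ζ) a
  have e (ζ : E n) : inner ℝ (a • x) (a⁻¹ • ζ) = inner ℝ x ζ := by
    rw [real_inner_smul_left, real_inner_smul_right, mul_inv_cancel_left₀ ha.ne']
  simp only [e, finrank_euclideanSpace, Fintype.card_fin, abs_of_pos (pow_pos ha n),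
    Complex.real_smul] at h
  rw [h]
  push_cast
  ring

theorem sum_lpKer (φ : 𝓢(E n, ℂ)) (K : ℕ) (x : E n) :
    ∑ i ∈ Finset.range (K + 1), lpKer φ i x =
      ((2 ^ K : ℝ) : ℂ) ^ n * checkS φ ((2 ^ K : ℝ) • x) := by
  simp only [lpKer]
  rw [← checkS_sum, sum_lpS, checkS_scaleS_inv (by positivity)]

/-- Indices of the blocks with frequencies of size at most `2 ^ K`. -/
def lowIdx (d K : ℕ) : Finset (Fin d → ℕ) := Fintype.piFinset fun _ => Finset.range (K + 1)

theorem integrable_blk_translate {σ : (Fin d → E n) → ℂ} {M : ℝ} (K : Fin d → 𝓢(E n, ℂ))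
    (hσ : Measurable σ) (hM : ∀ X, ‖σ X‖ ≤ M) (X : Fin d → E n) :
    Integrable fun Y : Fin d → E n => (∏ j, K j (Y j)) * σ (X - Y) :=
  (integrable_prod_schwartz K).mul_bdd_measurable (g := fun Y => σ (X - Y))
    (hσ.comp (measurable_const.sub measurable_id)) fun _ => hM _

/-- Over a full box of indices the sum of products is a product of sums, each telescoping to one
dilated kernel; rescaling the variable exhibits an approximate identity at scale `2^{-K}`. -/
theorem sum_lpBlock (φ : 𝓢(E n, ℂ)) {σ : (Fin d → E n) → ℂ} {M : ℝ}
    (hσ : Measurable σ) (hM : ∀ X, ‖σ X‖ ≤ M) (K : ℕ) (X : Fin d → E n) :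
    ∑ k ∈ lowIdx d K, lpBlock φ k σ X =
      ∫ Z : Fin d → E n, (∏ j, checkS φ (Z j)) * σ (X - ((2 : ℝ) ^ K)⁻¹ • Z) := by
  have ha : (0 : ℝ) < 2 ^ K := by positivity
  simp only [lpBlock_eq_blk, blk]
  rw [← integral_finsetSum _ fun k _ => integrable_blk_translate _ hσ hM X]
  have e (Y : Fin d → E n) : ∑ k ∈ lowIdx d K, (∏ j, lpKer φ (k j) (Y j)) * σ (X - Y) =
      ((2 ^ K : ℝ) : ℂ) ^ (d * n) * ((∏ j, checkS φ (((2 ^ K : ℝ) • Y) j)) *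
        σ (X - ((2 : ℝ) ^ K)⁻¹ • ((2 : ℝ) ^ K) • Y)) := by
    rw [← Finset.sum_mul, lowIdx, ← Finset.prod_univ_sum (fun _ => Finset.range (K + 1))
      (fun j i => lpKer φ i (Y j)), inv_smul_smul₀ ha.ne']
    simp only [sum_lpKer, Finset.prod_mul_distrib, Finset.prod_const, Finset.card_univ,
      Fintype.card_fin, ← pow_mul, Pi.smul_apply]
    rw [mul_comm n d, mul_assoc]
  simp only [e, integral_const_mul]
  rw [Measure.integral_comp_smul (volume : Measure (Fin d → E n))
    (fun Z => (∏ j, checkS φ (Z j)) * σ (X - ((2 : ℝ) ^ K)⁻¹ • Z)) ((2 : ℝ) ^ K)]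
  have hf : Module.finrank ℝ (Fin d → E n) = d * n := by
    simp [Module.finrank_pi_fintype]
  rw [hf, abs_of_pos (by positivity), Complex.real_smul, ← mul_assoc]
  push_cast
  rw [mul_inv_cancel₀ (pow_ne_zero _ (pow_ne_zero _ two_ne_zero)), one_mul]

theorem integral_prod_checkS {φ : 𝓢(E n, ℂ)} (hφ : IsLPGenerator φ) :
    ∫ Z : Fin d → E n, ∏ j, checkS φ (Z j) = 1 := by
  rw [integral_fintype_prod_volume_eq_prod]
  simp [integral_checkS, hφ.1 0]

theorem integrable_opT {σ : (Fin (N + 1) → E n) → ℂ} {M : ℝ} (hσ : Measurable σ)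
    (hM : ∀ X, ‖σ X‖ ≤ M) (f : Fin N → 𝓢(E n, ℂ)) (x : E n) :
    Integrable fun ξ : Fin N → E n =>
      wave x (∑ j, ξ j) * σ (Fin.cons x ξ) * ∏ j, hatS (f j) (ξ j) := by
  have h := ((integrable_prod_schwartz fun j => hatS (f j)).mul_bdd_measurable
    (g := fun ξ => wave x (∑ j, ξ j) * σ (Fin.cons x ξ)) (M := M)
    ((measurable_wave measurable_const measurable_sum_freq).mul
      (hσ.comp (measurable_cons.comp (measurable_const.prodMk measurable_id))))
    fun ξ => by rw [norm_mul, norm_wave, one_mul]; exact hM _)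
  refine h.congr (Eventually.of_forall fun ξ => ?_)
  dsimp only
  ring

theorem measurable_opT {σ : (Fin (N + 1) → E n) → ℂ} (hσ : Measurable σ)
    (f : Fin N → 𝓢(E n, ℂ)) : Measurable (opT σ fun j => f j) := by
  simp only [funext (opT_eq σ f)]
  refine Measurable.const_mul ?_ _
  have : Measurable (fun p : E n × (Fin N → E n) =>
      wave p.1 (∑ j, p.2 j) * σ (Fin.cons p.1 p.2) * ∏ j, hatS (f j) (p.2 j)) :=
    ((measurable_wave measurable_fst (measurable_sum_freq.comp measurable_snd)).mul
      (hσ.comp measurable_cons)).mul ((measurable_prod_schwartz _).comp measurable_snd)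
  exact (this.stronglyMeasurable.integral_prod_right').measurable

theorem measurable_lpBlock (φ : 𝓢(E n, ℂ)) (k : Fin d → ℕ) {σ : (Fin d → E n) → ℂ}
    (hσ : Measurable σ) : Measurable (lpBlock φ k σ) := by
  rw [lpBlock_eq_blk]; exact measurable_blk _ hσ

theorem opT_sum_lpBlock (φ : 𝓢(E n, ℂ)) {σ : (Fin (N + 1) → E n) → ℂ} {M : ℝ}
    (hσ : Measurable σ) (hM : ∀ X, ‖σ X‖ ≤ M) (f : Fin N → 𝓢(E n, ℂ))
    (S : Finset (Fin (N + 1) → ℕ)) :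
    opT (fun X => ∑ k ∈ S, lpBlock φ k σ X) (fun j => f j) =
      ∑ k ∈ S, opT (lpBlock φ k σ) fun j => f j := by
  ext x
  simp only [Finset.sum_apply, opT_eq, ← Finset.mul_sum]
  rw [← integral_finsetSum]
  · simp only [Finset.mul_sum, Finset.sum_mul]
  · intro k _
    simp only [lpBlock_eq_blk]
    exact integrable_opT (measurable_blk _ hσ) (norm_blk_le _ hM) f x

/-- The difference of two operators on a bounded set is controlled by a weighted `L¹` distance
of the symbols. -/
theorem setLIntegral_enorm_opT_sub_le {σ τ : (Fin (N + 1) → E n) → ℂ} {M M' : ℝ}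
    (hσ : Measurable σ) (hM : ∀ X, ‖σ X‖ ≤ M) (hτ : Measurable τ) (hM' : ∀ X, ‖τ X‖ ≤ M')
    (f : Fin N → 𝓢(E n, ℂ)) {s : Set (E n)} (hs : MeasurableSet s) :
    ∫⁻ x in s, ‖opT τ (fun j => f j) x - opT σ (fun j => f j) x‖ₑ ≤
      ‖((2 * Real.pi : ℝ) : ℂ)⁻¹ ^ (N * n)‖ₑ * ∫⁻ X : Fin (N + 1) → E n,
        ‖s.indicator (fun _ => (1 : ℂ)) (X 0) * ∏ j, hatS (f j) (X j.succ)‖ₑ * ‖τ X - σ X‖ₑ := by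
  have hm : Measurable fun p : E n × (Fin N → E n) =>
      ‖(∏ j, hatS (f j) (p.2 j)) * (τ (Fin.cons p.1 p.2) - σ (Fin.cons p.1 p.2))‖ₑ :=
    (((measurable_prod_schwartz fun j => hatS (f j)).comp measurable_snd).mul
      ((hτ.comp measurable_cons).sub (hσ.comp measurable_cons))).enorm
  have hi : Measurable (s.indicator fun _ => (1 : ℂ)) := measurable_const.indicator hs
  rw [lintegral_cons, Measure.volume_eq_prod, lintegral_prod _ (by
    simp only [Fin.cons_zero, Fin.cons_succ]
    exact ((((hi.comp measurable_fst).mul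
      ((measurable_prod_schwartz fun j => hatS (f j)).comp measurable_snd)).enorm).mul
      ((hτ.comp measurable_cons).sub (hσ.comp measurable_cons)).enorm).aemeasurable),
    ← lintegral_indicator hs, ← lintegral_const_mul' _ _ enorm_ne_top]
  refine lintegral_mono fun x => ?_
  by_cases hx : x ∈ s
  · simp only [Set.indicator_of_mem hx, Fin.cons_zero, Fin.cons_succ, one_mul]
    rw [opT_eq, opT_eq, ← mul_sub, ← integral_sub (integrable_opT hτ hM' f x)
      (integrable_opT hσ hM f x), enorm_mul]
    gcongr
    refine (enorm_integral_le_lintegral_enorm _).trans_eq (lintegral_congr fun ξ => ?_)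
    rw [← sub_mul, ← mul_sub, enorm_mul, enorm_mul, ← ofReal_norm (wave _ _), norm_wave,
      ENNReal.ofReal_one, one_mul, mul_comm]
  · simp [Set.indicator_of_notMem hx]

theorem integrable_indicator_mul_prod (f : Fin N → 𝓢(E n, ℂ)) {s : Set (E n)}
    (hs : MeasurableSet s) (hsv : volume s ≠ ∞) :
    Integrable fun X : Fin (N + 1) → E n =>
      s.indicator (fun _ => (1 : ℂ)) (X 0) * ∏ j, f j (X j.succ) := by
  have h1 : Integrable (s.indicator fun _ => (1 : ℂ)) (volume : Measure (E n)) :=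
    (integrable_indicator_iff hs).mpr (integrableOn_const hsv)
  have h2 := h1.mul_prod (integrable_prod_schwartz f)
  rw [← measurePreserving_consE.integrable_comp_emb consE.measurableEmbedding]
  refine h2.congr (Eventually.of_forall fun p => ?_)
  simp only [Function.comp, consE_apply, Fin.cons_zero, Fin.cons_succ]

/-- The `L¹` distance on `s` is dominated by the distance of the symbols with weight `1_s(x) ∏
f̂_j(ξ_j)`, integrable because `s` has finite measure. -/
theorem tendsto_setLIntegral_enorm_opT_sub {φ : 𝓢(E n, ℂ)} (hφ : IsLPGenerator φ)
    {σ : (Fin (N + 1) → E n) → ℂ} {M : ℝ} (hσ : Measurable σ) (hM : ∀ X, ‖σ X‖ ≤ M)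
    (f : Fin N → 𝓢(E n, ℂ)) {s : Set (E n)} (hs : MeasurableSet s) (hsv : volume s ≠ ∞) :
    Tendsto (fun K => ∫⁻ x in s, ‖(∑ k ∈ lowIdx (N + 1) K, opT (lpBlock φ k σ) fun j => f j) x -
      opT σ (fun j => f j) x‖ₑ) atTop (𝓝 0) := by
  have hg := integrable_indicator_mul_prod (fun j => hatS (f j)) hs hsv
  have hgm : Measurable fun X : Fin (N + 1) → E n =>
      s.indicator (fun _ => (1 : ℂ)) (X 0) * ∏ j, hatS (f j) (X (Fin.succ j)) :=
    ((measurable_const.indicator hs).comp (measurable_pi_apply 0)).mul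
      ((measurable_prod_schwartz fun j => hatS (f j)).comp
        (measurable_pi_lambda _ fun j => measurable_pi_apply (Fin.succ j)))
  have hε : Tendsto (fun K : ℕ => ((2 : ℝ) ^ K)⁻¹) atTop (𝓝 0) :=
    tendsto_inv_atTop_zero.comp (tendsto_pow_atTop_atTop_of_one_lt one_lt_two)
  have h := tendsto_lintegral_approxIdentity hg hgm hσ hM
    (integrable_prod_schwartz fun _ : Fin (N + 1) => checkS φ)
    (measurable_prod_schwartz fun _ => checkS φ) (integral_prod_checkS hφ) hε
  have h2 := ENNReal.Tendsto.const_mul (a := ‖((2 * Real.pi : ℝ) : ℂ)⁻¹ ^ (N * n)‖ₑ) h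
    (Or.inr enorm_ne_top)
  rw [mul_zero] at h2
  refine tendsto_of_tendsto_of_tendsto_of_le_of_le tendsto_const_nhds h2 (fun _ => zero_le)
    fun K => ?_
  dsimp only
  have hb (X : Fin (N + 1) → E n) : ‖∑ k ∈ lowIdx (N + 1) K, lpBlock φ k σ X‖ ≤
      (∫ Y : Fin (N + 1) → E n, ‖∏ j, checkS φ (Y j)‖) * M := by
    rw [sum_lpBlock φ hσ hM]
    exact norm_integral_mul_le (integrable_prod_schwartz fun _ => checkS φ) fun _ => hM _
  have h3 := setLIntegral_enorm_opT_sub_le hσ hM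
    (Finset.measurable_sum _ fun k _ => measurable_lpBlock φ k hσ) hb f hs
  rw [opT_sum_lpBlock φ hσ hM] at h3
  simpa only [sum_lpBlock φ hσ hM] using h3

/-- On a bounded set, the `L²` norm of `T_σ` is at most the sum of those of the blocks. -/
theorem eLpNorm_opT_le_tsum {φ : 𝓢(E n, ℂ)} (hφ : IsLPGenerator φ)
    {σ : (Fin (N + 1) → E n) → ℂ} {M : ℝ} (hσ : Measurable σ) (hM : ∀ X, ‖σ X‖ ≤ M)
    (f : Fin N → 𝓢(E n, ℂ)) {s : Set (E n)} (hs : MeasurableSet s) (hsv : volume s ≠ ∞) :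
    eLpNorm (opT σ fun j => f j) 2 (volume.restrict s) ≤
      ∑' k, eLpNorm (opT (lpBlock φ k σ) fun j => f j) 2 (volume.restrict s) := by
  have hmk (k : Fin (N + 1) → ℕ) : AEStronglyMeasurable (opT (lpBlock φ k σ) fun j => f j)
      (volume.restrict s) :=
    (measurable_opT (measurable_lpBlock φ k hσ) f).aestronglyMeasurable
  have hmS (K : ℕ) : AEStronglyMeasurable
      (∑ k ∈ lowIdx (N + 1) K, opT (lpBlock φ k σ) fun j => f j) (volume.restrict s) :=
    Finset.aestronglyMeasurable_sum _ fun k _ => hmk k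
  have ht := tendsto_setLIntegral_enorm_opT_sub hφ hσ hM f hs hsv
  -- Convergence in `L¹` gives an almost everywhere convergent subsequence, to which Fatou in `L²`
  -- applies.
  have hmeas : TendstoInMeasure (volume.restrict s)
      (fun K => ∑ k ∈ lowIdx (N + 1) K, opT (lpBlock φ k σ) fun j => f j) atTop
      (opT σ fun j => f j) := by
    refine tendstoInMeasure_of_tendsto_eLpNorm one_ne_zero hmS
      (measurable_opT hσ f).aestronglyMeasurable ?_
    simp only [eLpNorm_one_eq_lintegral_enorm, Pi.sub_apply]
    exact ht
  obtain ⟨ns, -, hns⟩ := hmeas.exists_seq_tendsto_ae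
  refine Lp.eLpNorm_le_of_ae_tendsto (f := fun i =>
    ∑ k ∈ lowIdx (N + 1) (ns i), opT (lpBlock φ k σ) fun j => f j)
    (Eventually.of_forall fun i => ?_) (fun i => hmS _) hns
  exact (eLpNorm_sum_le (fun k _ => hmk k) one_le_two).trans (ENNReal.sum_le_tsum _)

end PartialSums

/-! ### Independence of the representative of the symbol -/

section Representatives

variable {n d N : ℕ}

/-- Convolution ignores null sets, so the blocks agree at every point and not merely almost
everywhere. -/
theorem lpBlock_congr_ae (φ : 𝓢(E n, ℂ)) (k : Fin d → ℕ) {σ τ : (Fin d → E n) → ℂ}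
    (h : σ =ᵐ[volume] τ) : lpBlock φ k σ = lpBlock φ k τ := by
  ext X
  refine integral_congr_ae ?_
  have h1 : (fun Y => σ (X - Y)) =ᵐ[volume] fun Y => τ (X - Y) :=
    (Measure.measurePreserving_sub_left volume X).quasiMeasurePreserving.ae_eq_comp h
  filter_upwards [h1] with Y hY
  rw [hY]

theorem symbolNorm_congr_ae (φ : 𝓢(E n, ℂ)) (W : (Fin N → E n) → ℝ) (s : Fin (N + 1) → ℝ)
    (t : ℝ≥0∞) {σ τ : (Fin (N + 1) → E n) → ℂ} (h : σ =ᵐ[volume] τ) :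
    symbolNorm φ W s t σ = symbolNorm φ W s t τ := by
  simp only [symbolNorm, lpBlock_congr_ae φ _ h]

/-- By Fubini the slices of the two symbols agree for almost every `x` only, hence the weaker
conclusion. -/
theorem opT_congr_ae {σ τ : (Fin (N + 1) → E n) → ℂ} (h : σ =ᵐ[volume] τ)
    (f : Fin N → E n → ℂ) : opT σ f =ᵐ[volume] opT τ f := by
  have h1 := measurePreserving_consE.quasiMeasurePreserving.ae_eq_comp h
  filter_upwards [Measure.ae_ae_of_ae_prod h1] with x hx
  rw [opT, opT]
  congr 1
  refine integral_congr_ae ?_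
  filter_upwards [hx] with ξ hξ
  simp only [Function.comp, consE_apply] at hξ
  rw [hξ]

/-- An essentially bounded function has a bounded measurable representative. -/
theorem exists_measurable_bounded_ae_eq {α : Type*} [MeasurableSpace α] {μ : Measure α}
    {f : α → ℂ} (hf : MemLp f ∞ μ) :
    ∃ (g : α → ℂ) (M : ℝ), Measurable g ∧ (∀ x, ‖g x‖ ≤ M) ∧ f =ᵐ[μ] g := by
  set M := (eLpNorm f ∞ μ).toReal with hMdef
  have hm := hf.1.stronglyMeasurable_mk.measurable
  have hs : MeasurableSet {x | ‖hf.1.mk f x‖ ≤ M} := measurableSet_le hm.norm measurable_const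
  refine ⟨{x | ‖hf.1.mk f x‖ ≤ M}.indicator (hf.1.mk f), M, hm.indicator hs, fun x => ?_, ?_⟩
  · by_cases hx : x ∈ {x | ‖hf.1.mk f x‖ ≤ M}
    · rw [Set.indicator_of_mem hx]; exact hx
    · rw [Set.indicator_of_notMem hx, norm_zero]; exact ENNReal.toReal_nonneg
  · have hb : ∀ᵐ x ∂μ, ‖f x‖ₑ ≤ eLpNorm f ∞ μ := by
      rw [eLpNorm_exponent_top]; exact enorm_ae_le_eLpNormEssSup f μ
    filter_upwards [hf.1.ae_eq_mk, hb] with x h1 h2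
    have hx : x ∈ {x | ‖hf.1.mk f x‖ ≤ M} := by
      change ‖hf.1.mk f x‖ ≤ M
      rw [← h1, hMdef, ← toReal_enorm]
      exact ENNReal.toReal_mono hf.2.ne h2
    rw [Set.indicator_of_mem hx, ← h1]

end Representatives

end MultiPsiDO

end

theorem theorem5p3 (n N : ℕ) (hn : 0 < n) (hN : 0 < N)
    (φ : 𝓢(MultiPsiDO.E n, ℂ)) (hφ : MultiPsiDO.IsLPGenerator φ)
    (W : (Fin N → MultiPsiDO.E n) → ℝ) (hW : MultiPsiDO.Moderate W)
    (hWB : MultiPsiDO.ClassB n N (fun ν => W (fun j => MultiPsiDO.lat (ν j))))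
    (q : Fin N → ℝ≥0∞) (hq : ∀ j, 0 < q j) (r : ℝ≥0∞) (hr : 0 < r)
    (hqr : ∑ j, (q j)⁻¹ = r⁻¹)
    (s : Fin (N + 1) → ℝ) (hs₀ : s 0 = (n : ℝ) / 2)
    (hs : ∀ j : Fin N, s j.succ = (n : ℝ) / (min 2 (q j)).toReal)
    (σ : (Fin (N + 1) → MultiPsiDO.E n) → ℂ)
    (hσ : MultiPsiDO.MemSymbol φ W s (min 1 r) σ) :
    MultiPsiDO.BoundedOnAmalgams q r (MultiPsiDO.opT σ) := by
  -- The estimates above need an everywhere bounded Borel symbol. Passing to one leaves the symbol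
  -- norm unchanged and alters the operator's output only on a null set.
  obtain ⟨τ, M, hτ, hM, hστ⟩ := MultiPsiDO.exists_measurable_bounded_ae_eq hσ.1
  have hfin := hσ.2
  rw [MultiPsiDO.symbolNorm_congr_ae φ W s _ hστ] at hfin
  obtain ⟨C, hC⟩ := MultiPsiDO.exists_seqNorm_tsum_opT_lpBlock_le hφ hW hWB hq hr hqr hs₀ hs
  refine ⟨C * (MultiPsiDO.symbolNorm φ W s (min 1 r) τ).toNNReal, fun f _ => ⟨?_, ?_⟩⟩
  · exact (MultiPsiDO.measurable_opT hτ f).aestronglyMeasurable.congr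
      (MultiPsiDO.opT_congr_ae hστ _).symm
  · rw [MultiPsiDO.amalgamNorm_eq, ENNReal.coe_mul, ENNReal.coe_toNNReal hfin.ne]
    refine (MultiPsiDO.seqNorm_mono fun m => ?_).trans (hC τ M hτ hM hfin f)
    rw [eLpNorm_congr_ae (ae_restrict_of_ae (MultiPsiDO.opT_congr_ae hστ _))]
    exact MultiPsiDO.eLpNorm_opT_le_tsum hφ hτ hM f (MultiPsiDO.measurableSet_cell m)
      (MultiPsiDO.volume_cell_lt_top m).ne
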